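/- **Conventions.** Algebras are associative algebras over $\mathbb C$, possibly without identity, with non-degenerate product; $M(A)$ is the multiplier algebra of $A$, and $\iota$ denotes identity maps. A *regular multiplier Hopf algebra* is an algebra $A$ with a coassociative homomorphism $\Delta_A:A\to M(A\otimes A)$ such that $a\otimes b\mapsto\Delta_A(a)(1\otimes b)$, $(a\otimes 1)\Delta_A(b)$, $\Delta_A(a)(b\otimes 1)$ and $(1\otimes a)\Delta_A(b)$ are bijections from $A\otimes A$ to $A\otimes A$. We write $\Delta_A(a)=\sum a_{(1)}\otimes a_{(2)}$, the legs being covered by multiplication or by an action. Let $C$ and $D$ be regular multiplier Hopf algebras. * $C$ is a *left $D$-module algebra*: there is a left action $\triangleright$ of $D$ on $C$ such that the elements $d\triangleright c$ span $C$ and $d\triangleright(cc')=\sum(d_{(1)}\triangleright c)(d_{(2)}\triangleright c')$. The *smash product* $CD$ is the space $C\otimes D$, with $c\otimes d$ written $cd$, and with the product $(cd)(c'd')=\sum c(d_{(1)}\triangleright c')\,d_{(2)}d'$. Put $R(d\otimes c)=\sum (d_{(1)}\triangleright c)\otimes d_{(2)}$ and $R^{\rm op}(d\otimes c)=\sum (d_{(2)}\triangleright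 c)\otimes d_{(1)}$; these are maps from $D\otimes C$ to $C\otimes D$. * Let $M_0(D\otimes C)$ be the space of elements $x$ for which $x(1\otimes c)$ and $(1\otimes c)x$ are in $D\otimes C$ for all $c\in C$, i.e. of pairs of linear maps $c\mapsto x(1\otimes c)$ and $c\mapsto(1\otimes c)x$ from $C$ to $D\otimes C$ with $(1\otimes c)(x(1\otimes c'))=((1\otimes c)x)(1\otimes c')$. A *right coaction* of $C$ on $D$ is an injective linear map $\Gamma:D\to M_0(D\otimes C)$ with $(\Gamma\otimes\iota)\Gamma=(\iota\otimes\Delta_C)\Gamma$. Put $T(c\otimes d)=(1\otimes c)\Gamma(d)$ and $T^{\rm op}(c\otimes d)=\Gamma(d)(1\otimes c)$; these are maps from $C\otimes D$ to $D\otimes C$. * $D$ is a *right $C$-comodule coalgebra*: there is a right coaction $\Gamma$ of $C$ on $D$ such that, for all $c\in C$ and $d,d'\in D$, the elements $\big((T\otimes\iota)(c\otimes\Delta_D(d))\big)(d'\otimes1\otimes1)$ and $(d'\otimes1\otimes1)\big((T\otimes\iota)(c\otimes\Delta_D(d))\big)$ are in $D\otimes C\otimes D$ (where the third factor is read after multiplication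 with elements of $D$), and $$(\Delta_D\otimes\iota)T=(\iota\otimes T)(T\otimes\iota)(\iota\otimes\Delta_D)\quad\text{on } C\otimes D,$$ read after multiplication with $d'\otimes 1\otimes 1$ from the right and from the left. * Put $P=T^{\rm op}\circ R^{\rm op}:D\otimes C\to D\otimes C$, that is, $P(d\otimes c)=\sum\Gamma(d_{(1)})(1\otimes(d_{(2)}\triangleright c))$. Write $m_D$ for the product of $D$, and $P_{ij}$ for $P$ acting on the factors $i$ and $j$ of a threefold tensor product. **Theorem.** Let $C$ and $D$ be regular multiplier Hopf algebras such that $C$ is a left $D$-module algebra and $D$ is a right $C$-comodule coalgebra. Assume that $$P(m_D\otimes\iota)=(m_D\otimes\iota)P_{13}P_{23}\ \text{ on } D\otimes D\otimes C,\qquad (\iota\otimes\Delta_C)P=P_{12}P_{13}(\iota\otimes\Delta_C)\ \text{ on } D\otimes C,$$ the second equation being read after multiplication with $1\otimes1\otimes c'$ from the right for all $c'\in C$, and that $P=T\circ R$ on $D\otimes C$. Then there is exactly one linear map $\Delta_\#:CD\to M(CD\otimes CD)$ such that $$\Delta_\#(cd)=\sum\Delta_C(c)\,\Gamma(d_{(1)})\,(1\otimes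 d_{(2)})\qquad(c\in C,\ d\in D),$$ i.e. such that $\Delta_\#(cd)(x\otimes d'y)=\Delta_C(c)\sum\Gamma(p_i)(x\otimes q_iy)$ for all $x,y\in CD$ and $d'\in D$, where $\sum p_i\otimes q_i=\Delta_D(d)(1\otimes d')$. Here $D$ acts on $CD$ by $d(c'd')=\sum(d_{(1)}\triangleright c')(d_{(2)}d')$, and $\Delta_C(c)$ and $\Gamma(p)$ act on $CD\otimes CD$ from the left in the natural way, through left multiplication by $C$ and $D$ on $CD$. This map $\Delta_\#$ (the smash coproduct) is an algebra homomorphism. -/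

import Mathlib

open scoped TensorProduct

noncomputable section

/-! ### Algebras and multipliers

Algebras are associative algebras over `ℂ`, not necessarily with an identity. -/

/-- The product is non-degenerate as a bilinear map. -/
def NondegenerateMul (A : Type*) [NonUnitalNonAssocRing A] : Prop :=
  (∀ a : A, (∀ b, a * b = 0) → a = 0) ∧ (∀ a : A, (∀ b, b * a = 0) → a = 0)

/-- The multiplier algebra `M(A)`. A multiplier `m` is given by its left and its right action
`a ↦ m a` and `a ↦ a m` on `A`, such that `m (a b) = (m a) b`, `(a b) m = a (b m)` and
`a (m b) = (a m) b`. The product of `M(A)` is composition: `(m n) a = m (n a)` and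
`a (m n) = (a m) n`. -/
def multiplierSubalgebra (A : Type*) [NonUnitalNonAssocRing A] [Module ℂ A]
    [IsScalarTower ℂ A A] [SMulCommClass ℂ A A] :
    Subalgebra ℂ (Module.End ℂ A × (Module.End ℂ A)ᵐᵒᵖ) where
  carrier := {m | (∀ a b : A, m.1 (a * b) = m.1 a * b) ∧
    (∀ a b : A, m.2.unop (a * b) = a * m.2.unop b) ∧
    (∀ a b : A, a * m.1 b = m.2.unop a * b)}
  mul_mem' := by
    rintro m n ⟨h1, h2, h3⟩ ⟨k1, k2, k3⟩
    refine ⟨fun a b => ?_, fun a b => ?_, fun a b => ?_⟩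
    · simp [h1, k1]
    · simp [h2, k2]
    · simp [h3, k3]
  add_mem' := by
    rintro m n ⟨h1, h2, h3⟩ ⟨k1, k2, k3⟩
    refine ⟨fun a b => ?_, fun a b => ?_, fun a b => ?_⟩
    · simp [h1, k1, add_mul]
    · simp [h2, k2, mul_add]
    · simp [h3, k3, add_mul, mul_add]
  algebraMap_mem' := by
    intro r
    refine ⟨fun a b => ?_, fun a b => ?_, fun a b => ?_⟩ <;>
      simp [Algebra.algebraMap_eq_smul_one, smul_mul_assoc, mul_smul_comm]

/-- The multiplier algebra `M(A)` as a type; it is a unital `ℂ`-algebra. -/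
abbrev Multiplier (A : Type*) [NonUnitalNonAssocRing A] [Module ℂ A]
    [IsScalarTower ℂ A A] [SMulCommClass ℂ A A] : Type _ :=
  ↥(multiplierSubalgebra A)

/-- The left action `a ↦ m a` of a multiplier. -/
def Multiplier.left {A : Type*} [NonUnitalNonAssocRing A] [Module ℂ A]
    [IsScalarTower ℂ A A] [SMulCommClass ℂ A A] (m : Multiplier A) : A →ₗ[ℂ] A :=
  m.1.1

/-- The right action `a ↦ a m` of a multiplier. -/
def Multiplier.right {A : Type*} [NonUnitalNonAssocRing A] [Module ℂ A]
    [IsScalarTower ℂ A A] [SMulCommClass ℂ A A] (m : Multiplier A) : A →ₗ[ℂ] A :=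
  m.1.2.unop

/-! ### Regular multiplier Hopf algebras -/

/-- A regular multiplier Hopf algebra: an algebra `A` over `ℂ` with non-degenerate product, and a
coproduct `Δ`, a homomorphism from `A` to `M(A ⊗ A)`, such that the four maps
* `T₁ (a ⊗ b) = Δ(a)(1 ⊗ b)`,
* `T₂ (a ⊗ b) = (a ⊗ 1)Δ(b)`,
* `T₃ (a ⊗ b) = Δ(a)(b ⊗ 1)`,
* `T₄ (a ⊗ b) = (1 ⊗ a)Δ(b)`

have range in `A ⊗ A` and are bijections of `A ⊗ A`. The conditions on `T₁`, `T₂` say that `(A, Δ)`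
is a multiplier Hopf algebra, those on `T₃`, `T₄` say the same of the opposite coproduct.
As the product of `A ⊗ A` is non-degenerate, a multiplier of `A ⊗ A` is determined
by its left action, and by its right action, so that `Δ` determines the maps `Tᵢ`. -/
class RegularMultiplierHopfAlgebra (A : Type*) [NonUnitalRing A] [Module ℂ A]
    [IsScalarTower ℂ A A] [SMulCommClass ℂ A A] where
  nondegenerate : NondegenerateMul A
  /-- the coproduct -/
  Δ : A →ₙₐ[ℂ] Multiplier (A ⊗[ℂ] A)
  /-- `T₁ (a ⊗ b) = Δ(a)(1 ⊗ b)` -/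
  T₁ : A ⊗[ℂ] A ≃ₗ[ℂ] A ⊗[ℂ] A
  /-- `T₂ (a ⊗ b) = (a ⊗ 1)Δ(b)` -/
  T₂ : A ⊗[ℂ] A ≃ₗ[ℂ] A ⊗[ℂ] A
  /-- `T₃ (a ⊗ b) = Δ(a)(b ⊗ 1)` -/
  T₃ : A ⊗[ℂ] A ≃ₗ[ℂ] A ⊗[ℂ] A
  /-- `T₄ (a ⊗ b) = (1 ⊗ a)Δ(b)` -/
  T₄ : A ⊗[ℂ] A ≃ₗ[ℂ] A ⊗[ℂ] A
  T₁_spec : ∀ a b p q : A, (Δ a).left (p ⊗ₜ (b * q)) = T₁ (a ⊗ₜ b) * (p ⊗ₜ q)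
  T₂_spec : ∀ a b p q : A, (Δ b).right ((p * a) ⊗ₜ q) = (p ⊗ₜ q) * T₂ (a ⊗ₜ b)
  T₃_spec : ∀ a b p q : A, (Δ a).left ((b * p) ⊗ₜ q) = T₃ (a ⊗ₜ b) * (p ⊗ₜ q)
  T₄_spec : ∀ a b p q : A, (Δ b).right (p ⊗ₜ (q * a)) = (p ⊗ₜ q) * T₄ (a ⊗ₜ b)
  /-- Coassociativity
  `(a ⊗ 1 ⊗ 1) (Δ ⊗ ι)(Δ(b)(1 ⊗ c)) = (ι ⊗ Δ)((a ⊗ 1)Δ(b)) (1 ⊗ 1 ⊗ c)`. -/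
  coassoc : ∀ a b c : A,
    TensorProduct.assoc ℂ A A A (LinearMap.rTensor A T₂.toLinearMap
      ((TensorProduct.assoc ℂ A A A).symm (a ⊗ₜ T₁ (b ⊗ₜ c)))) =
    LinearMap.lTensor A T₁.toLinearMap
      (TensorProduct.assoc ℂ A A A (T₂ (a ⊗ₜ b) ⊗ₜ c))

open RegularMultiplierHopfAlgebra

/-! ### Left module algebras, the maps `R` and `Rᵒᵖ` -/

/-- A unital left action `d ▷ c = act d c` of a regular multiplier Hopf algebra `D` on an algebra
`C` that makes `C` a left `D`-module algebra.

The last field is `d ▷ (c c') = ∑ (d₁ ▷ c)(d₂ ▷ c')`, where `d₂` is covered by writing `c'` as a sum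
of elements `e ▷ c'`: it says `d ▷ (c (e ▷ c')) = ∑ (p ▷ c)(q ▷ c')` where
`∑ p ⊗ q = Δ(d)(1 ⊗ e)`. -/
class LeftModuleAlgebra (D C : Type*)
    [NonUnitalRing D] [Module ℂ D] [IsScalarTower ℂ D D] [SMulCommClass ℂ D D]
    [RegularMultiplierHopfAlgebra D]
    [NonUnitalRing C] [Module ℂ C] [IsScalarTower ℂ C C] [SMulCommClass ℂ C C] where
  /-- the action -/
  act : D →ₗ[ℂ] C →ₗ[ℂ] C
  mul_act : ∀ (d d' : D) (c : C), act (d * d') c = act d (act d' c)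
  unital : Submodule.span ℂ {x : C | ∃ d c, act d c = x} = ⊤
  act_mul : ∀ (d e : D) (c c' : C),
    act d (c * act e c') =
      TensorProduct.lift ((LinearMap.mul ℂ C).compl₁₂ (act.flip c) (act.flip c'))
        (T₁ (d ⊗ₜ[ℂ] e))

section Action

variable (D C : Type*)
  [NonUnitalRing D] [Module ℂ D] [IsScalarTower ℂ D D] [SMulCommClass ℂ D D]
  [RegularMultiplierHopfAlgebra D]
  [NonUnitalRing C] [Module ℂ C] [IsScalarTower ℂ C C] [SMulCommClass ℂ C C]
  [LeftModuleAlgebra D C]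

/-- The action as a map `D ⊗ C → C`, `d ⊗ c ↦ d ▷ c`. -/
def actMap : D ⊗[ℂ] C →ₗ[ℂ] C := TensorProduct.lift LeftModuleAlgebra.act

theorem actMap_surjective : Function.Surjective (actMap D C) := by
  rw [← LinearMap.range_eq_top, eq_top_iff, ← LeftModuleAlgebra.unital (D := D) (C := C),
    Submodule.span_le]
  rintro _ ⟨d, c, rfl⟩
  exact ⟨d ⊗ₜ c, by simp [actMap]⟩

theorem exists_actSection : ∃ s : C →ₗ[ℂ] D ⊗[ℂ] C, actMap D C ∘ₗ s = LinearMap.id :=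
  LinearMap.exists_rightInverse_of_surjective _
    (LinearMap.range_eq_top.2 (actMap_surjective D C))

/-- A linear way to write each `c : C` as a sum of elements `e ▷ c'`. The maps defined with
it below do not depend on the choice, see `twist_act` and `twistOp_act`. -/
def actSection : C →ₗ[ℂ] D ⊗[ℂ] C := (exists_actSection D C).choose

theorem actMap_actSection (c : C) : actMap D C (actSection D C c) = c :=
  LinearMap.congr_fun (exists_actSection D C).choose_spec c

/-- `d ⊗ (e ⊗ c) ↦ ∑ (p ▷ c) ⊗ q` where `∑ p ⊗ q = Δ(d)(e ⊗ 1)`. -/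
def twistAux : D ⊗[ℂ] (D ⊗[ℂ] C) →ₗ[ℂ] C ⊗[ℂ] D :=
  LinearMap.rTensor D (actMap D C) ∘ₗ
    (TensorProduct.rightComm ℂ D D C).toLinearMap ∘ₗ
    LinearMap.rTensor C (T₃ (A := D)).toLinearMap ∘ₗ
    (TensorProduct.assoc ℂ D D C).symm.toLinearMap

/-- `d ⊗ (e ⊗ c) ↦ ∑ (q ▷ c) ⊗ p` where `∑ p ⊗ q = Δ(d)(1 ⊗ e)`. -/
def twistOpAux : D ⊗[ℂ] (D ⊗[ℂ] C) →ₗ[ℂ] C ⊗[ℂ] D :=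
  (TensorProduct.comm ℂ D C).toLinearMap ∘ₗ
    LinearMap.lTensor D (actMap D C) ∘ₗ
    (TensorProduct.assoc ℂ D D C).toLinearMap ∘ₗ
    LinearMap.rTensor C (T₁ (A := D)).toLinearMap ∘ₗ
    (TensorProduct.assoc ℂ D D C).symm.toLinearMap

/-- The twist map `R (d ⊗ c) = ∑ (d₁ ▷ c) ⊗ d₂`. Here `d₁` is covered by `c` through the
action: for `c = ∑ eᵢ ▷ cᵢ` the value is `∑ (d₁ eᵢ ▷ cᵢ) ⊗ d₂`. -/
def twist : D ⊗[ℂ] C →ₗ[ℂ] C ⊗[ℂ] D :=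
  twistAux D C ∘ₗ LinearMap.lTensor D (actSection D C)

/-- The twist map `Rᵒᵖ (d ⊗ c) = ∑ (d₂ ▷ c) ⊗ d₁`. Here `d₂` is covered by `c` through the
action: for `c = ∑ eᵢ ▷ cᵢ` the value is `∑ (d₂ eᵢ ▷ cᵢ) ⊗ d₁`. -/
def twistOp : D ⊗[ℂ] C →ₗ[ℂ] C ⊗[ℂ] D :=
  twistOpAux D C ∘ₗ LinearMap.lTensor D (actSection D C)

variable {D C}

/-- An element of `M ⊗ B` is zero if it is killed by right multiplication with `B`. -/
theorem tensor_eq_zero_of_mulRight {M B : Type*} [AddCommGroup M] [Module ℂ M]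
    [NonUnitalRing B] [Module ℂ B] [IsScalarTower ℂ B B] [SMulCommClass ℂ B B]
    (hB : NondegenerateMul B) (x : M ⊗[ℂ] B)
    (h : ∀ b, LinearMap.lTensor M (LinearMap.mulRight ℂ b) x = 0) : x = 0 := by
  let e := TensorProduct.equivFinsuppOfBasisLeft (N := B) (Module.Free.chooseBasis ℂ M)
  apply e.injective
  rw [map_zero]
  ext i
  refine hB.1 _ fun b => ?_
  have key : ∀ y : M ⊗[ℂ] B,
      e (LinearMap.lTensor M (LinearMap.mulRight ℂ b) y) i = e y i * b := by
    intro y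
    induction y using TensorProduct.induction_on with
    | zero => simp
    | tmul m c => simp [e, smul_mul_assoc]
    | add y z hy hz => simp only [map_add, Finsupp.add_apply, hy, hz, add_mul]
  rw [← key, h, map_zero, Finsupp.zero_apply]

theorem tensor_eq_of_mulRight {M B : Type*} [AddCommGroup M] [Module ℂ M]
    [NonUnitalRing B] [Module ℂ B] [IsScalarTower ℂ B B] [SMulCommClass ℂ B B]
    (hB : NondegenerateMul B) (x y : M ⊗[ℂ] B)
    (h : ∀ b, LinearMap.lTensor M (LinearMap.mulRight ℂ b) x =
      LinearMap.lTensor M (LinearMap.mulRight ℂ b) y) : x = y :=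
  sub_eq_zero.1 (tensor_eq_zero_of_mulRight hB _ fun b => by rw [map_sub, h, sub_self])

theorem mul_tmul_eq {A : Type*} [NonUnitalRing A] [Module ℂ A] [IsScalarTower ℂ A A]
    [SMulCommClass ℂ A A] (x : A ⊗[ℂ] A) (p q : A) :
    x * (p ⊗ₜ q) = LinearMap.lTensor A (LinearMap.mulRight ℂ q)
      (LinearMap.rTensor A (LinearMap.mulRight ℂ p) x) := by
  induction x using TensorProduct.induction_on with
  | zero => simp
  | tmul m c => simp
  | add y z hy hz => simp only [map_add, add_mul, hy, hz]

theorem tensor_eq_of_mul {A : Type*} [NonUnitalRing A] [Module ℂ A] [IsScalarTower ℂ A A]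
    [SMulCommClass ℂ A A] (hA : NondegenerateMul A) (x y : A ⊗[ℂ] A)
    (h : ∀ p q : A, x * (p ⊗ₜ q) = y * (p ⊗ₜ q)) : x = y := by
  have h1 : ∀ p, LinearMap.rTensor A (LinearMap.mulRight ℂ p) x =
      LinearMap.rTensor A (LinearMap.mulRight ℂ p) y := fun p =>
    tensor_eq_of_mulRight hA _ _ fun q => by rw [← mul_tmul_eq, ← mul_tmul_eq, h]
  apply (TensorProduct.comm ℂ A A).injective
  refine tensor_eq_of_mulRight hA _ _ fun p => ?_
  rw [LinearMap.lTensor_comm, LinearMap.lTensor_comm, h1]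

/-- `(Δ(d)(e ⊗ 1))(1 ⊗ d') = (Δ(d)(1 ⊗ d'))(e ⊗ 1)`. -/
theorem T₃_mul_T₁ (d e d' : D) :
    LinearMap.lTensor D (LinearMap.mulRight ℂ d') (T₃ (d ⊗ₜ[ℂ] e)) =
      LinearMap.rTensor D (LinearMap.mulRight ℂ e) (T₁ (d ⊗ₜ[ℂ] d')) := by
  refine tensor_eq_of_mul nondegenerate _ _ fun p q => ?_
  have a1 : ∀ x : D ⊗[ℂ] D, LinearMap.lTensor D (LinearMap.mulRight ℂ d') x * (p ⊗ₜ q) =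
      x * (p ⊗ₜ (d' * q)) := by
    intro x
    induction x using TensorProduct.induction_on with
    | zero => simp
    | tmul m c => simp [mul_assoc]
    | add y z hy hz => simp only [map_add, add_mul, hy, hz]
  have a2 : ∀ x : D ⊗[ℂ] D, LinearMap.rTensor D (LinearMap.mulRight ℂ e) x * (p ⊗ₜ q) =
      x * ((e * p) ⊗ₜ q) := by
    intro x
    induction x using TensorProduct.induction_on with
    | zero => simp
    | tmul m c => simp [mul_assoc]
    | add y z hy hz => simp only [map_add, add_mul, hy, hz]
  rw [a1, a2, ← T₃_spec, ← T₁_spec]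

theorem twistAux_mul (d d' : D) (z : D ⊗[ℂ] C) :
    LinearMap.lTensor C (LinearMap.mulRight ℂ d') (twistAux D C (d ⊗ₜ z)) =
      LinearMap.rTensor D (LeftModuleAlgebra.act.flip (actMap D C z)) (T₁ (d ⊗ₜ[ℂ] d')) := by
  induction z using TensorProduct.induction_on with
  | zero => simp
  | add y z hy hz =>
    simp only [TensorProduct.tmul_add, map_add, hy, hz, LinearMap.rTensor_add,
      LinearMap.add_apply]
  | tmul e c =>
    have b1 : ∀ x : D ⊗[ℂ] D, LinearMap.lTensor C (LinearMap.mulRight ℂ d')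
        (LinearMap.rTensor D (actMap D C) (TensorProduct.rightComm ℂ D D C (x ⊗ₜ c))) =
        LinearMap.rTensor D (LeftModuleAlgebra.act.flip c)
          (LinearMap.lTensor D (LinearMap.mulRight ℂ d') x) := by
      intro x
      induction x using TensorProduct.induction_on with
      | zero => simp
      | tmul m c => simp [actMap]
      | add y z hy hz => simp only [map_add, TensorProduct.add_tmul, hy, hz]
    have b2 : ∀ x : D ⊗[ℂ] D, LinearMap.rTensor D (LeftModuleAlgebra.act.flip c)
        (LinearMap.rTensor D (LinearMap.mulRight ℂ e) x) =
        LinearMap.rTensor D (LeftModuleAlgebra.act.flip (actMap D C (e ⊗ₜ c))) x := by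
      intro x
      induction x using TensorProduct.induction_on with
      | zero => simp
      | tmul m c => simp [actMap, LeftModuleAlgebra.mul_act]
      | add y z hy hz => simp only [map_add, hy, hz]
    rw [← b2, ← T₃_mul_T₁, ← b1]
    simp [twistAux]

theorem twistOpAux_mul (d d' : D) (z : D ⊗[ℂ] C) :
    LinearMap.lTensor C (LinearMap.mulRight ℂ d') (twistOpAux D C (d ⊗ₜ z)) =
      TensorProduct.comm ℂ D C (LinearMap.lTensor D
        (LeftModuleAlgebra.act.flip (actMap D C z)) (T₃ (d ⊗ₜ[ℂ] d'))) := by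
  induction z using TensorProduct.induction_on with
  | zero => simp
  | add y z hy hz =>
    simp only [TensorProduct.tmul_add, map_add, hy, hz, LinearMap.lTensor_add,
      LinearMap.add_apply]
  | tmul e c =>
    have b1 : ∀ x : D ⊗[ℂ] D, LinearMap.lTensor C (LinearMap.mulRight ℂ d')
        (TensorProduct.comm ℂ D C (LinearMap.lTensor D (actMap D C)
          (TensorProduct.assoc ℂ D D C (x ⊗ₜ c)))) =
        TensorProduct.comm ℂ D C (LinearMap.lTensor D (LeftModuleAlgebra.act.flip c)
          (LinearMap.rTensor D (LinearMap.mulRight ℂ d') x)) := by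
      intro x
      induction x using TensorProduct.induction_on with
      | zero => simp
      | tmul m c => simp [actMap]
      | add y z hy hz => simp only [map_add, TensorProduct.add_tmul, hy, hz]
    have b2 : ∀ x : D ⊗[ℂ] D, LinearMap.lTensor D (LeftModuleAlgebra.act.flip c)
        (LinearMap.lTensor D (LinearMap.mulRight ℂ e) x) =
        LinearMap.lTensor D (LeftModuleAlgebra.act.flip (actMap D C (e ⊗ₜ c))) x := by
      intro x
      induction x using TensorProduct.induction_on with
      | zero => simp
      | tmul m c => simp [actMap, LeftModuleAlgebra.mul_act]
      | add y z hy hz => simp only [map_add, hy, hz]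
    rw [← b2, T₃_mul_T₁, ← b1]
    simp [twistOpAux]

/-- `R (d ⊗ (e ▷ c)) = ∑ (p ▷ c) ⊗ q` where `∑ p ⊗ q = Δ(d)(e ⊗ 1)`. -/
theorem twist_act (d e : D) (c : C) :
    twist D C (d ⊗ₜ LeftModuleAlgebra.act e c) =
      LinearMap.rTensor D (LeftModuleAlgebra.act.flip c) (T₃ (d ⊗ₜ[ℂ] e)) := by
  have h : twist D C (d ⊗ₜ LeftModuleAlgebra.act e c) = twistAux D C (d ⊗ₜ (e ⊗ₜ c)) := by
    refine tensor_eq_of_mulRight (nondegenerate (A := D)) _ _ fun d' => ?_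
    have h1 : twist D C (d ⊗ₜ LeftModuleAlgebra.act e c) =
        twistAux D C (d ⊗ₜ actSection D C (LeftModuleAlgebra.act e c)) := by simp [twist]
    rw [h1, twistAux_mul, twistAux_mul, actMap_actSection]
    simp [actMap]
  have b : ∀ x : D ⊗[ℂ] D,
      LinearMap.rTensor D (actMap D C) (TensorProduct.rightComm ℂ D D C (x ⊗ₜ c)) =
      LinearMap.rTensor D (LeftModuleAlgebra.act.flip c) x := by
    intro x
    induction x using TensorProduct.induction_on with
    | zero => simp
    | tmul m c => simp [actMap]
    | add y z hy hz => simp only [map_add, TensorProduct.add_tmul, hy, hz]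
  rw [h, ← b]
  simp [twistAux]

/-- `Rᵒᵖ (d ⊗ (e ▷ c)) = ∑ (q ▷ c) ⊗ p` where `∑ p ⊗ q = Δ(d)(1 ⊗ e)`. -/
theorem twistOp_act (d e : D) (c : C) :
    twistOp D C (d ⊗ₜ LeftModuleAlgebra.act e c) =
      TensorProduct.comm ℂ D C
        (LinearMap.lTensor D (LeftModuleAlgebra.act.flip c) (T₁ (d ⊗ₜ[ℂ] e))) := by
  have h : twistOp D C (d ⊗ₜ LeftModuleAlgebra.act e c) =
      twistOpAux D C (d ⊗ₜ (e ⊗ₜ c)) := by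
    refine tensor_eq_of_mulRight (nondegenerate (A := D)) _ _ fun d' => ?_
    have h1 : twistOp D C (d ⊗ₜ LeftModuleAlgebra.act e c) =
        twistOpAux D C (d ⊗ₜ actSection D C (LeftModuleAlgebra.act e c)) := by simp [twistOp]
    rw [h1, twistOpAux_mul, twistOpAux_mul, actMap_actSection]
    simp [actMap]
  have b : ∀ x : D ⊗[ℂ] D,
      LinearMap.lTensor D (actMap D C) (TensorProduct.assoc ℂ D D C (x ⊗ₜ c)) =
      LinearMap.lTensor D (LeftModuleAlgebra.act.flip c) x := by
    intro x
    induction x using TensorProduct.induction_on with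
    | zero => simp
    | tmul m c => simp [actMap]
    | add y z hy hz => simp only [map_add, TensorProduct.add_tmul, hy, hz]
  rw [h, ← b]
  simp [twistOpAux]

end Action

/-! ### Right coactions, comodule coalgebras, the maps `T` and `Tᵒᵖ` -/

/-- The completion `M₀(D ⊗ C)` of the `C`-bimodule `D ⊗ C`, where `D` is a vector space, `C` an
algebra, and `C` acts by multiplication on the second factor. An element `x` is given by the maps
`x.1 : c ↦ x(1 ⊗ c)` and `x.2 : c ↦ (1 ⊗ c)x` from `C` to `D ⊗ C`, with
`(1 ⊗ c)(x(1 ⊗ c')) = ((1 ⊗ c)x)(1 ⊗ c')`. -/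
def completedModule (D C : Type*) [AddCommGroup D] [Module ℂ D]
    [NonUnitalRing C] [Module ℂ C] [IsScalarTower ℂ C C] [SMulCommClass ℂ C C] :
    Submodule ℂ ((C →ₗ[ℂ] D ⊗[ℂ] C) × (C →ₗ[ℂ] D ⊗[ℂ] C)) where
  carrier := {x | ∀ c c' : C, LinearMap.lTensor D (LinearMap.mulLeft ℂ c) (x.1 c') =
    LinearMap.lTensor D (LinearMap.mulRight ℂ c') (x.2 c)}
  add_mem' := by
    intro x y hx hy c c'
    simp [hx c c', hy c c']
  zero_mem' := by
    intro c c'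
    simp
  smul_mem' := by
    intro r x hx c c'
    simp [hx c c']

/-- For a linear map `Γ : D → M₀(D ⊗ C)`, the map `T (c ⊗ d) = (1 ⊗ c)Γ(d)`. -/
def cotwistMap {D C : Type*} [AddCommGroup D] [Module ℂ D]
    [NonUnitalRing C] [Module ℂ C] [IsScalarTower ℂ C C] [SMulCommClass ℂ C C]
    (Γ : D →ₗ[ℂ] completedModule D C) : C ⊗[ℂ] D →ₗ[ℂ] D ⊗[ℂ] C :=
  TensorProduct.lift
    (LinearMap.snd ℂ _ _ ∘ₗ (completedModule D C).subtype ∘ₗ Γ).flip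

/-- For a linear map `Γ : D → M₀(D ⊗ C)`, the map `Tᵒᵖ (c ⊗ d) = Γ(d)(1 ⊗ c)`. -/
def cotwistOpMap {D C : Type*} [AddCommGroup D] [Module ℂ D]
    [NonUnitalRing C] [Module ℂ C] [IsScalarTower ℂ C C] [SMulCommClass ℂ C C]
    (Γ : D →ₗ[ℂ] completedModule D C) : C ⊗[ℂ] D →ₗ[ℂ] D ⊗[ℂ] C :=
  TensorProduct.lift
    (LinearMap.fst ℂ _ _ ∘ₗ (completedModule D C).subtype ∘ₗ Γ).flip

/-- A right coaction of a regular multiplier Hopf algebra `C` on a vector space `D`: an injective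
linear map `Γ : D → M₀(D ⊗ C)` with `(Γ ⊗ ι)Γ = (ι ⊗ Δ)Γ`.

The last equation is one between elements of the completion of the `C ⊗ C`-bimodule `D ⊗ C ⊗ C`. It
is given by the products with `1 ⊗ c ⊗ c'` from the right and from the left.
* From the right, `(Γ ⊗ ι)(Γ(d)) (1 ⊗ c ⊗ c') = (Γ ⊗ ι)(Γ(d)(1 ⊗ c')) (1 ⊗ c ⊗ 1)`, while for
  `∑ c ⊗ c' = Δ(p)(1 ⊗ q)` one has
  `∑ (ι ⊗ Δ)(Γ(d)) (1 ⊗ c ⊗ c') = (ι ⊗ Δ)(Γ(d)(1 ⊗ p)) (1 ⊗ 1 ⊗ q)`.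
* From the left, `(1 ⊗ c ⊗ c') (Γ ⊗ ι)(Γ(d)) = (1 ⊗ c ⊗ 1) (Γ ⊗ ι)((1 ⊗ c')Γ(d))`, while for
  `∑ c ⊗ c' = (1 ⊗ q)Δ(p)` one has
  `∑ (1 ⊗ c ⊗ c') (ι ⊗ Δ)(Γ(d)) = (1 ⊗ 1 ⊗ q) (ι ⊗ Δ)((1 ⊗ p)Γ(d))`.

The elements `Δ(p)(1 ⊗ q)` span `C ⊗ C`, and so do the elements `(1 ⊗ q)Δ(p)`. -/
class RightCoaction (C D : Type*)
    [NonUnitalRing C] [Module ℂ C] [IsScalarTower ℂ C C] [SMulCommClass ℂ C C]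
    [RegularMultiplierHopfAlgebra C] [AddCommGroup D] [Module ℂ D] where
  /-- the coaction -/
  Γ : D →ₗ[ℂ] completedModule D C
  injective : Function.Injective Γ
  coassoc_right : ∀ (d : D) (p q : C),
    LinearMap.rTensor C (cotwistOpMap Γ) ((TensorProduct.assoc ℂ C D C).symm
      (LinearMap.lTensor C (cotwistOpMap Γ)
        (TensorProduct.assoc ℂ C C D (T₁ (p ⊗ₜ[ℂ] q) ⊗ₜ[ℂ] d)))) =
    (TensorProduct.assoc ℂ D C C).symm (LinearMap.lTensor D (T₁ (A := C)).toLinearMap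
      (TensorProduct.assoc ℂ D C C (cotwistOpMap Γ (p ⊗ₜ d) ⊗ₜ q)))
  coassoc_left : ∀ (d : D) (p q : C),
    LinearMap.rTensor C (cotwistMap Γ) ((TensorProduct.assoc ℂ C D C).symm
      (LinearMap.lTensor C (cotwistMap Γ)
        (TensorProduct.assoc ℂ C C D (T₄ (q ⊗ₜ[ℂ] p) ⊗ₜ[ℂ] d)))) =
    (TensorProduct.assoc ℂ D C C).symm (LinearMap.lTensor D (T₄ (A := C)).toLinearMap
      (TensorProduct.leftComm ℂ C D C (q ⊗ₜ cotwistMap Γ (p ⊗ₜ d))))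

section Coaction

variable (C D : Type*)
  [NonUnitalRing C] [Module ℂ C] [IsScalarTower ℂ C C] [SMulCommClass ℂ C C]
  [RegularMultiplierHopfAlgebra C] [AddCommGroup D] [Module ℂ D] [RightCoaction C D]

/-- The cotwist map `T (c ⊗ d) = (1 ⊗ c)Γ(d)`. -/
def cotwist : C ⊗[ℂ] D →ₗ[ℂ] D ⊗[ℂ] C := cotwistMap (RightCoaction.Γ (C := C) (D := D))

/-- The cotwist map `Tᵒᵖ (c ⊗ d) = Γ(d)(1 ⊗ c)`. -/
def cotwistOp : C ⊗[ℂ] D →ₗ[ℂ] D ⊗[ℂ] C := cotwistOpMap (RightCoaction.Γ (C := C) (D := D))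

end Coaction

/-- A regular multiplier Hopf algebra `D` with a right coaction of `C` is a right `C`-comodule
coalgebra if `(Δ ⊗ ι)T = (ι ⊗ T)(T ⊗ ι)(ι ⊗ Δ)` on `C ⊗ D`.

In this equation `Y = (T ⊗ ι)(c ⊗ Δ(d))` is an element of the completion of `D ⊗ C ⊗ D` as a
`D`-bimodule with multiplication in the third factor: `Y (1 ⊗ 1 ⊗ d'') = (T ⊗ ι)(c ⊗ Δ(d)(1 ⊗ d''))`.
It is required that `Y (d' ⊗ 1 ⊗ 1)` and `(d' ⊗ 1 ⊗ 1) Y` are in `D ⊗ C ⊗ D`, i.e. are given by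
elements `w` of `D ⊗ C ⊗ D`, and the equation is required after multiplication with
`d' ⊗ 1 ⊗ 1` from the right and from the left, as `(ι ⊗ T) w = (Δ ⊗ ι)(T(c ⊗ d)) (d' ⊗ 1 ⊗ 1)` and
as `(ι ⊗ T) w = (d' ⊗ 1 ⊗ 1) (Δ ⊗ ι)(T(c ⊗ d))`. -/
class RightComoduleCoalgebra (C D : Type*)
    [NonUnitalRing C] [Module ℂ C] [IsScalarTower ℂ C C] [SMulCommClass ℂ C C]
    [RegularMultiplierHopfAlgebra C]
    [NonUnitalRing D] [Module ℂ D] [IsScalarTower ℂ D D] [SMulCommClass ℂ D D]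
    [RegularMultiplierHopfAlgebra D] [RightCoaction C D] : Prop where
  comul_right : ∀ (c : C) (d d' : D), ∃ w : D ⊗[ℂ] (C ⊗[ℂ] D),
    (∀ d'' : D, LinearMap.lTensor D (LinearMap.lTensor C (LinearMap.mulRight ℂ d'')) w =
      LinearMap.rTensor (C ⊗[ℂ] D) (LinearMap.mulRight ℂ d')
        (TensorProduct.assoc ℂ D C D (LinearMap.rTensor D (cotwist C D)
          ((TensorProduct.assoc ℂ C D D).symm (c ⊗ₜ[ℂ] T₁ (d ⊗ₜ[ℂ] d'')))))) ∧
    LinearMap.lTensor D (cotwist C D) w =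
      TensorProduct.assoc ℂ D D C (LinearMap.rTensor C (T₃ (A := D)).toLinearMap
        (TensorProduct.rightComm ℂ D C D (cotwist C D (c ⊗ₜ d) ⊗ₜ d')))
  comul_left : ∀ (c : C) (d d' : D), ∃ w : D ⊗[ℂ] (C ⊗[ℂ] D),
    (∀ d'' : D, LinearMap.lTensor D (LinearMap.lTensor C (LinearMap.mulRight ℂ d'')) w =
      LinearMap.rTensor (C ⊗[ℂ] D) (LinearMap.mulLeft ℂ d')
        (TensorProduct.assoc ℂ D C D (LinearMap.rTensor D (cotwist C D)
          ((TensorProduct.assoc ℂ C D D).symm (c ⊗ₜ[ℂ] T₁ (d ⊗ₜ[ℂ] d'')))))) ∧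
    LinearMap.lTensor D (cotwist C D) w =
      TensorProduct.assoc ℂ D D C (LinearMap.rTensor C (T₂ (A := D)).toLinearMap
        ((TensorProduct.assoc ℂ D D C).symm (d' ⊗ₜ cotwist C D (c ⊗ₜ d))))

/-! ### The map `P` and the conditions on it -/

section Compatibility

variable (C D : Type*)
  [NonUnitalRing C] [Module ℂ C] [IsScalarTower ℂ C C] [SMulCommClass ℂ C C]
  [RegularMultiplierHopfAlgebra C]
  [NonUnitalRing D] [Module ℂ D] [IsScalarTower ℂ D D] [SMulCommClass ℂ D D]
  [RegularMultiplierHopfAlgebra D]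
  [LeftModuleAlgebra D C] [RightCoaction C D]

/-- `P = Tᵒᵖ ∘ Rᵒᵖ`, that is, `P (d ⊗ c) = ∑ Γ(d₁)(1 ⊗ (d₂ ▷ c))`. -/
def mapP : D ⊗[ℂ] C →ₗ[ℂ] D ⊗[ℂ] C := cotwistOp C D ∘ₗ twistOp D C

/-- `P₂₃` on `D ⊗ D ⊗ C`. -/
def mapP₂₃ : D ⊗[ℂ] (D ⊗[ℂ] C) →ₗ[ℂ] D ⊗[ℂ] (D ⊗[ℂ] C) := LinearMap.lTensor D (mapP C D)

/-- `P₁₃` on `D ⊗ D ⊗ C`. -/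
def mapP₁₃ : D ⊗[ℂ] (D ⊗[ℂ] C) →ₗ[ℂ] D ⊗[ℂ] (D ⊗[ℂ] C) :=
  (TensorProduct.leftComm ℂ D D C).toLinearMap ∘ₗ LinearMap.lTensor D (mapP C D) ∘ₗ
    (TensorProduct.leftComm ℂ D D C).toLinearMap

/-- `P₁₂` on `D ⊗ C ⊗ C`. -/
def mapP₁₂' : D ⊗[ℂ] (C ⊗[ℂ] C) →ₗ[ℂ] D ⊗[ℂ] (C ⊗[ℂ] C) :=
  (TensorProduct.assoc ℂ D C C).toLinearMap ∘ₗ LinearMap.rTensor C (mapP C D) ∘ₗ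
    (TensorProduct.assoc ℂ D C C).symm.toLinearMap

/-- `P₁₃` on `D ⊗ C ⊗ C`. -/
def mapP₁₃' : D ⊗[ℂ] (C ⊗[ℂ] C) →ₗ[ℂ] D ⊗[ℂ] (C ⊗[ℂ] C) :=
  LinearMap.lTensor D (TensorProduct.comm ℂ C C).toLinearMap ∘ₗ mapP₁₂' C D ∘ₗ
    LinearMap.lTensor D (TensorProduct.comm ℂ C C).toLinearMap

/-- `P(m_D ⊗ ι) = (m_D ⊗ ι)P₁₃P₂₃` on `D ⊗ D ⊗ C`. -/
def PMulCondition : Prop :=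
  let mι : D ⊗[ℂ] (D ⊗[ℂ] C) →ₗ[ℂ] D ⊗[ℂ] C :=
    LinearMap.rTensor C (LinearMap.mul' ℂ D) ∘ₗ (TensorProduct.assoc ℂ D D C).symm.toLinearMap
  mapP C D ∘ₗ mι = mι ∘ₗ mapP₁₃ C D ∘ₗ mapP₂₃ C D

/-- `(ι ⊗ Δ_C)P = P₁₂P₁₃(ι ⊗ Δ_C)` on `D ⊗ C`.

Here `Z = P₁₃(d ⊗ Δ(c))` is an element of the completion of `D ⊗ C ⊗ C` as a `C`-bimodule with
multiplication in the second factor: `Z (1 ⊗ c'' ⊗ 1) = P₁₃(d ⊗ Δ(c)(c'' ⊗ 1))`. The equation is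
required after multiplication with `1 ⊗ 1 ⊗ c'` from the right, for all `c'`: the element
`Z (1 ⊗ 1 ⊗ c')` is given by some `w` in `D ⊗ C ⊗ C`, and
`P₁₂ w = (ι ⊗ Δ)(P(d ⊗ c)) (1 ⊗ 1 ⊗ c')`. -/
def PComulCondition : Prop :=
  ∀ (d : D) (c c' : C), ∃ w : D ⊗[ℂ] (C ⊗[ℂ] C),
    (∀ c'' : C, LinearMap.lTensor D (LinearMap.rTensor C (LinearMap.mulRight ℂ c'')) w =
      LinearMap.lTensor D (LinearMap.lTensor C (LinearMap.mulRight ℂ c'))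
        (mapP₁₃' C D (d ⊗ₜ[ℂ] T₃ (c ⊗ₜ[ℂ] c'')))) ∧
    mapP₁₂' C D w = LinearMap.lTensor D (T₁ (A := C)).toLinearMap
      (TensorProduct.assoc ℂ D C C (mapP C D (d ⊗ₜ c) ⊗ₜ c'))

/-- `P = T ∘ R`, i.e. `T ∘ R = Tᵒᵖ ∘ Rᵒᵖ`, on `D ⊗ C`. -/
def PTwistCondition : Prop := mapP C D = cotwist C D ∘ₗ twist D C

end Compatibility

/-! ### The smash product -/

/-- The smash product `CD`: the space `C ⊗ D`, the element `c ⊗ d` being written `cd`. -/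
def SmashProduct (C D : Type*) [AddCommGroup C] [Module ℂ C] [AddCommGroup D] [Module ℂ D] :
    Type _ := C ⊗[ℂ] D

section Smash

variable (C D : Type*)

instance [AddCommGroup C] [Module ℂ C] [AddCommGroup D] [Module ℂ D] :
    AddCommGroup (SmashProduct C D) := inferInstanceAs (AddCommGroup (C ⊗[ℂ] D))

instance [AddCommGroup C] [Module ℂ C] [AddCommGroup D] [Module ℂ D] :
    Module ℂ (SmashProduct C D) := inferInstanceAs (Module ℂ (C ⊗[ℂ] D))

/-- The identification of `C ⊗ D` with the smash product, `c ⊗ d ↦ cd`. -/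
def SmashProduct.equiv [AddCommGroup C] [Module ℂ C] [AddCommGroup D] [Module ℂ D] :
    C ⊗[ℂ] D ≃ₗ[ℂ] SmashProduct C D := LinearEquiv.refl ℂ (C ⊗[ℂ] D)

variable
  [NonUnitalRing C] [Module ℂ C] [IsScalarTower ℂ C C] [SMulCommClass ℂ C C]
  [NonUnitalRing D] [Module ℂ D] [IsScalarTower ℂ D D] [SMulCommClass ℂ D D]
  [RegularMultiplierHopfAlgebra D] [LeftModuleAlgebra D C]

/-- Left multiplication with elements of `D` on the smash product:
`d ⊗ c'd' ↦ d(c'd') = ∑ (d₁ ▷ c')(d₂d')`. -/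
def SmashProduct.mulD : D →ₗ[ℂ] SmashProduct C D →ₗ[ℂ] SmashProduct C D :=
  TensorProduct.curry
    ((SmashProduct.equiv C D).toLinearMap ∘ₗ
      LinearMap.lTensor C (LinearMap.mul' ℂ D) ∘ₗ
      (TensorProduct.assoc ℂ C D D).toLinearMap ∘ₗ
      LinearMap.rTensor D (twist D C) ∘ₗ
      (TensorProduct.assoc ℂ D C D).symm.toLinearMap ∘ₗ
      LinearMap.lTensor D (SmashProduct.equiv C D).symm.toLinearMap)

/-- Left multiplication with elements of `C` on the smash product: `c ⊗ c'd' ↦ (cc')d'`. -/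
def SmashProduct.mulC : C →ₗ[ℂ] SmashProduct C D →ₗ[ℂ] SmashProduct C D :=
  TensorProduct.curry
    ((SmashProduct.equiv C D).toLinearMap ∘ₗ
      LinearMap.rTensor D (LinearMap.mul' ℂ C) ∘ₗ
      (TensorProduct.assoc ℂ C C D).symm.toLinearMap ∘ₗ
      LinearMap.lTensor C (SmashProduct.equiv C D).symm.toLinearMap)

/-- The product of the smash product,
`(cd)(c'd') = c(d(c'd')) = ∑ c(d₁ ▷ c') d₂d'`; as a map it is `(m_C ⊗ m_D)(ι ⊗ R ⊗ ι)`. -/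
def SmashProduct.mulMap : SmashProduct C D →ₗ[ℂ] SmashProduct C D →ₗ[ℂ] SmashProduct C D :=
  TensorProduct.lift
    ((LinearMap.llcomp ℂ _ _ _).compl₁₂ (SmashProduct.mulC C D) (SmashProduct.mulD C D)) ∘ₗ
    (SmashProduct.equiv C D).symm.toLinearMap

instance : NonUnitalNonAssocRing (SmashProduct C D) where
  mul x y := SmashProduct.mulMap C D x y
  left_distrib x y z := map_add (SmashProduct.mulMap C D x) y z
  right_distrib x y z := LinearMap.map_add₂ (SmashProduct.mulMap C D) x y z
  zero_mul x := LinearMap.map_zero₂ (SmashProduct.mulMap C D) x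
  mul_zero x := map_zero (SmashProduct.mulMap C D x)

instance : IsScalarTower ℂ (SmashProduct C D) (SmashProduct C D) where
  smul_assoc r x y := LinearMap.map_smul₂ (SmashProduct.mulMap C D) r x y

instance : SMulCommClass ℂ (SmashProduct C D) (SmashProduct C D) where
  smul_comm r x y := (map_smul (SmashProduct.mulMap C D x) r y).symm

/-- `(c ⊗ d)(c' ⊗ d') = (m_C ⊗ m_D)(c ⊗ R(d ⊗ c') ⊗ d')`. -/
theorem SmashProduct.mul_def (c c' : C) (d d' : D) :
    SmashProduct.equiv C D (c ⊗ₜ d) * SmashProduct.equiv C D (c' ⊗ₜ d') =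
      SmashProduct.equiv C D
        (TensorProduct.map (LinearMap.mulLeft ℂ c) (LinearMap.mulRight ℂ d')
          (twist D C (d ⊗ₜ c'))) := by
  change SmashProduct.mulC C D c (SmashProduct.mulD C D d
    (SmashProduct.equiv C D (c' ⊗ₜ d'))) = _
  have h : ∀ x : C ⊗[ℂ] D, SmashProduct.mulC C D c (SmashProduct.equiv C D
      (LinearMap.lTensor C (LinearMap.mul' ℂ D) (TensorProduct.assoc ℂ C D D (x ⊗ₜ d')))) =
      SmashProduct.equiv C D
        (TensorProduct.map (LinearMap.mulLeft ℂ c) (LinearMap.mulRight ℂ d') x) := by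
    intro x
    induction x using TensorProduct.induction_on with
    | zero => simp
    | tmul a b => simp [SmashProduct.mulC]
    | add y z hy hz => simp only [map_add, TensorProduct.add_tmul, hy, hz]
  rw [← h]
  simp [SmashProduct.mulD]

end Smash

/-! ### The smash coproduct -/

section SmashCoproduct

variable (C D : Type*)
  [NonUnitalRing C] [Module ℂ C] [IsScalarTower ℂ C C] [SMulCommClass ℂ C C]
  [RegularMultiplierHopfAlgebra C]
  [NonUnitalRing D] [Module ℂ D] [IsScalarTower ℂ D D] [SMulCommClass ℂ D D]
  [RegularMultiplierHopfAlgebra D]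
  [LeftModuleAlgebra D C] [RightCoaction C D]

/-- The left action of a multiplier `m` of `C ⊗ C` on `CD ⊗ CD`,
`m (c d ⊗ c' d') = m(c ⊗ c') (d ⊗ d')`. -/
def multiplierCAct (m : Multiplier (C ⊗[ℂ] C)) :
    SmashProduct C D ⊗[ℂ] SmashProduct C D →ₗ[ℂ] SmashProduct C D ⊗[ℂ] SmashProduct C D :=
  TensorProduct.map (SmashProduct.equiv C D).toLinearMap (SmashProduct.equiv C D).toLinearMap ∘ₗ
    (TensorProduct.tensorTensorTensorComm ℂ C C D D).toLinearMap ∘ₗ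
    LinearMap.rTensor (D ⊗[ℂ] D) m.left ∘ₗ
    (TensorProduct.tensorTensorTensorComm ℂ C D C D).toLinearMap ∘ₗ
    TensorProduct.map (SmashProduct.equiv C D).symm.toLinearMap
      (SmashProduct.equiv C D).symm.toLinearMap

/-- The left action of an element `g` of `M₀(D ⊗ C)` on `CD ⊗ CD`,
`g (x ⊗ c' d') = ∑ y x ⊗ z d'` where `∑ y ⊗ z = g(1 ⊗ c')` in `D ⊗ C`. -/
def completedModuleAct : completedModule D C →ₗ[ℂ]
    SmashProduct C D ⊗[ℂ] SmashProduct C D →ₗ[ℂ] SmashProduct C D ⊗[ℂ] SmashProduct C D :=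
  (((LinearMap.lTensorHom (R := ℂ) (SmashProduct C D)) ∘ₗ
    (LinearMap.rTensorHom (R := ℂ) D) ∘ₗ
    LinearMap.fst ℂ (C →ₗ[ℂ] D ⊗[ℂ] C) (C →ₗ[ℂ] D ⊗[ℂ] C) ∘ₗ
    (completedModule D C).subtype).compr₂
      (LinearMap.lTensor (SmashProduct C D) (SmashProduct.equiv C D).toLinearMap ∘ₗ
        LinearMap.rTensor (C ⊗[ℂ] D) (TensorProduct.lift (SmashProduct.mulD C D).flip) ∘ₗ
        (TensorProduct.assoc ℂ (SmashProduct C D) D (C ⊗[ℂ] D)).symm.toLinearMap ∘ₗ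
        LinearMap.lTensor (SmashProduct C D) (TensorProduct.assoc ℂ D C D).toLinearMap)).compl₂
    (LinearMap.lTensor (SmashProduct C D) (SmashProduct.equiv C D).symm.toLinearMap)

/-- A linear map `Δ' : CD → M(CD ⊗ CD)` is the smash coproduct if
`Δ'(cd) = ∑ Δ_C(c) Γ(d₁) (1 ⊗ d₂)` for all `c` and `d`. Here `d₂` is covered by multiplication with
`1 ⊗ d'` from the right: the formula reads
`Δ'(cd) (x ⊗ d'y) = Δ_C(c) ∑ Γ(p) (x ⊗ qy)` for all `x` and `y` in `CD`, where
`∑ p ⊗ q = Δ_D(d)(1 ⊗ d')`. The elements `x ⊗ d'y` span `CD ⊗ CD`. -/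
def IsSmashCoproduct
    (Δ' : SmashProduct C D →ₗ[ℂ] Multiplier (SmashProduct C D ⊗[ℂ] SmashProduct C D)) : Prop :=
  ∀ (c : C) (d d' : D) (x y : SmashProduct C D),
    (Δ' (SmashProduct.equiv C D (c ⊗ₜ d))).left (x ⊗ₜ SmashProduct.mulD C D d' y) =
      multiplierCAct C D (Δ c)
        (TensorProduct.lift
          ((completedModuleAct C D ∘ₗ RightCoaction.Γ (C := C) (D := D)).compl₂
            (TensorProduct.mk ℂ (SmashProduct C D) (SmashProduct C D) x ∘ₗ
              (SmashProduct.mulD C D).flip y))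
          (T₁ (d ⊗ₜ[ℂ] d')))

end SmashCoproduct

end

open scoped TensorProduct

noncomputable section

set_option linter.unusedSectionVars false

open RegularMultiplierHopfAlgebra

/-! ### Jointly injective families and tensor products -/

section JointlyInjective

variable {M B B' ι : Type*} [AddCommGroup M] [Module ℂ M] [AddCommGroup B] [Module ℂ B]
  [AddCommGroup B'] [Module ℂ B']

/-! In CD ⊗ CD, if u b = 0 for all b then u = 0 (`tensor_eq_zero_of_forall_mul`), so a multiplier is
determined by its left action. The defining formula prescribes that left action on the elements x ⊗
d'y, which span because D · CD = CD. This gives uniqueness, and it allows every identity to be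
checked on operators. Put E(d) = ∑ Γ(d₁)(1 ⊗ d₂), acting as `comulDAct d`; the operator attached to
cd is Δ_C(c)E(d), which is `smashComulAct`.

Existence needs a right action as well, that is, each product a Δ_C(c)E(d) must come from an
element. The twist map R is bijective, hence CD is also spanned by products dc. For Δ_C(c) one moves
the C-parts of a to the right, where (c₁ ⊗ c₂)Δ_C(c) lies in C ⊗ C. For E(d) one uses that (d' ⊗
c)E(d) is (d' ⊗ 1 ⊗ 1)(T ⊗ ι)(c ⊗ Δ_D(d)), which lies in D ⊗ C ⊗ D by the comodule coalgebra
condition (`hasRightAction_comulDAct`).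

Multiplicativity reduces to three rules, since the product of CD is governed by dc = R(d ⊗ c). Δ_C
is a homomorphism. E is multiplicative: E(d)(1 ⊗ v) = ∑ P(d₁ ⊗ v)(1 ⊗ d₂), and the condition on P
and m_D applies (`comulDAct_mul`). Finally E(d)Δ_C(c) must be the operator attached to R(d ⊗ c)
(`comulDAct_comulCAct`). By coassociativity of Δ_D this amounts to R₁₂P₁₃(p ⊗ Δ_C(c)) = ∑
Δ₁₃(c')Γ₂₃(p') with ∑ c' ⊗ p' = R(p ⊗ c). The map T₁₂ is injective (`cotwist_injective`). As TR = P,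
it sends the left side to P₁₂P₁₃(p ⊗ Δ_C(c)) = (ι ⊗ Δ_C)P(p ⊗ c), and it sends the right side to (ι
⊗ Δ_C)TR(p ⊗ c) by coassociativity of Γ (`cotwist_comulCoact`).

No counit or antipode appears. Their role is played by local units, extracted from the bijectivity
of `T₁` (`exists_local_unit`): any element of a unital module has the form e m, which supplies the
factor that covers a leg of a coproduct. -/

theorem TensorProduct.eq_of_forall_lTensor_eq (f : ι → B →ₗ[ℂ] B')
    (hf : ∀ b, (∀ i, f i b = 0) → b = 0) {x y : M ⊗[ℂ] B}
    (h : ∀ i, LinearMap.lTensor M (f i) x = LinearMap.lTensor M (f i) y) : x = y := by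
  rw [← sub_eq_zero]
  set z := x - y with hz
  have hz' : ∀ i, LinearMap.lTensor M (f i) z = 0 := fun i => by rw [hz, map_sub, h, sub_self]
  -- In coordinates for a basis of M, the map ι ⊗ f i acts on each coefficient in B separately.
  let e := TensorProduct.equivFinsuppOfBasisLeft (N := B) (Module.Free.chooseBasis ℂ M)
  let e' := TensorProduct.equivFinsuppOfBasisLeft (N := B') (Module.Free.chooseBasis ℂ M)
  apply e.injective
  rw [map_zero]
  ext k
  refine hf _ fun i => ?_
  have key : ∀ w : M ⊗[ℂ] B, e' (LinearMap.lTensor M (f i) w) k = f i (e w k) := by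
    intro w
    induction w using TensorProduct.induction_on with
    | zero => simp
    | tmul m c => simp [e, e']
    | add y z hy hz => simp only [map_add, Finsupp.add_apply, hy, hz]
  rw [← key, hz', map_zero, Finsupp.zero_apply]

theorem TensorProduct.eq_of_forall_rTensor_eq (f : ι → B →ₗ[ℂ] B')
    (hf : ∀ b, (∀ i, f i b = 0) → b = 0) {x y : B ⊗[ℂ] M}
    (h : ∀ i, LinearMap.rTensor M (f i) x = LinearMap.rTensor M (f i) y) : x = y := by
  apply (TensorProduct.comm ℂ B M).injective
  refine TensorProduct.eq_of_forall_lTensor_eq f hf fun i => ?_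
  rw [LinearMap.lTensor_comm, LinearMap.lTensor_comm, h]

end JointlyInjective

/-! ### Cancelling multiplication in one leg of a tensor product. -/

section Nondegenerate

variable {A M : Type*} [NonUnitalRing A] [Module ℂ A] [IsScalarTower ℂ A A] [SMulCommClass ℂ A A]
  [AddCommGroup M] [Module ℂ M]

theorem lTensor_mulRight_ext (hA : NondegenerateMul A) {x y : M ⊗[ℂ] A}
    (h : ∀ a : A, LinearMap.lTensor M (LinearMap.mulRight ℂ a) x =
      LinearMap.lTensor M (LinearMap.mulRight ℂ a) y) : x = y :=
  TensorProduct.eq_of_forall_lTensor_eq _ (fun b hb => hA.1 b fun a => by simpa using hb a) h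

theorem lTensor_mulLeft_ext (hA : NondegenerateMul A) {x y : M ⊗[ℂ] A}
    (h : ∀ a : A, LinearMap.lTensor M (LinearMap.mulLeft ℂ a) x =
      LinearMap.lTensor M (LinearMap.mulLeft ℂ a) y) : x = y :=
  TensorProduct.eq_of_forall_lTensor_eq _ (fun b hb => hA.2 b fun a => by simpa using hb a) h

theorem rTensor_mulRight_ext (hA : NondegenerateMul A) {x y : A ⊗[ℂ] M}
    (h : ∀ a : A, LinearMap.rTensor M (LinearMap.mulRight ℂ a) x =
      LinearMap.rTensor M (LinearMap.mulRight ℂ a) y) : x = y :=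
  TensorProduct.eq_of_forall_rTensor_eq _ (fun b hb => hA.1 b fun a => by simpa using hb a) h

theorem rTensor_mulLeft_ext (hA : NondegenerateMul A) {x y : A ⊗[ℂ] M}
    (h : ∀ a : A, LinearMap.rTensor M (LinearMap.mulLeft ℂ a) x =
      LinearMap.rTensor M (LinearMap.mulLeft ℂ a) y) : x = y :=
  TensorProduct.eq_of_forall_rTensor_eq _ (fun b hb => hA.2 b fun a => by simpa using hb a) h

theorem tmul_mul_eq (x : A ⊗[ℂ] A) (p q : A) :
    (p ⊗ₜ q) * x = LinearMap.lTensor A (LinearMap.mulLeft ℂ q)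
      (LinearMap.rTensor A (LinearMap.mulLeft ℂ p) x) := by
  induction x using TensorProduct.induction_on with
  | zero => simp
  | tmul m c => simp
  | add y z hy hz => simp only [map_add, mul_add, hy, hz]

theorem tensor_eq_of_tmul_mul (hA : NondegenerateMul A) {x y : A ⊗[ℂ] A}
    (h : ∀ p q : A, (p ⊗ₜ q) * x = (p ⊗ₜ q) * y) : x = y :=
  rTensor_mulLeft_ext hA fun p => lTensor_mulLeft_ext hA fun q => by
    rw [← tmul_mul_eq, ← tmul_mul_eq, h]

end Nondegenerate

/-! ### Multipliers -/

section Multipliers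

variable {A : Type*} [NonUnitalNonAssocRing A] [Module ℂ A] [IsScalarTower ℂ A A]
  [SMulCommClass ℂ A A]

theorem Multiplier.left_mul_apply (m : Multiplier A) (a b : A) :
    m.left (a * b) = m.left a * b := m.2.1 a b

theorem Multiplier.mul_left_apply (m : Multiplier A) (a b : A) :
    a * m.left b = m.right a * b := m.2.2.2 a b

theorem Multiplier.left_mul (m n : Multiplier A) : (m * n).left = m.left ∘ₗ n.left := rfl

/-- If the product is non-degenerate, a multiplier is determined by its left action. -/
theorem Multiplier.ext_left (hA : ∀ a : A, (∀ b, a * b = 0) → a = 0) {m n : Multiplier A}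
    (h : m.left = n.left) : m = n := by
  apply Subtype.ext
  refine Prod.ext h (MulOpposite.unop_injective (LinearMap.ext fun a => ?_))
  change m.right a = n.right a
  rw [← sub_eq_zero]
  refine hA _ fun b => ?_
  rw [sub_mul, ← m.mul_left_apply, ← n.mul_left_apply, h, sub_self]

end Multipliers

/-! ### Identities for the coproduct of a regular multiplier Hopf algebra -/

section Hopf

variable {H : Type*} [NonUnitalRing H] [Module ℂ H] [IsScalarTower ℂ H H] [SMulCommClass ℂ H H]
  [RegularMultiplierHopfAlgebra H]

theorem rTensor_mulRight_mul (x : H ⊗[ℂ] H) (a p q : H) :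
    LinearMap.rTensor H (LinearMap.mulRight ℂ a) x * (p ⊗ₜ q) = x * ((a * p) ⊗ₜ q) := by
  induction x using TensorProduct.induction_on with
  | zero => simp
  | tmul m c => simp [mul_assoc]
  | add y z hy hz => simp only [map_add, add_mul, hy, hz]

theorem lTensor_mulRight_mul (x : H ⊗[ℂ] H) (a p q : H) :
    LinearMap.lTensor H (LinearMap.mulRight ℂ a) x * (p ⊗ₜ q) = x * (p ⊗ₜ (a * q)) := by
  induction x using TensorProduct.induction_on with
  | zero => simp
  | tmul m c => simp [mul_assoc]
  | add y z hy hz => simp only [map_add, add_mul, hy, hz]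

theorem mul_rTensor_mulLeft (x : H ⊗[ℂ] H) (a p q : H) :
    (p ⊗ₜ q) * LinearMap.rTensor H (LinearMap.mulLeft ℂ a) x = ((p * a) ⊗ₜ q) * x := by
  induction x using TensorProduct.induction_on with
  | zero => simp
  | tmul m c => simp [mul_assoc]
  | add y z hy hz => simp only [map_add, mul_add, hy, hz]

theorem mul_lTensor_mulLeft (x : H ⊗[ℂ] H) (a p q : H) :
    (p ⊗ₜ q) * LinearMap.lTensor H (LinearMap.mulLeft ℂ a) x = (p ⊗ₜ (q * a)) * x := by
  induction x using TensorProduct.induction_on with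
  | zero => simp
  | tmul m c => simp [mul_assoc]
  | add y z hy hz => simp only [map_add, mul_add, hy, hz]

/-- `Δ(a)(p ⊗ b) = (Δ(a)(1 ⊗ b))(p ⊗ 1)`. -/
theorem Δ_left_tmul (a p b : H) :
    (Δ a).left (p ⊗ₜ b) = LinearMap.rTensor H (LinearMap.mulRight ℂ p) (T₁ (a ⊗ₜ[ℂ] b)) := by
  refine tensor_eq_of_mul nondegenerate _ _ fun r s => ?_
  rw [rTensor_mulRight_mul, ← T₁_spec, ← Multiplier.left_mul_apply,
    Algebra.TensorProduct.tmul_mul_tmul]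

theorem Δ_mul_left (a b : H) (z : H ⊗[ℂ] H) :
    (Δ (a * b)).left z = (Δ a).left ((Δ b).left z) := by
  rw [map_mul, Multiplier.left_mul, LinearMap.comp_apply]

/-- `Δ(a)(Δ(b)(1 ⊗ c)) = Δ(ab)(1 ⊗ c)`. -/
theorem Δ_left_T₁ (a b c : H) :
    (Δ a).left (T₁ (b ⊗ₜ[ℂ] c)) = T₁ ((a * b) ⊗ₜ[ℂ] c) := by
  refine tensor_eq_of_mul nondegenerate _ _ fun r s => ?_
  rw [← Multiplier.left_mul_apply, ← T₁_spec, ← T₁_spec, Δ_mul_left]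

theorem T₁_tmul_mul (a b c : H) :
    T₁ (a ⊗ₜ[ℂ] (b * c)) = LinearMap.lTensor H (LinearMap.mulRight ℂ c) (T₁ (a ⊗ₜ[ℂ] b)) := by
  refine tensor_eq_of_mul nondegenerate _ _ fun r s => ?_
  rw [lTensor_mulRight_mul, ← T₁_spec, ← T₁_spec, mul_assoc]

theorem T₃_tmul_mul (a b c : H) :
    T₃ (a ⊗ₜ[ℂ] (b * c)) = LinearMap.rTensor H (LinearMap.mulRight ℂ c) (T₃ (a ⊗ₜ[ℂ] b)) := by
  refine tensor_eq_of_mul nondegenerate _ _ fun r s => ?_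
  rw [rTensor_mulRight_mul, ← T₃_spec, ← T₃_spec, mul_assoc]

/-- `(f ⊗ 1)(Δ(a)(1 ⊗ b)) = ((f ⊗ 1)Δ(a))(1 ⊗ b)`. -/
theorem mulLeft_T₁ (f a b : H) :
    LinearMap.rTensor H (LinearMap.mulLeft ℂ f) (T₁ (a ⊗ₜ[ℂ] b)) =
      LinearMap.lTensor H (LinearMap.mulRight ℂ b) (T₂ (f ⊗ₜ[ℂ] a)) := by
  refine tensor_eq_of_tmul_mul nondegenerate fun p q => tensor_eq_of_mul nondegenerate _ _
    fun r s => ?_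
  rw [mul_rTensor_mulLeft, mul_assoc, mul_assoc, lTensor_mulRight_mul, ← T₁_spec,
    Multiplier.mul_left_apply, T₂_spec, mul_assoc]

/-- `(1 ⊗ f)(Δ(a)(1 ⊗ b)) = ((1 ⊗ f)Δ(a))(1 ⊗ b)`. -/
theorem mulLeft_T₁' (f a b : H) :
    LinearMap.lTensor H (LinearMap.mulLeft ℂ f) (T₁ (a ⊗ₜ[ℂ] b)) =
      LinearMap.lTensor H (LinearMap.mulRight ℂ b) (T₄ (f ⊗ₜ[ℂ] a)) := by
  refine tensor_eq_of_tmul_mul nondegenerate fun p q => tensor_eq_of_mul nondegenerate _ _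
    fun r s => ?_
  rw [mul_lTensor_mulLeft, mul_assoc, mul_assoc, lTensor_mulRight_mul, ← T₁_spec,
    Multiplier.mul_left_apply, T₄_spec, mul_assoc]

/-- `(f ⊗ 1)(Δ(a)(b ⊗ 1)) = ((f ⊗ 1)Δ(a))(b ⊗ 1)`. -/
theorem mulLeft_T₃' (f a b : H) :
    LinearMap.rTensor H (LinearMap.mulLeft ℂ f) (T₃ (a ⊗ₜ[ℂ] b)) =
      LinearMap.rTensor H (LinearMap.mulRight ℂ b) (T₂ (f ⊗ₜ[ℂ] a)) := by
  refine tensor_eq_of_tmul_mul nondegenerate fun p q => tensor_eq_of_mul nondegenerate _ _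
    fun r s => ?_
  rw [mul_rTensor_mulLeft, mul_assoc, mul_assoc, rTensor_mulRight_mul, ← T₃_spec,
    Multiplier.mul_left_apply, T₂_spec, mul_assoc]

/-! ### Local units -/

/-- Elements of `H ⊗ V` have left local units in `H`. -/
theorem exists_local_unit_tensor {V : Type*} [AddCommGroup V] [Module ℂ V] (t : H ⊗[ℂ] V) :
    ∃ e : H, LinearMap.rTensor V (LinearMap.mulLeft ℂ e) t = t := by
  rcases subsingleton_or_nontrivial H with hH | hH
  · refine ⟨0, ?_⟩
    have : ∀ x : H ⊗[ℂ] V, x = 0 := by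
      intro x
      induction x using TensorProduct.induction_on with
      | zero => rfl
      | tmul h v => rw [Subsingleton.elim h 0, TensorProduct.zero_tmul]
      | add y z hy hz => rw [hy, hz, add_zero]
    rw [this t, map_zero]
  let φ : H →ₗ[ℂ] H ⊗[ℂ] V := (LinearMap.rTensorHom V ∘ₗ LinearMap.mul ℂ H).flip t
  have hφ : ∀ e, φ e = LinearMap.rTensor V (LinearMap.mulLeft ℂ e) t := fun e => rfl
  -- N is the space of all e t, and the claim is that t lies in N.
  let N := LinearMap.range φ
  -- τ sends p ⊗ t to ∑ p₁ ⊗ p₂t. It is bijective, and the plan is to show that both p ⊗ t and H ⊗ N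
  -- land in H ⊗ N, the latter onto it.
  let τ : H ⊗[ℂ] (H ⊗[ℂ] V) ≃ₗ[ℂ] H ⊗[ℂ] (H ⊗[ℂ] V) :=
    (TensorProduct.assoc ℂ H H V).symm ≪≫ₗ
      TensorProduct.congr (T₁ (A := H)) (LinearEquiv.refl ℂ V) ≪≫ₗ TensorProduct.assoc ℂ H H V
  have hτ : ∀ (a b : H) (v : V),
      τ (a ⊗ₜ (b ⊗ₜ v)) = TensorProduct.assoc ℂ H H V (T₁ (a ⊗ₜ[ℂ] b) ⊗ₜ v) := by
    intro a b v
    simp [τ]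
  have h1 : ∀ z : H ⊗[ℂ] H, τ (LinearMap.lTensor H φ z) = LinearMap.lTensor H φ (T₁ z) := by
    intro z
    induction z using TensorProduct.induction_on with
    | zero => simp
    | add y z hy hz => simp only [map_add, hy, hz]
    | tmul a b =>
      have key : ∀ s : H ⊗[ℂ] V, τ (a ⊗ₜ LinearMap.rTensor V (LinearMap.mulLeft ℂ b) s) =
          LinearMap.lTensor H ((LinearMap.rTensorHom V ∘ₗ LinearMap.mul ℂ H).flip s)
            (T₁ (a ⊗ₜ[ℂ] b)) := by
        intro s
        induction s using TensorProduct.induction_on with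
        | zero => simp
        | add y z hy hz => simp only [map_add, TensorProduct.tmul_add, hy, hz,
            LinearMap.lTensor_add, LinearMap.add_apply]
        | tmul c v =>
          rw [LinearMap.rTensor_tmul, LinearMap.mulLeft_apply, hτ, T₁_tmul_mul]
          generalize T₁ (a ⊗ₜ[ℂ] b) = w
          induction w using TensorProduct.induction_on with
          | zero => simp
          | add y z hy hz => simp only [map_add, TensorProduct.add_tmul, hy, hz]
          | tmul x y => simp
      simpa [hφ] using key t
  -- After multiplication with f in the first leg one gets ∑ fp₁ ⊗ p₂t, where ∑ fp₁ ⊗ p₂ is in H ⊗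
  -- H. So this product is in H ⊗ N, and f cancels by non-degeneracy.
  have h2 : ∀ p : H, LinearMap.lTensor H N.mkQ (τ (p ⊗ₜ t)) = 0 := by
    intro p
    refine rTensor_mulLeft_ext nondegenerate fun f => ?_
    have key : ∀ s : H ⊗[ℂ] V,
        LinearMap.rTensor (H ⊗[ℂ] V) (LinearMap.mulLeft ℂ f) (τ (p ⊗ₜ s)) =
          LinearMap.lTensor H ((LinearMap.rTensorHom V ∘ₗ LinearMap.mul ℂ H).flip s)
            (T₂ (f ⊗ₜ[ℂ] p)) := by
      intro s
      induction s using TensorProduct.induction_on with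
      | zero => simp
      | add y z hy hz => simp only [map_add, TensorProduct.tmul_add, hy, hz,
          LinearMap.lTensor_add, LinearMap.add_apply]
      | tmul c v =>
        have e1 : ∀ w : H ⊗[ℂ] H, LinearMap.rTensor (H ⊗[ℂ] V) (LinearMap.mulLeft ℂ f)
            (TensorProduct.assoc ℂ H H V (w ⊗ₜ v)) = TensorProduct.assoc ℂ H H V
              (LinearMap.rTensor H (LinearMap.mulLeft ℂ f) w ⊗ₜ v) := by
          intro w
          induction w using TensorProduct.induction_on with
          | zero => simp
          | add y z hy hz => simp only [map_add, TensorProduct.add_tmul, hy, hz]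
          | tmul x y => simp
        rw [hτ, e1, mulLeft_T₁]
        generalize T₂ (f ⊗ₜ[ℂ] p) = w
        induction w using TensorProduct.induction_on with
        | zero => simp
        | add y z hy hz => simp only [map_add, TensorProduct.add_tmul, hy, hz]
        | tmul x y => simp
    rw [map_zero, ← LinearMap.comp_apply, LinearMap.rTensor_comp_lTensor,
      ← LinearMap.lTensor_comp_rTensor, LinearMap.comp_apply, key]
    change LinearMap.lTensor H N.mkQ (LinearMap.lTensor H φ _) = 0
    rw [← LinearMap.comp_apply, ← LinearMap.lTensor_comp]
    have : N.mkQ ∘ₗ φ = 0 := LinearMap.range_mkQ_comp φ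
    rw [this, LinearMap.lTensor_zero, LinearMap.zero_apply]
  have hex : Function.Exact φ N.mkQ := LinearMap.exact_map_mkQ_range φ
  -- Surjectivity of `T₁` makes every element of H ⊗ N the image under τ of an element of H ⊗ N, so
  -- injectivity of τ puts p ⊗ t itself in H ⊗ N.
  have h3 : ∀ p : H, p ⊗ₜ[ℂ] N.mkQ t = 0 := by
    intro p
    obtain ⟨s, hs⟩ := (lTensor_exact H hex N.mkQ_surjective _).1 (h2 p)
    have h4 : p ⊗ₜ t = LinearMap.lTensor H φ (T₁.symm s) := by
      apply τ.injective
      rw [h1, LinearEquiv.apply_symm_apply, hs]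
    have h5 := congrArg (LinearMap.lTensor H N.mkQ) h4
    rw [LinearMap.lTensor_tmul, ← LinearMap.comp_apply, ← LinearMap.lTensor_comp] at h5
    have : N.mkQ ∘ₗ φ = 0 := LinearMap.range_mkQ_comp φ
    rw [h5, this, LinearMap.lTensor_zero, LinearMap.zero_apply]
  obtain ⟨p, hp⟩ := exists_ne (0 : H)
  have h6 : N.mkQ t = 0 := by
    have := h3 p
    by_contra hne
    refine hp ((Module.forall_dual_apply_eq_zero_iff ℂ p).1 fun g => ?_)
    have h7 := congrArg (TensorProduct.lid ℂ _ ∘ LinearMap.rTensor _ g) this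
    have hne' : t ∉ N := fun h => hne ((Submodule.Quotient.mk_eq_zero N).2 h)
    simpa [hne'] using h7
  obtain ⟨e, he⟩ := (Submodule.Quotient.mk_eq_zero N).1 h6
  exact ⟨e, he⟩

/-- Elements of a unital module over `H` have local units in `H`. -/
theorem exists_local_unit {M : Type*} [AddCommGroup M] [Module ℂ M] {act : H →ₗ[ℂ] M →ₗ[ℂ] M}
    (hact : ∀ a b m, act (a * b) m = act a (act b m))
    (hsurj : Function.Surjective (TensorProduct.lift act)) (m : M) : ∃ e, act e m = m := by
  obtain ⟨t, rfl⟩ := hsurj m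
  obtain ⟨e, he⟩ := exists_local_unit_tensor t
  refine ⟨e, ?_⟩
  conv_rhs => rw [← he]
  generalize t = s
  induction s using TensorProduct.induction_on with
  | zero => simp
  | tmul a m => simp [hact]
  | add y z hy hz => simp only [map_add, hy, hz]

/-! ### The coproduct acting on a unital module -/

section ComulAct

variable {M : Type*} [AddCommGroup M] [Module ℂ M]

/-- For m = b m' the value is Δ(a)(1 ⊗ b) applied to m', and a section σ provides such a
decomposition. The stated property characterizes the map without decomposing m, because (f ⊗ 1)Δ(a)
already lies in H ⊗ H; hence σ does not matter. -/
theorem exists_comulAct {act : H →ₗ[ℂ] M →ₗ[ℂ] M}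
    (hact : ∀ a b m, act (a * b) m = act a (act b m))
    (hsurj : Function.Surjective (TensorProduct.lift act)) :
    ∃ τ : H ⊗[ℂ] M →ₗ[ℂ] H ⊗[ℂ] M, ∀ f a m,
      LinearMap.rTensor M (LinearMap.mulLeft ℂ f) (τ (a ⊗ₜ m)) =
        LinearMap.lTensor H (act.flip m) (T₂ (f ⊗ₜ[ℂ] a)) := by
  obtain ⟨σ, hσ⟩ := LinearMap.exists_rightInverse_of_surjective _ (LinearMap.range_eq_top.2 hsurj)
  refine ⟨LinearMap.lTensor H (TensorProduct.lift act) ∘ₗ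
    (TensorProduct.assoc ℂ H H M).toLinearMap ∘ₗ LinearMap.rTensor M (T₁ (A := H)).toLinearMap ∘ₗ
    (TensorProduct.assoc ℂ H H M).symm.toLinearMap ∘ₗ LinearMap.lTensor H σ, fun f a m => ?_⟩
  have key : ∀ s : H ⊗[ℂ] M, LinearMap.rTensor M (LinearMap.mulLeft ℂ f)
      (LinearMap.lTensor H (TensorProduct.lift act) (TensorProduct.assoc ℂ H H M
        (LinearMap.rTensor M (T₁ (A := H)).toLinearMap
          ((TensorProduct.assoc ℂ H H M).symm (a ⊗ₜ s))))) =
      LinearMap.lTensor H (act.flip (TensorProduct.lift act s)) (T₂ (f ⊗ₜ[ℂ] a)) := by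
    intro s
    induction s using TensorProduct.induction_on with
    | zero => simp
    | add y z hy hz => simp only [map_add, TensorProduct.tmul_add, hy, hz,
        LinearMap.lTensor_add, LinearMap.add_apply]
    | tmul b m =>
      have e1 : ∀ w : H ⊗[ℂ] H, LinearMap.rTensor M (LinearMap.mulLeft ℂ f)
          (LinearMap.lTensor H (TensorProduct.lift act) (TensorProduct.assoc ℂ H H M
            (w ⊗ₜ m))) = LinearMap.lTensor H (act.flip m)
              (LinearMap.rTensor H (LinearMap.mulLeft ℂ f) w) := by
        intro w
        induction w using TensorProduct.induction_on with
        | zero => simp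
        | add y z hy hz => simp only [map_add, TensorProduct.add_tmul, hy, hz]
        | tmul x y => simp
      rw [TensorProduct.assoc_symm_tmul, LinearMap.rTensor_tmul, LinearEquiv.coe_coe, e1,
        mulLeft_T₁, TensorProduct.lift.tmul]
      generalize T₂ (f ⊗ₜ[ℂ] a) = w
      induction w using TensorProduct.induction_on with
      | zero => simp
      | add y z hy hz => simp only [map_add, hy, hz]
      | tmul x y => simp [hact]
  have h := key (σ m)
  rw [← LinearMap.comp_apply (TensorProduct.lift act) σ, hσ, LinearMap.id_apply] at h
  simpa using h

/-- The map `a ⊗ m ↦ ∑ a₁ ⊗ a₂ m` for a unital left module over `H`. -/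
def comulAct {act : H →ₗ[ℂ] M →ₗ[ℂ] M}
    (hact : ∀ a b m, act (a * b) m = act a (act b m))
    (hsurj : Function.Surjective (TensorProduct.lift act)) : H ⊗[ℂ] M →ₗ[ℂ] H ⊗[ℂ] M :=
  (exists_comulAct hact hsurj).choose

variable {act : H →ₗ[ℂ] M →ₗ[ℂ] M}
    (hact : ∀ a b m, act (a * b) m = act a (act b m))
    (hsurj : Function.Surjective (TensorProduct.lift act))

theorem mulLeft_comulAct (f a : H) (m : M) :
    LinearMap.rTensor M (LinearMap.mulLeft ℂ f) (comulAct hact hsurj (a ⊗ₜ m)) =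
      LinearMap.lTensor H (act.flip m) (T₂ (f ⊗ₜ[ℂ] a)) :=
  (exists_comulAct hact hsurj).choose_spec f a m

/-- `∑ a₁ ⊗ a₂ (b m) = ∑ p ⊗ q m` where `∑ p ⊗ q = Δ(a)(1 ⊗ b)`. -/
theorem comulAct_act (a b : H) (m : M) :
    comulAct hact hsurj (a ⊗ₜ act b m) = LinearMap.lTensor H (act.flip m) (T₁ (a ⊗ₜ[ℂ] b)) := by
  refine rTensor_mulLeft_ext nondegenerate fun f => ?_
  rw [mulLeft_comulAct, ← LinearMap.comp_apply (LinearMap.rTensor M _),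
    LinearMap.rTensor_comp_lTensor, ← LinearMap.lTensor_comp_rTensor, LinearMap.comp_apply,
    mulLeft_T₁]
  generalize T₂ (f ⊗ₜ[ℂ] a) = w
  induction w using TensorProduct.induction_on with
  | zero => simp
  | add y z hy hz => simp only [map_add, hy, hz]
  | tmul x y => simp [hact]

end ComulAct

end Hopf

/-! ### The pentagon equation -/

section Pentagon

variable {H : Type*} [NonUnitalRing H] [Module ℂ H] [IsScalarTower ℂ H H] [SMulCommClass ℂ H H]
  [RegularMultiplierHopfAlgebra H]

/-- The left action of `Δ(a)` on `H ⊗ H`, as a linear map in `a`. -/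
def ΔLeft : H →ₗ[ℂ] H ⊗[ℂ] H →ₗ[ℂ] H ⊗[ℂ] H where
  toFun a := (Δ a).left
  map_add' a b := by rw [map_add]; rfl
  map_smul' r a := by rw [map_smul]; rfl

theorem ΔLeft_apply (a : H) : ΔLeft a = (Δ a).left := rfl

/-- `a ⊗ p ⊗ q ↦ Δ₁₂(a₁)(1 ⊗ p ⊗ a₂ q)`. -/
def T₁₂T₁₃ : H ⊗[ℂ] (H ⊗[ℂ] H) →ₗ[ℂ] H ⊗[ℂ] (H ⊗[ℂ] H) :=
  (TensorProduct.assoc ℂ H H H).toLinearMap ∘ₗ LinearMap.rTensor H (T₁ (A := H)).toLinearMap ∘ₗ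
    (TensorProduct.rightComm ℂ H H H).toLinearMap ∘ₗ
    LinearMap.rTensor H (T₁ (A := H)).toLinearMap ∘ₗ
    (TensorProduct.rightComm ℂ H H H).toLinearMap ∘ₗ
    (TensorProduct.assoc ℂ H H H).symm.toLinearMap

theorem T₁₂T₁₃_tmul (a p q : H) : T₁₂T₁₃ (a ⊗ₜ[ℂ] (p ⊗ₜ[ℂ] q)) =
    TensorProduct.assoc ℂ H H H (LinearMap.rTensor H (T₁ (A := H)).toLinearMap
      (TensorProduct.rightComm ℂ H H H (T₁ (a ⊗ₜ[ℂ] q) ⊗ₜ p))) := by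
  simp [T₁₂T₁₃]

/-- Both sides are ∑ fa₁ ⊗ a₂p ⊗ a₃q; this is the coassociativity axiom with the middle leg covered
by p. -/
theorem coassoc_mulRight (f a p q : H) :
    LinearMap.rTensor (H ⊗[ℂ] H) (LinearMap.mulLeft ℂ f) (T₁₂T₁₃ (a ⊗ₜ[ℂ] (p ⊗ₜ[ℂ] q))) =
      LinearMap.lTensor H (ΔLeft.flip (p ⊗ₜ q)) (T₂ (f ⊗ₜ[ℂ] a)) := by
  have e1 : ∀ w : H ⊗[ℂ] H, LinearMap.rTensor (H ⊗[ℂ] H) (LinearMap.mulLeft ℂ f)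
      (TensorProduct.assoc ℂ H H H (LinearMap.rTensor H (T₁ (A := H)).toLinearMap
        (TensorProduct.rightComm ℂ H H H (w ⊗ₜ p)))) =
      LinearMap.lTensor H (LinearMap.rTensor H (LinearMap.mulRight ℂ p))
        (TensorProduct.assoc ℂ H H H (LinearMap.rTensor H (T₂ (A := H)).toLinearMap
          ((TensorProduct.assoc ℂ H H H).symm (f ⊗ₜ w)))) := by
    intro w
    induction w using TensorProduct.induction_on with
    | zero => simp
    | add y z hy hz => simp only [map_add, TensorProduct.add_tmul, TensorProduct.tmul_add, hy, hz]
    | tmul r s =>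
      have e2 : ∀ w : H ⊗[ℂ] H, LinearMap.rTensor (H ⊗[ℂ] H) (LinearMap.mulLeft ℂ f)
          (TensorProduct.assoc ℂ H H H (w ⊗ₜ s)) = TensorProduct.assoc ℂ H H H
            (LinearMap.rTensor H (LinearMap.mulLeft ℂ f) w ⊗ₜ s) := by
        intro w
        induction w using TensorProduct.induction_on with
        | zero => simp
        | add y z hy hz => simp only [map_add, TensorProduct.add_tmul, hy, hz]
        | tmul x y => simp
      rw [TensorProduct.rightComm_tmul, LinearMap.rTensor_tmul, LinearEquiv.coe_coe, e2,
        mulLeft_T₁, TensorProduct.assoc_symm_tmul, LinearMap.rTensor_tmul, LinearEquiv.coe_coe]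
      generalize T₂ (f ⊗ₜ[ℂ] r) = w
      induction w using TensorProduct.induction_on with
      | zero => simp
      | add y z hy hz => simp only [map_add, TensorProduct.add_tmul, hy, hz]
      | tmul x y => simp
  rw [T₁₂T₁₃_tmul, e1, coassoc]
  generalize T₂ (f ⊗ₜ[ℂ] a) = w
  induction w using TensorProduct.induction_on with
  | zero => simp
  | add y z hy hz => simp only [map_add, TensorProduct.add_tmul, hy, hz]
  | tmul x y => simp [ΔLeft_apply, Δ_left_tmul]

/-- The pentagon equation for `T₁`. -/
theorem T₁₂T₁₃_T₁ (a b c : H) : T₁₂T₁₃ (a ⊗ₜ[ℂ] T₁ (b ⊗ₜ[ℂ] c)) =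
    LinearMap.lTensor H (T₁ (A := H)).toLinearMap
      (TensorProduct.assoc ℂ H H H (T₁ (a ⊗ₜ[ℂ] b) ⊗ₜ c)) := by
  -- Multiplied with f in the first leg, the two sides become ∑ fa₁ ⊗ Δ(a₂)Δ(b)(1 ⊗ c) and ∑ fa₁ ⊗
  -- Δ(a₂b)(1 ⊗ c), equal since Δ is a homomorphism.
  refine rTensor_mulLeft_ext nondegenerate fun f => ?_
  have e1 : ∀ w : H ⊗[ℂ] H, LinearMap.rTensor (H ⊗[ℂ] H) (LinearMap.mulLeft ℂ f)
      (T₁₂T₁₃ (a ⊗ₜ[ℂ] w)) = LinearMap.lTensor H (ΔLeft.flip w) (T₂ (f ⊗ₜ[ℂ] a)) := by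
    intro w
    induction w using TensorProduct.induction_on with
    | zero => simp
    | add y z hy hz => simp only [map_add, TensorProduct.tmul_add, hy, hz,
        LinearMap.lTensor_add, LinearMap.add_apply]
    | tmul p q => exact coassoc_mulRight f a p q
  have e2 : ∀ w : H ⊗[ℂ] H, LinearMap.rTensor (H ⊗[ℂ] H) (LinearMap.mulLeft ℂ f)
      (LinearMap.lTensor H (T₁ (A := H)).toLinearMap (TensorProduct.assoc ℂ H H H (w ⊗ₜ c))) =
      LinearMap.lTensor H (T₁ (A := H)).toLinearMap (TensorProduct.assoc ℂ H H H
        (LinearMap.rTensor H (LinearMap.mulLeft ℂ f) w ⊗ₜ c)) := by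
    intro w
    induction w using TensorProduct.induction_on with
    | zero => simp
    | add y z hy hz => simp only [map_add, TensorProduct.add_tmul, hy, hz]
    | tmul x y => simp
  rw [e1, e2, mulLeft_T₁]
  generalize T₂ (f ⊗ₜ[ℂ] a) = w
  induction w using TensorProduct.induction_on with
  | zero => simp
  | add y z hy hz => simp only [map_add, TensorProduct.add_tmul, hy, hz]
  | tmul x y => simp [ΔLeft_apply, Δ_left_T₁]

end Pentagon

/-! ### The twist map is bijective -/

section Twist

variable {D C : Type*}
  [NonUnitalRing D] [Module ℂ D] [IsScalarTower ℂ D D] [SMulCommClass ℂ D D]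
  [RegularMultiplierHopfAlgebra D]
  [NonUnitalRing C] [Module ℂ C] [IsScalarTower ℂ C C] [SMulCommClass ℂ C C]
  [LeftModuleAlgebra D C]

theorem exists_act_eq_self (c : C) : ∃ e : D, LeftModuleAlgebra.act e c = c :=
  exists_local_unit LeftModuleAlgebra.mul_act (actMap_surjective D C) c

/-- `R (d ⊗ c)(1 ⊗ d') = ∑ (p ▷ c) ⊗ q` where `∑ p ⊗ q = Δ(d)(1 ⊗ d')`. -/
theorem mulRight_twist (d d' : D) (c : C) :
    LinearMap.lTensor C (LinearMap.mulRight ℂ d') (twist D C (d ⊗ₜ c)) =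
      LinearMap.rTensor D (LeftModuleAlgebra.act.flip c) (T₁ (d ⊗ₜ[ℂ] d')) := by
  have h : twist D C (d ⊗ₜ c) = twistAux D C (d ⊗ₜ actSection D C c) := by simp [twist]
  rw [h, twistAux_mul, actMap_actSection]

theorem twist_lTensor_act (c : C) (z : D ⊗[ℂ] D) :
    twist D C (LinearMap.lTensor D (LeftModuleAlgebra.act.flip c) z) =
      LinearMap.rTensor D (LeftModuleAlgebra.act.flip c) (T₃ z) := by
  induction z using TensorProduct.induction_on with
  | zero => simp
  | add y z hy hz => simp only [map_add, hy, hz]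
  | tmul d e => rw [LinearMap.lTensor_tmul, LinearMap.flip_apply, twist_act]

/-- If e ▷ c = c, then e ⊗ d = `T₃` z for some z in D ⊗ D, and acting on c turns z into a preimage
of c ⊗ d. -/
theorem twist_surjective : Function.Surjective (twist D C) := by
  intro x
  induction x using TensorProduct.induction_on with
  | zero => exact ⟨0, map_zero _⟩
  | add y z hy hz =>
    obtain ⟨a, rfl⟩ := hy
    obtain ⟨b, rfl⟩ := hz
    exact ⟨a + b, map_add _ _ _⟩
  | tmul c d =>
    obtain ⟨e, he⟩ := exists_act_eq_self (D := D) c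
    refine ⟨LinearMap.lTensor D (LeftModuleAlgebra.act.flip c) (T₃.symm (e ⊗ₜ[ℂ] d)), ?_⟩
    rw [twist_lTensor_act, LinearEquiv.apply_symm_apply, LinearMap.rTensor_tmul,
      LinearMap.flip_apply, he]

/-- R is the map induced by the bijection τ below on the quotient C of D ⊗ C by the kernel K of the
action. It is injective because τ⁻¹ maps K ⊗ D into D ⊗ K, which follows from local units for K. -/
theorem twist_injective : Function.Injective (twist D C) := by
  rw [injective_iff_map_eq_zero]
  intro t ht
  let τ : D ⊗[ℂ] (D ⊗[ℂ] C) ≃ₗ[ℂ] (D ⊗[ℂ] C) ⊗[ℂ] D :=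
    (TensorProduct.assoc ℂ D D C).symm ≪≫ₗ
      TensorProduct.congr (T₃ (A := D)) (LinearEquiv.refl ℂ C) ≪≫ₗ TensorProduct.rightComm ℂ D D C
  have hτ : ∀ (a b : D) (c : C),
      τ (a ⊗ₜ (b ⊗ₜ c)) = TensorProduct.rightComm ℂ D D C (T₃ (a ⊗ₜ[ℂ] b) ⊗ₜ c) := by
    intro a b c
    simp [τ]
  have h1 : ∀ z, twist D C (LinearMap.lTensor D (actMap D C) z) =
      LinearMap.rTensor D (actMap D C) (τ z) := by
    intro z
    induction z using TensorProduct.induction_on with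
    | zero => simp
    | add y z hy hz => simp only [map_add, hy, hz]
    | tmul d s =>
      induction s using TensorProduct.induction_on with
      | zero => simp
      | add y z hy hz => simp only [map_add, TensorProduct.tmul_add, hy, hz]
      | tmul e c =>
        have : actMap D C (e ⊗ₜ c) = LeftModuleAlgebra.act e c := rfl
        rw [LinearMap.lTensor_tmul, hτ, this, twist_act]
        generalize T₃ (d ⊗ₜ[ℂ] e) = w
        induction w using TensorProduct.induction_on with
        | zero => simp
        | add y z hy hz => simp only [map_add, TensorProduct.add_tmul, hy, hz]
        | tmul x y => simp [actMap]
  let φ : D ⊗[ℂ] C →ₗ[ℂ] D →ₗ[ℂ] D ⊗[ℂ] C := (LinearMap.rTensorHom C ∘ₗ LinearMap.mul ℂ D).flip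
  have hφ : ∀ k e, φ k e = LinearMap.rTensor C (LinearMap.mulLeft ℂ e) k := fun k e => rfl
  have h2 : ∀ (k : D ⊗[ℂ] C) (w : D ⊗[ℂ] D),
      τ (LinearMap.lTensor D (φ k) w) = LinearMap.rTensor D (φ k) (T₃ w) := by
    intro k w
    induction w using TensorProduct.induction_on with
    | zero => simp
    | add y z hy hz => simp only [map_add, hy, hz]
    | tmul a b =>
      induction k using TensorProduct.induction_on with
      | zero => simp
      | add y z hy hz => simp only [map_add, LinearMap.lTensor_add, LinearMap.add_apply,
          LinearMap.rTensor_add, hy, hz]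
      | tmul d c =>
        rw [LinearMap.lTensor_tmul, hφ, LinearMap.rTensor_tmul, LinearMap.mulLeft_apply, hτ,
          T₃_tmul_mul]
        generalize T₃ (a ⊗ₜ[ℂ] b) = w
        induction w using TensorProduct.induction_on with
        | zero => simp
        | add y z hy hz => simp only [map_add, TensorProduct.add_tmul, hy, hz]
        | tmul x y => simp [hφ]
  let K := LinearMap.ker (actMap D C)
  -- With k = e k, the inverse of τ acts only on the factor e: τ⁻¹(ek ⊗ q) = ∑ a ⊗ bk where `T₃`
  -- sends ∑ a ⊗ b to e ⊗ q. Each bk stays in K.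
  have h3 : ∀ s : K ⊗[ℂ] D,
      LinearMap.lTensor D (actMap D C) (τ.symm (LinearMap.rTensor D K.subtype s)) = 0 := by
    intro s
    induction s using TensorProduct.induction_on with
    | zero => simp
    | add y z hy hz => simp only [map_add, hy, hz, add_zero]
    | tmul k q =>
      obtain ⟨e, he⟩ := exists_local_unit_tensor (k : D ⊗[ℂ] C)
      have h4 : τ.symm (LinearMap.rTensor D K.subtype (k ⊗ₜ q)) =
          LinearMap.lTensor D (φ k) (T₃.symm (e ⊗ₜ[ℂ] q)) := by
        rw [LinearEquiv.symm_apply_eq, h2, LinearEquiv.apply_symm_apply, LinearMap.rTensor_tmul,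
          LinearMap.rTensor_tmul, hφ, he, Submodule.subtype_apply]
      have h5 : actMap D C ∘ₗ φ k = 0 := by
        ext d
        have h6 : ∀ k', actMap D C (φ k' d) = LeftModuleAlgebra.act d (actMap D C k') := by
          intro k'
          induction k' using TensorProduct.induction_on with
          | zero => simp
          | add y z hy hz => simp only [map_add, LinearMap.add_apply, hy, hz]
          | tmul a c => simp [hφ, actMap, LeftModuleAlgebra.mul_act]
        rw [LinearMap.comp_apply, h6, LinearMap.mem_ker.1 k.2, map_zero, LinearMap.zero_apply]
      rw [h4, ← LinearMap.comp_apply, ← LinearMap.lTensor_comp, h5, LinearMap.lTensor_zero,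
        LinearMap.zero_apply]
  obtain ⟨z, rfl⟩ := LinearMap.lTensor_surjective D (actMap_surjective D C) t
  rw [h1] at ht
  obtain ⟨s, hs⟩ := (rTensor_exact D (LinearMap.exact_subtype_ker_map (actMap D C))
    (actMap_surjective D C) _).1 ht
  have := h3 s
  rwa [hs, LinearEquiv.symm_apply_apply] at this

end Twist

/-! ### The smash product as an algebra -/

namespace SmashProduct

section Algebra

variable {D C : Type*}
  [NonUnitalRing D] [Module ℂ D] [IsScalarTower ℂ D D] [SMulCommClass ℂ D D]
  [RegularMultiplierHopfAlgebra D]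
  [NonUnitalRing C] [Module ℂ C] [IsScalarTower ℂ C C] [SMulCommClass ℂ C C]
  [LeftModuleAlgebra D C]

theorem induction {motive : SmashProduct C D → Prop} (x : SmashProduct C D)
    (zero : motive 0) (tmul : ∀ c d, motive (equiv C D (c ⊗ₜ d)))
    (add : ∀ x y, motive x → motive y → motive (x + y)) : motive x := by
  obtain ⟨x, rfl⟩ := (equiv C D).surjective x
  induction x using TensorProduct.induction_on with
  | zero => simpa using zero
  | tmul c d => exact tmul c d
  | add y z hy hz => simpa only [map_add] using add _ _ hy hz

theorem mulC_equiv (c c' : C) (d : D) :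
    mulC C D c (equiv C D (c' ⊗ₜ d)) = equiv C D ((c * c') ⊗ₜ d) := by
  simp [mulC]

theorem mulD_equiv (d d' : D) (c : C) :
    mulD C D d (equiv C D (c ⊗ₜ d')) =
      equiv C D (LinearMap.rTensor D (LeftModuleAlgebra.act.flip c) (T₁ (d ⊗ₜ[ℂ] d'))) := by
  rw [← mulRight_twist]
  have h : mulD C D d (equiv C D (c ⊗ₜ d')) = equiv C D (LinearMap.lTensor C (LinearMap.mul' ℂ D)
      (TensorProduct.assoc ℂ C D D (twist D C (d ⊗ₜ c) ⊗ₜ d'))) := by simp [mulD]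
  rw [h]
  generalize twist D C (d ⊗ₜ c) = w
  induction w using TensorProduct.induction_on with
  | zero => simp
  | add y z hy hz => simp only [map_add, TensorProduct.add_tmul, hy, hz]
  | tmul x y => simp

theorem equiv_tmul_mul (c : C) (d : D) (y : SmashProduct C D) :
    equiv C D (c ⊗ₜ d) * y = mulC C D c (mulD C D d y) := rfl

theorem smash_add_mul (x y z : SmashProduct C D) : (x + y) * z = x * z + y * z :=
  LinearMap.map_add₂ (mulMap C D) x y z

theorem mulC_mulC (c c' : C) (y : SmashProduct C D) :
    mulC C D (c * c') y = mulC C D c (mulC C D c' y) := by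
  induction y using induction with
  | zero => simp
  | tmul a b => simp only [mulC_equiv, mul_assoc]
  | add y z hy hz => simp only [map_add, hy, hz]

theorem mulD_mulD (d d' : D) (y : SmashProduct C D) :
    mulD C D (d * d') y = mulD C D d (mulD C D d' y) := by
  induction y using induction with
  | zero => simp
  | add y z hy hz => simp only [map_add, hy, hz]
  | tmul c b =>
    rw [mulD_equiv, mulD_equiv, ← Δ_left_T₁]
    generalize T₁ (d' ⊗ₜ[ℂ] b) = w
    induction w using TensorProduct.induction_on with
    | zero => simp
    | add y z hy hz => simp only [map_add, hy, hz]
    | tmul p q =>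
      rw [Δ_left_tmul, LinearMap.rTensor_tmul, mulD_equiv]
      generalize T₁ (d ⊗ₜ[ℂ] q) = w
      induction w using TensorProduct.induction_on with
      | zero => simp
      | add y z hy hz => simp only [map_add, hy, hz]
      | tmul x y => simp [LeftModuleAlgebra.mul_act]

/-- `b (v (e y)) = ∑ (p ▷ v) (q y)` where `∑ p ⊗ q = Δ(b)(1 ⊗ e)`. -/
theorem mulD_mulC_mulD (b e : D) (v : C) (y : SmashProduct C D) :
    mulD C D b (mulC C D v (mulD C D e y)) =
      TensorProduct.lift ((LinearMap.llcomp ℂ _ _ _).compl₁₂ (mulC C D ∘ₗ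
        LeftModuleAlgebra.act.flip v) (mulD C D)) (T₁ (b ⊗ₜ[ℂ] e)) y := by
  induction y using induction with
  | zero => simp
  | add y z hy hz => simp only [map_add, hy, hz]
  | tmul c d =>
    -- Ψ(p ⊗ q ⊗ r) = (p ▷ v)(q ▷ c) r. Both sides are Ψ of ∑ b₁ ⊗ b₂e₁ ⊗ b₃e₂d, which the pentagon
    -- equation computes in two ways.
    let Ψ : D ⊗[ℂ] (D ⊗[ℂ] D) →ₗ[ℂ] SmashProduct C D :=
      (equiv C D).toLinearMap ∘ₗ LinearMap.rTensor D (TensorProduct.lift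
        ((LinearMap.mul ℂ C).compl₁₂ (LeftModuleAlgebra.act.flip v)
          (LeftModuleAlgebra.act.flip c))) ∘ₗ (TensorProduct.assoc ℂ D D D).symm.toLinearMap
    have e1 : ∀ w : D ⊗[ℂ] D, mulD C D b (mulC C D v
        (equiv C D (LinearMap.rTensor D (LeftModuleAlgebra.act.flip c) w))) =
        Ψ (T₁₂T₁₃ (b ⊗ₜ w)) := by
      intro w
      induction w using TensorProduct.induction_on with
      | zero => simp
      | add y z hy hz => simp only [map_add, TensorProduct.tmul_add, hy, hz]
      | tmul p q =>
        rw [LinearMap.rTensor_tmul, mulC_equiv, mulD_equiv, T₁₂T₁₃_tmul]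
        generalize T₁ (b ⊗ₜ[ℂ] q) = w
        induction w using TensorProduct.induction_on with
        | zero => simp
        | add y z hy hz => simp only [map_add, TensorProduct.add_tmul, hy, hz]
        | tmul x y => simp [Ψ, LeftModuleAlgebra.act_mul]
    rw [mulD_equiv, e1, T₁₂T₁₃_T₁]
    generalize T₁ (b ⊗ₜ[ℂ] e) = w
    induction w using TensorProduct.induction_on with
    | zero => simp
    | add y z hy hz => simp only [map_add, TensorProduct.add_tmul, LinearMap.add_apply, hy, hz]
    | tmul x y =>
      rw [TensorProduct.assoc_tmul, LinearMap.lTensor_tmul, TensorProduct.lift.tmul,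
        LinearMap.compl₁₂_apply, LinearMap.llcomp_apply, mulD_equiv, LinearEquiv.coe_coe]
      generalize T₁ (y ⊗ₜ[ℂ] d) = w
      induction w using TensorProduct.induction_on with
      | zero => simp
      | add y z hy hz => simp only [map_add, TensorProduct.tmul_add, hy, hz]
      | tmul x y => simp [Ψ, mulC_equiv]

/-- D · CD = CD: if e ▷ c = c, the bijection `T₁` provides ∑ a ⊗ b with ∑ a(cb) = (e ▷ c)d = cd. -/
theorem lift_mulD_surjective : Function.Surjective (TensorProduct.lift (mulD C D)) := by
  intro x
  induction x using induction with
  | zero => exact ⟨0, map_zero _⟩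
  | add y z hy hz =>
    obtain ⟨a, rfl⟩ := hy
    obtain ⟨b, rfl⟩ := hz
    exact ⟨a + b, map_add _ _ _⟩
  | tmul c d =>
    obtain ⟨e, he⟩ := exists_act_eq_self (D := D) c
    have key : ∀ z : D ⊗[ℂ] D, TensorProduct.lift (mulD C D)
        (LinearMap.lTensor D ((equiv C D).toLinearMap ∘ₗ TensorProduct.mk ℂ C D c) z) =
        equiv C D (LinearMap.rTensor D (LeftModuleAlgebra.act.flip c) (T₁ z)) := by
      intro z
      induction z using TensorProduct.induction_on with
      | zero => simp
      | add y z hy hz => simp only [map_add, hy, hz]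
      | tmul a b => rw [← mulD_equiv]; simp
    refine ⟨_, (key (T₁.symm (e ⊗ₜ[ℂ] d))).trans ?_⟩
    rw [LinearEquiv.apply_symm_apply, LinearMap.rTensor_tmul, LinearMap.flip_apply, he]

theorem exists_mulD_eq_self (y : SmashProduct C D) : ∃ e, mulD C D e y = y :=
  exists_local_unit mulD_mulD lift_mulD_surjective y

/-- Covering rule in CD: a factor e of D at the left of y may be absorbed into the D-leg of the
preceding factor. -/
theorem equiv_mul_mulD (t : C ⊗[ℂ] D) (e : D) (y : SmashProduct C D) :
    equiv C D t * mulD C D e y =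
      equiv C D (LinearMap.lTensor C (LinearMap.mulRight ℂ e) t) * y := by
  induction t using TensorProduct.induction_on with
  | zero => simp
  | add y z hy hz => simp only [map_add, smash_add_mul, hy, hz]
  | tmul c d => simp only [LinearMap.lTensor_tmul, equiv_tmul_mul, LinearMap.mulRight_apply,
      mulD_mulD]

/-- The commutation rule `d c = R(d ⊗ c)` in the smash product. -/
theorem mulD_mulC (b : D) (v : C) (y : SmashProduct C D) :
    mulD C D b (mulC C D v y) = equiv C D (twist D C (b ⊗ₜ v)) * y := by
  -- The local unit e covers the second leg of Δ(b).
  obtain ⟨e, he⟩ := exists_mulD_eq_self y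
  rw [← he, mulD_mulC_mulD, equiv_mul_mulD, mulRight_twist]
  generalize T₁ (b ⊗ₜ[ℂ] e) = w
  induction w using TensorProduct.induction_on with
  | zero => simp
  | add y z hy hz => simp only [map_add, smash_add_mul, LinearMap.add_apply, hy, hz]
  | tmul p q => simp [equiv_tmul_mul]

theorem mulC_mul (c : C) (x y : SmashProduct C D) : mulC C D c x * y = mulC C D c (x * y) := by
  induction x using induction with
  | zero => simp
  | add y z hy hz => simp only [map_add, smash_add_mul, hy, hz]
  | tmul a b => rw [mulC_equiv, equiv_tmul_mul, equiv_tmul_mul, mulC_mulC]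

/-- For x = ab the commutation rule moves d past a, and both sides become ∑ (d₁ ▷ a)(d₂b)y. -/
theorem mulD_mul (d : D) (x y : SmashProduct C D) : mulD C D d x * y = mulD C D d (x * y) := by
  induction x using induction with
  | zero => simp
  | add y z hy hz => simp only [map_add, smash_add_mul, hy, hz]
  | tmul a b =>
    rw [equiv_tmul_mul, mulD_mulC, equiv_mul_mulD, mulRight_twist, mulD_equiv]

/-- Left multiplication by cd is that of c after that of d, and each of these commutes with right
multiplications. -/
theorem smash_mul_assoc (x y z : SmashProduct C D) : x * y * z = x * (y * z) := by
  induction x using induction with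
  | zero => simp
  | add a b ha hb => simp only [smash_add_mul, ha, hb]
  | tmul a b => rw [equiv_tmul_mul, equiv_tmul_mul, mulC_mul, mulD_mul]

/-- Writing x = R(t), one has R(t)(cd) = R(t(1 ⊗ c))(1 ⊗ d). Non-degeneracy of D removes d,
injectivity of R removes R, and non-degeneracy of C removes c. -/
theorem eq_zero_of_forall_mul (hC : NondegenerateMul C) (x : SmashProduct C D)
    (hx : ∀ y, x * y = 0) : x = 0 := by
  obtain ⟨x, rfl⟩ := (equiv C D).surjective x
  obtain ⟨t, rfl⟩ := twist_surjective x
  have key : ∀ (s : D ⊗[ℂ] C) (c : C) (d : D), equiv C D (twist D C s) * equiv C D (c ⊗ₜ d) =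
      equiv C D (LinearMap.lTensor C (LinearMap.mulRight ℂ d)
        (twist D C (LinearMap.lTensor D (LinearMap.mulRight ℂ c) s))) := by
    intro s c d
    induction s using TensorProduct.induction_on with
    | zero => simp
    | add y z hy hz => simp only [map_add, smash_add_mul, hy, hz]
    | tmul a b =>
      rw [← mulD_mulC, mulC_equiv, mulD_equiv, ← mulRight_twist, LinearMap.lTensor_tmul,
        LinearMap.mulRight_apply]
  have h : t = 0 := by
    refine lTensor_mulRight_ext hC fun c => twist_injective ?_
    refine lTensor_mulRight_ext (nondegenerate (A := D)) fun d => ?_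
    apply (equiv C D).injective
    rw [← key, hx, map_zero, map_zero, map_zero, map_zero]
  rw [h, map_zero, map_zero]

end Algebra

/-! ### Local units for the action of C on CD. -/

section CAction

variable {C D : Type*}
  [NonUnitalRing C] [Module ℂ C] [IsScalarTower ℂ C C] [SMulCommClass ℂ C C]
  [RegularMultiplierHopfAlgebra C]
  [NonUnitalRing D] [Module ℂ D] [IsScalarTower ℂ D D] [SMulCommClass ℂ D D]

theorem exists_mulC_eq_self (y : SmashProduct C D) : ∃ e, mulC C D e y = y := by
  obtain ⟨t, rfl⟩ := (equiv C D).surjective y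
  obtain ⟨e, he⟩ := exists_local_unit_tensor t
  refine ⟨e, ?_⟩
  conv_rhs => rw [← he]
  generalize t = s
  induction s using TensorProduct.induction_on with
  | zero => simp
  | add y z hy hz => simp only [map_add, hy, hz]
  | tmul a b => simp [mulC]

end CAction

end SmashProduct

/-! ### The cotwist maps of a coaction -/

section Cotwist

variable {C D : Type*}
  [NonUnitalRing C] [Module ℂ C] [IsScalarTower ℂ C C] [SMulCommClass ℂ C C]
  [RegularMultiplierHopfAlgebra C] [AddCommGroup D] [Module ℂ D] [RightCoaction C D]

theorem cotwistOp_tmul (c : C) (d : D) :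
    cotwistOp C D (c ⊗ₜ d) = (RightCoaction.Γ (C := C) d).1.1 c := rfl

/-- `(1 ⊗ c)(Γ(d)(1 ⊗ c')) = ((1 ⊗ c)Γ(d))(1 ⊗ c')`. -/
theorem mulLeft_cotwistOp (c c' : C) (d : D) :
    LinearMap.lTensor D (LinearMap.mulLeft ℂ c) (cotwistOp C D (c' ⊗ₜ d)) =
      LinearMap.lTensor D (LinearMap.mulRight ℂ c') (cotwist C D (c ⊗ₜ d)) :=
  (RightCoaction.Γ (C := C) d).2 c c'

/-- Elements of M₀(D ⊗ C) are not assumed to be module maps; compatibility of their two halves and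
non-degeneracy of C force it. -/
theorem cotwistOp_mul_tmul (c c' : C) (d : D) :
    cotwistOp C D ((c * c') ⊗ₜ d) =
      LinearMap.lTensor D (LinearMap.mulRight ℂ c') (cotwistOp C D (c ⊗ₜ d)) := by
  refine lTensor_mulLeft_ext (nondegenerate (A := C)) fun e => ?_
  rw [mulLeft_cotwistOp, ← LinearMap.comp_apply (LinearMap.lTensor D _) (LinearMap.lTensor D _),
    ← LinearMap.lTensor_comp]
  have h1 : LinearMap.mulLeft ℂ e ∘ₗ LinearMap.mulRight ℂ c' =
      LinearMap.mulRight ℂ c' ∘ₗ LinearMap.mulLeft ℂ e := by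
    ext x; simp [mul_assoc]
  have h2 : LinearMap.mulRight ℂ (c * c') =
      LinearMap.mulRight ℂ c' ∘ₗ LinearMap.mulRight ℂ c := by
    ext x; simp [mul_assoc]
  rw [h1, h2, LinearMap.lTensor_comp, LinearMap.lTensor_comp, LinearMap.comp_apply,
    LinearMap.comp_apply, mulLeft_cotwistOp]

/-- The right half of an element of M₀(D ⊗ C) determines the left half, so injectivity of Γ can be
tested on products Γ(d)(1 ⊗ c). -/
theorem eq_zero_of_forall_cotwistOp (d : D) (h : ∀ c : C, cotwistOp C D (c ⊗ₜ d) = 0) :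
    d = 0 := by
  apply RightCoaction.injective (C := C)
  rw [map_zero]
  apply Subtype.ext
  refine Prod.ext (LinearMap.ext fun c => h c) (LinearMap.ext fun c => ?_)
  change cotwist C D (c ⊗ₜ d) = 0
  refine lTensor_mulRight_ext (nondegenerate (A := C)) fun c' => ?_
  rw [← mulLeft_cotwistOp, h, map_zero, map_zero]

/-- The cotwist map of a coaction is injective. -/
theorem cotwist_injective : Function.Injective (cotwist C D) := by
  rw [injective_iff_map_eq_zero]
  intro z hz
  refine TensorProduct.eq_of_forall_lTensor_eq
    (fun r : C => cotwistOp C D ∘ₗ TensorProduct.mk ℂ C D r)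
    (fun d hd => eq_zero_of_forall_cotwistOp d hd) fun r => ?_
  -- Λ(u ⊗ v)(s) = (Γ ⊗ ι)(s(1 ⊗ v))(1 ⊗ u ⊗ 1).
  let Λ : C ⊗[ℂ] C →ₗ[ℂ] D ⊗[ℂ] C →ₗ[ℂ] (D ⊗[ℂ] C) ⊗[ℂ] C :=
    TensorProduct.lift (LinearMap.mk₂ ℂ (fun u v => LinearMap.rTensor C (cotwistOp C D) ∘ₗ
      (TensorProduct.assoc ℂ C D C).symm.toLinearMap ∘ₗ TensorProduct.mk ℂ C (D ⊗[ℂ] C) u ∘ₗ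
      LinearMap.lTensor D (LinearMap.mulRight ℂ v))
      (fun u u' v => by ext; simp)
      (fun r u v => by ext; simp)
      (fun u v v' => by ext; simp [mul_add, TensorProduct.tmul_add])
      (fun r u v => by ext; simp [mul_smul_comm]))
  have hΛ : ∀ u v s, Λ (u ⊗ₜ v) s = LinearMap.rTensor C (cotwistOp C D)
      ((TensorProduct.assoc ℂ C D C).symm
        (u ⊗ₜ LinearMap.lTensor D (LinearMap.mulRight ℂ v) s)) := by
    intro u v s
    simp [Λ]
  -- For y = p ⊗ d the left side is (1 ⊗ (1 ⊗ p)Δ(r'))-type data with r' the C-leg of Γ(d)(1 ⊗ r),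
  -- covered by q. Coassociativity of Γ rewrites it as (1 ⊗ 1 ⊗ p)(Γ ⊗ ι)(Γ(d)) times Δ(r)(1 ⊗ q),
  -- so it depends on y only through T(y).
  have key : ∀ (y : C ⊗[ℂ] D) (q : C), LinearMap.lTensor D (LinearMap.lTensor C
      (LinearMap.mulRight ℂ q)) (LinearMap.lTensor D (T₄ (A := C)).toLinearMap
        (TensorProduct.leftComm ℂ C D C (LinearMap.lTensor C
          (cotwistOp C D ∘ₗ TensorProduct.mk ℂ C D r) y))) =
      TensorProduct.assoc ℂ D C C (Λ (T₁ (r ⊗ₜ[ℂ] q)) (cotwist C D y)) := by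
    intro y q
    induction y using TensorProduct.induction_on with
    | zero => simp
    | add y z hy hz => simp only [map_add, hy, hz]
    | tmul p d =>
      have e1 : ∀ s : D ⊗[ℂ] C, LinearMap.lTensor D (LinearMap.lTensor C
          (LinearMap.mulRight ℂ q)) (LinearMap.lTensor D (T₄ (A := C)).toLinearMap
            (TensorProduct.leftComm ℂ C D C (p ⊗ₜ s))) =
          TensorProduct.assoc ℂ D C C (LinearMap.lTensor (D ⊗[ℂ] C) (LinearMap.mulLeft ℂ p)
            ((TensorProduct.assoc ℂ D C C).symm (LinearMap.lTensor D (T₁ (A := C)).toLinearMap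
              (TensorProduct.assoc ℂ D C C (s ⊗ₜ q))))) := by
        intro s
        induction s using TensorProduct.induction_on with
        | zero => simp
        | add y z hy hz => simp only [map_add, TensorProduct.tmul_add, TensorProduct.add_tmul,
            hy, hz]
        | tmul a y =>
          have e3 : ∀ w : C ⊗[ℂ] C, TensorProduct.assoc ℂ D C C (LinearMap.lTensor (D ⊗[ℂ] C)
              (LinearMap.mulLeft ℂ p) ((TensorProduct.assoc ℂ D C C).symm (a ⊗ₜ w))) =
              a ⊗ₜ LinearMap.lTensor C (LinearMap.mulLeft ℂ p) w := by
            intro w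
            induction w using TensorProduct.induction_on with
            | zero => simp
            | add y z hy hz => simp only [map_add, TensorProduct.tmul_add, hy, hz]
            | tmul a y => simp
          rw [TensorProduct.assoc_tmul, LinearMap.lTensor_tmul, LinearEquiv.coe_coe, e3,
            mulLeft_T₁']
          simp
      have e2 : ∀ w : C ⊗[ℂ] C, LinearMap.lTensor (D ⊗[ℂ] C) (LinearMap.mulLeft ℂ p)
          (LinearMap.rTensor C (cotwistOp C D) ((TensorProduct.assoc ℂ C D C).symm
            (LinearMap.lTensor C (cotwistOp C D) (TensorProduct.assoc ℂ C C D (w ⊗ₜ d))))) =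
          Λ w (cotwist C D (p ⊗ₜ d)) := by
        intro w
        induction w using TensorProduct.induction_on with
        | zero => simp
        | add y z hy hz => simp only [map_add, TensorProduct.add_tmul, LinearMap.add_apply, hy, hz]
        | tmul u v =>
          rw [hΛ, ← mulLeft_cotwistOp, TensorProduct.assoc_tmul, LinearMap.lTensor_tmul]
          generalize cotwistOp C D (v ⊗ₜ d) = s
          induction s using TensorProduct.induction_on with
          | zero => simp
          | add y z hy hz => simp only [map_add, TensorProduct.tmul_add, hy, hz]
          | tmul a b => simp
      rw [LinearMap.lTensor_tmul, LinearMap.comp_apply, TensorProduct.mk_apply, e1, ← e2]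
      congr 2
      exact (RightCoaction.coassoc_right d r q).symm
  -- As T(z) = 0, the element built from Γ applied to the D-leg of z vanishes after `T₄`. Since `T₄`
  -- is bijective and r is arbitrary, injectivity of Γ gives z = 0.
  have h1 : LinearMap.lTensor D (T₄ (A := C)).toLinearMap (TensorProduct.leftComm ℂ C D C
      (LinearMap.lTensor C (cotwistOp C D ∘ₗ TensorProduct.mk ℂ C D r) z)) = 0 := by
    refine TensorProduct.eq_of_forall_lTensor_eq
      (fun q : C => LinearMap.lTensor C (LinearMap.mulRight ℂ q)) (fun b hb => ?_) fun q => ?_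
    · exact lTensor_mulRight_ext (nondegenerate (A := C)) fun a => by rw [hb a, map_zero]
    · rw [key, hz, map_zero, map_zero, map_zero]
  have h2 : Function.Injective (LinearMap.lTensor D (T₄ (A := C)).toLinearMap) :=
    (TensorProduct.congr (LinearEquiv.refl ℂ D) (T₄ (A := C))).injective
  apply (TensorProduct.leftComm ℂ C D C).injective
  apply h2
  rw [h1, map_zero, map_zero, map_zero]

/-- `c ⊗ d ↦ ∑ (u ⊗ r) ⊗ v` where `∑ r ⊗ s = Γ(d)(1 ⊗ c')` and `∑ u ⊗ v = Δ(c)(1 ⊗ s)`, that is,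
`Δ₁₃(c) Γ₂₃(d) (1 ⊗ 1 ⊗ c')`. -/
def comulCoact (c' : C) : C ⊗[ℂ] D →ₗ[ℂ] (C ⊗[ℂ] D) ⊗[ℂ] C :=
  (TensorProduct.rightComm ℂ C C D).toLinearMap ∘ₗ
    (TensorProduct.comm ℂ D (C ⊗[ℂ] C)).toLinearMap ∘ₗ
    LinearMap.lTensor D (T₁ (A := C)).toLinearMap ∘ₗ
    (TensorProduct.leftComm ℂ C D C).toLinearMap ∘ₗ
    LinearMap.lTensor C (cotwistOp C D ∘ₗ TensorProduct.mk ℂ C D c')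

/-- `(ι ⊗ Δ)((1 ⊗ c)Γ(d)) = (1 ⊗ Δ(c))(Γ ⊗ ι)Γ(d)`, covered by `1 ⊗ 1 ⊗ c'` from the right. -/
theorem cotwist_comulCoact (c' : C) (x : C ⊗[ℂ] D) :
    TensorProduct.assoc ℂ D C C (LinearMap.rTensor C (cotwist C D) (comulCoact c' x)) =
      LinearMap.lTensor D (T₁ (A := C)).toLinearMap
        (TensorProduct.assoc ℂ D C C (cotwist C D x ⊗ₜ c')) := by
  induction x using TensorProduct.induction_on with
  | zero => simp
  | add y z hy hz => simp only [map_add, TensorProduct.add_tmul, hy, hz]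
  | tmul c d =>
    refine TensorProduct.eq_of_forall_lTensor_eq
      (fun e : C => LinearMap.rTensor C (LinearMap.mulRight ℂ e)) (fun b hb => ?_) fun e => ?_
    · exact rTensor_mulRight_ext (nondegenerate (A := C)) fun a => by rw [hb a, map_zero]
    have e1 : ∀ s : D ⊗[ℂ] C, LinearMap.lTensor D (LinearMap.rTensor C (LinearMap.mulRight ℂ e))
        (TensorProduct.assoc ℂ D C C (LinearMap.rTensor C (cotwist C D)
          (TensorProduct.rightComm ℂ C C D (TensorProduct.comm ℂ D (C ⊗[ℂ] C)
            (LinearMap.lTensor D (T₁ (A := C)).toLinearMap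
              (TensorProduct.leftComm ℂ C D C (c ⊗ₜ s))))))) =
        LinearMap.lTensor D (Δ c).left (TensorProduct.assoc ℂ D C C
          (LinearMap.rTensor C (cotwistOp C D) ((TensorProduct.assoc ℂ C D C).symm
            (e ⊗ₜ s)))) := by
      intro s
      induction s using TensorProduct.induction_on with
      | zero => simp
      | add y z hy hz => simp only [map_add, TensorProduct.tmul_add, hy, hz]
      | tmul r s =>
        let μ : C ⊗[ℂ] C →ₗ[ℂ] C →ₗ[ℂ] C ⊗[ℂ] C :=
          (LinearMap.rTensorHom C ∘ₗ (LinearMap.mul ℂ C).flip).flip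
        have hμ : ∀ w b, μ w b = LinearMap.rTensor C (LinearMap.mulRight ℂ b) w := fun _ _ => rfl
        have e3 : ∀ w : C ⊗[ℂ] C, LinearMap.lTensor D
            (LinearMap.rTensor C (LinearMap.mulRight ℂ e)) (TensorProduct.assoc ℂ D C C
              (LinearMap.rTensor C (cotwist C D) (TensorProduct.rightComm ℂ C C D (w ⊗ₜ r)))) =
            LinearMap.lTensor D (μ w) (cotwistOp C D (e ⊗ₜ r)) := by
          intro w
          induction w using TensorProduct.induction_on with
          | zero => simp
          | add y z hy hz => simp only [map_add, TensorProduct.add_tmul, LinearMap.lTensor_add,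
              LinearMap.add_apply, hy, hz]
          | tmul u v =>
            have e4 : ∀ x : D ⊗[ℂ] C, LinearMap.lTensor D
                (LinearMap.rTensor C (LinearMap.mulRight ℂ e)) (TensorProduct.assoc ℂ D C C
                  (x ⊗ₜ v)) = TensorProduct.assoc ℂ D C C
                    (LinearMap.lTensor D (LinearMap.mulRight ℂ e) x ⊗ₜ v) := by
              intro x
              induction x using TensorProduct.induction_on with
              | zero => simp
              | add y z hy hz => simp only [map_add, TensorProduct.add_tmul, hy, hz]
              | tmul x y => simp
            rw [TensorProduct.rightComm_tmul, LinearMap.rTensor_tmul, e4, ← mulLeft_cotwistOp]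
            generalize cotwistOp C D (e ⊗ₜ r) = x
            induction x using TensorProduct.induction_on with
            | zero => simp
            | add y z hy hz => simp only [map_add, TensorProduct.add_tmul, hy, hz]
            | tmul x y => simp [hμ]
        rw [TensorProduct.leftComm_tmul, LinearMap.lTensor_tmul, TensorProduct.comm_tmul,
          LinearEquiv.coe_coe, e3, TensorProduct.assoc_symm_tmul, LinearMap.rTensor_tmul]
        generalize cotwistOp C D (e ⊗ₜ r) = x
        induction x using TensorProduct.induction_on with
        | zero => simp
        | add y z hy hz => simp only [map_add, TensorProduct.add_tmul, hy, hz]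
        | tmul x y => simp [hμ, Δ_left_tmul]
    have e2 : ∀ s : D ⊗[ℂ] C, LinearMap.lTensor D (LinearMap.rTensor C (LinearMap.mulRight ℂ e))
        (LinearMap.lTensor D (T₁ (A := C)).toLinearMap
          (TensorProduct.assoc ℂ D C C (s ⊗ₜ c'))) =
        LinearMap.lTensor D (ΔLeft.flip (e ⊗ₜ[ℂ] c')) s := by
      intro s
      induction s using TensorProduct.induction_on with
      | zero => simp
      | add y z hy hz => simp only [map_add, TensorProduct.add_tmul, hy, hz]
      | tmul x y => simp [ΔLeft_apply, Δ_left_tmul]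
    -- The coassociativity of Γ is available on products Δ(p)(1 ⊗ q); bijectivity of `T₁` then gives
    -- it for e ⊗ c'.
    have e5 : ∀ z : C ⊗[ℂ] C, LinearMap.lTensor D (ΔLeft.flip (T₁ z)) (cotwist C D (c ⊗ₜ d)) =
        LinearMap.lTensor D (Δ c).left (TensorProduct.assoc ℂ D C C
          (LinearMap.rTensor C (cotwistOp C D) ((TensorProduct.assoc ℂ C D C).symm
            (LinearMap.lTensor C (cotwistOp C D)
              (TensorProduct.assoc ℂ C C D (T₁ z ⊗ₜ d)))))) := by
      intro z
      induction z using TensorProduct.induction_on with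
      | zero => simp
      | add y z hy hz => simp only [map_add, TensorProduct.add_tmul, LinearMap.lTensor_add,
          LinearMap.add_apply, hy, hz]
      | tmul p q =>
        have e6 : ∀ s : D ⊗[ℂ] C, LinearMap.lTensor D (ΔLeft.flip (T₁ (p ⊗ₜ[ℂ] q))) s =
            LinearMap.lTensor D ((T₁ (A := C)).toLinearMap ∘ₗ (TensorProduct.mk ℂ C C).flip q)
              (LinearMap.lTensor D (LinearMap.mulRight ℂ p) s) := by
          intro s
          induction s using TensorProduct.induction_on with
          | zero => simp
          | add y z hy hz => simp only [map_add, hy, hz]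
          | tmul x y => simp [ΔLeft_apply, Δ_left_T₁]
        have e7 := RightCoaction.coassoc_right d p q
        change LinearMap.rTensor C (cotwistOp C D) ((TensorProduct.assoc ℂ C D C).symm
          (LinearMap.lTensor C (cotwistOp C D)
            (TensorProduct.assoc ℂ C C D (T₁ (p ⊗ₜ[ℂ] q) ⊗ₜ[ℂ] d)))) =
          (TensorProduct.assoc ℂ D C C).symm (LinearMap.lTensor D (T₁ (A := C)).toLinearMap
            (TensorProduct.assoc ℂ D C C (cotwistOp C D (p ⊗ₜ d) ⊗ₜ q))) at e7
        rw [e6, ← mulLeft_cotwistOp, e7, LinearEquiv.apply_symm_apply]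
        generalize cotwistOp C D (p ⊗ₜ d) = x
        induction x using TensorProduct.induction_on with
        | zero => simp
        | add y z hy hz => simp only [map_add, TensorProduct.add_tmul, hy, hz]
        | tmul x y => simp [Δ_left_T₁]
    have e8 := e5 (T₁.symm (e ⊗ₜ[ℂ] c'))
    rw [LinearEquiv.apply_symm_apply, TensorProduct.assoc_tmul, LinearMap.lTensor_tmul] at e8
    rw [e2, e8, ← e1]
    simp [comulCoact]

end Cotwist

/-! ### Twist maps and the coproduct -/

section TwistComul

variable {D C : Type*}
  [NonUnitalRing D] [Module ℂ D] [IsScalarTower ℂ D D] [SMulCommClass ℂ D D]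
  [RegularMultiplierHopfAlgebra D]
  [NonUnitalRing C] [Module ℂ C] [IsScalarTower ℂ C C] [SMulCommClass ℂ C C]
  [LeftModuleAlgebra D C]

/-- `a₁ b ⊗ a₂ ⊗ a₃ c`, computed in two ways. -/
theorem T₃_T₁_coassoc (a b c : D) :
    LinearMap.lTensor D (T₁ (A := D)).toLinearMap
      (TensorProduct.assoc ℂ D D D (T₃ (a ⊗ₜ[ℂ] b) ⊗ₜ c)) =
    TensorProduct.assoc ℂ D D D (LinearMap.rTensor D
      ((T₃ (A := D)).toLinearMap ∘ₗ (TensorProduct.mk ℂ D D).flip b) (T₁ (a ⊗ₜ[ℂ] c))) := by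
  -- Multiplication with f in the first leg replaces `T₃` by `T₂`, with b as a mere right factor,
  -- and leaves the coassociativity axiom.
  refine rTensor_mulLeft_ext nondegenerate fun f => ?_
  have e1 : ∀ w : D ⊗[ℂ] D, LinearMap.rTensor (D ⊗[ℂ] D) (LinearMap.mulLeft ℂ f)
      (LinearMap.lTensor D (T₁ (A := D)).toLinearMap (TensorProduct.assoc ℂ D D D (w ⊗ₜ c))) =
      LinearMap.lTensor D (T₁ (A := D)).toLinearMap (TensorProduct.assoc ℂ D D D
        (LinearMap.rTensor D (LinearMap.mulLeft ℂ f) w ⊗ₜ c)) := by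
    intro w
    induction w using TensorProduct.induction_on with
    | zero => simp
    | add y z hy hz => simp only [map_add, TensorProduct.add_tmul, hy, hz]
    | tmul x y => simp
  have e2 : ∀ w : D ⊗[ℂ] D, LinearMap.rTensor (D ⊗[ℂ] D) (LinearMap.mulLeft ℂ f)
      (TensorProduct.assoc ℂ D D D (LinearMap.rTensor D
        ((T₃ (A := D)).toLinearMap ∘ₗ (TensorProduct.mk ℂ D D).flip b) w)) =
      LinearMap.rTensor (D ⊗[ℂ] D) (LinearMap.mulRight ℂ b)
        (TensorProduct.assoc ℂ D D D (LinearMap.rTensor D (T₂ (A := D)).toLinearMap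
          ((TensorProduct.assoc ℂ D D D).symm (f ⊗ₜ w)))) := by
    intro w
    induction w using TensorProduct.induction_on with
    | zero => simp
    | add y z hy hz => simp only [map_add, TensorProduct.tmul_add, hy, hz]
    | tmul p q =>
      have e3 : ∀ (g : D →ₗ[ℂ] D) (w : D ⊗[ℂ] D), LinearMap.rTensor (D ⊗[ℂ] D) g
          (TensorProduct.assoc ℂ D D D (w ⊗ₜ q)) =
          TensorProduct.assoc ℂ D D D (LinearMap.rTensor D g w ⊗ₜ q) := by
        intro g w
        induction w using TensorProduct.induction_on with
        | zero => simp
        | add y z hy hz => simp only [map_add, TensorProduct.add_tmul, hy, hz]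
        | tmul x y => simp
      rw [LinearMap.rTensor_tmul, e3, TensorProduct.assoc_symm_tmul, LinearMap.rTensor_tmul, e3]
      simp [mulLeft_T₃']
  rw [e1, e2, coassoc, mulLeft_T₃']
  generalize T₂ (f ⊗ₜ[ℂ] a) = w
  induction w using TensorProduct.induction_on with
  | zero => simp
  | add y z hy hz => simp only [map_add, TensorProduct.add_tmul, hy, hz]
  | tmul x y => simp

/-- `(ι ⊗ Δ)R(d ⊗ c)` and `(R ⊗ ι)(Δ(d) ⊗ c)` agree, covered by `1 ⊗ 1 ⊗ e` from the right. -/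
theorem twist_T₁ (d e : D) (c : C) :
    LinearMap.lTensor C (T₁ (A := D)).toLinearMap
      (TensorProduct.assoc ℂ C D D (twist D C (d ⊗ₜ c) ⊗ₜ e)) =
    TensorProduct.assoc ℂ C D D (LinearMap.rTensor D
      (twist D C ∘ₗ (TensorProduct.mk ℂ D C).flip c) (T₁ (d ⊗ₜ[ℂ] e))) := by
  -- With c = b ▷ c the twist is given by `T₃`, and the claim is the preceding identity acting on c.
  obtain ⟨b, hb⟩ := exists_act_eq_self (D := D) c
  rw [← hb, twist_act]
  have e1 : ∀ w : D ⊗[ℂ] D, LinearMap.lTensor C (T₁ (A := D)).toLinearMap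
      (TensorProduct.assoc ℂ C D D
        (LinearMap.rTensor D (LeftModuleAlgebra.act.flip c) w ⊗ₜ e)) =
      LinearMap.rTensor (D ⊗[ℂ] D) (LeftModuleAlgebra.act.flip c)
        (LinearMap.lTensor D (T₁ (A := D)).toLinearMap
          (TensorProduct.assoc ℂ D D D (w ⊗ₜ e))) := by
    intro w
    induction w using TensorProduct.induction_on with
    | zero => simp
    | add y z hy hz => simp only [map_add, TensorProduct.add_tmul, hy, hz]
    | tmul x y => simp
  rw [e1, T₃_T₁_coassoc]
  generalize T₁ (d ⊗ₜ[ℂ] e) = w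
  induction w using TensorProduct.induction_on with
  | zero => simp
  | add y z hy hz => simp only [map_add, hy, hz]
  | tmul p q =>
    simp only [LinearMap.rTensor_tmul, LinearMap.comp_apply, LinearMap.flip_apply,
      TensorProduct.mk_apply, twist_act, LinearEquiv.coe_coe]
    generalize T₃ (p ⊗ₜ[ℂ] b) = w
    induction w using TensorProduct.induction_on with
    | zero => simp
    | add y z hy hz => simp only [map_add, TensorProduct.add_tmul, hy, hz]
    | tmul x y => simp

/-- `(1 ⊗ f)Rᵒᵖ(d ⊗ c) = ∑ (q ▷ c) ⊗ p` where `∑ p ⊗ q = (f ⊗ 1)Δ(d)`. -/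
theorem mulLeft_twistOp (f d : D) (c : C) :
    LinearMap.rTensor C (LinearMap.mulLeft ℂ f)
      (TensorProduct.comm ℂ C D (twistOp D C (d ⊗ₜ c))) =
      LinearMap.lTensor D (LeftModuleAlgebra.act.flip c) (T₂ (f ⊗ₜ[ℂ] d)) := by
  obtain ⟨e, he⟩ := exists_act_eq_self (D := D) c
  have e1 : ∀ w : D ⊗[ℂ] D, LinearMap.rTensor C (LinearMap.mulLeft ℂ f)
      (LinearMap.lTensor D (LeftModuleAlgebra.act.flip c) w) =
      LinearMap.lTensor D (LeftModuleAlgebra.act.flip c)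
        (LinearMap.rTensor D (LinearMap.mulLeft ℂ f) w) := by
    intro w
    rw [← LinearMap.comp_apply, LinearMap.rTensor_comp_lTensor, ← LinearMap.lTensor_comp_rTensor,
      LinearMap.comp_apply]
  conv_lhs => rw [← he, twistOp_act]
  rw [← TensorProduct.comm_symm, LinearEquiv.symm_apply_apply, e1, mulLeft_T₁]
  generalize T₂ (f ⊗ₜ[ℂ] d) = w
  induction w using TensorProduct.induction_on with
  | zero => simp
  | add y z hy hz => simp only [map_add, hy, hz]
  | tmul x y => simp [LeftModuleAlgebra.mul_act, he]

end TwistComul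

namespace SmashProduct

/-! ### Operators on `CD ⊗ CD` -/

section Operators

variable {V B B' : Type*} [AddCommGroup V] [Module ℂ V] [AddCommGroup B] [Module ℂ B]
  [AddCommGroup B'] [Module ℂ B']

/-- The operator `x ⊗ y ↦ b x ⊗ b' y` for `b ⊗ b'` in a tensor product of two spaces that act. -/
def tensorOp (α : B →ₗ[ℂ] V →ₗ[ℂ] V) (β : B' →ₗ[ℂ] V →ₗ[ℂ] V) :
    B ⊗[ℂ] B' →ₗ[ℂ] V ⊗[ℂ] V →ₗ[ℂ] V ⊗[ℂ] V :=
  TensorProduct.homTensorHomMap (RingHom.id ℂ) V V V V ∘ₗ TensorProduct.map α β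

@[simp]
theorem tensorOp_tmul (α : B →ₗ[ℂ] V →ₗ[ℂ] V) (β : B' →ₗ[ℂ] V →ₗ[ℂ] V) (b : B) (b' : B')
    (x y : V) : tensorOp α β (b ⊗ₜ b') (x ⊗ₜ y) = α b x ⊗ₜ β b' y := by
  simp [tensorOp]

end Operators

variable {D C : Type*}
  [NonUnitalRing D] [Module ℂ D] [IsScalarTower ℂ D D] [SMulCommClass ℂ D D]
  [RegularMultiplierHopfAlgebra D]
  [NonUnitalRing C] [Module ℂ C] [IsScalarTower ℂ C C] [SMulCommClass ℂ C C]
  [LeftModuleAlgebra D C]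

theorem tensorOp_mul {B B' : Type*} [AddCommGroup B] [Module ℂ B] [AddCommGroup B'] [Module ℂ B']
    (α : B →ₗ[ℂ] SmashProduct C D →ₗ[ℂ] SmashProduct C D)
    (β : B' →ₗ[ℂ] SmashProduct C D →ₗ[ℂ] SmashProduct C D)
    (hα : ∀ b x y, α b x * y = α b (x * y)) (hβ : ∀ b x y, β b x * y = β b (x * y))
    (s : B ⊗[ℂ] B') (x y a b : SmashProduct C D) :
    tensorOp α β s (x ⊗ₜ y) * (a ⊗ₜ b) = tensorOp α β s ((x * a) ⊗ₜ (y * b)) := by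
  induction s using TensorProduct.induction_on with
  | zero => simp
  | add y z hy hz => simp only [map_add, LinearMap.add_apply, add_mul, hy, hz]
  | tmul p q => simp [hα, hβ]

/-- `∑ d₁ ⊗ d₂ y` for `d` in `D` and `y` in the smash product. -/
def comulD : D ⊗[ℂ] SmashProduct C D →ₗ[ℂ] D ⊗[ℂ] SmashProduct C D :=
  comulAct mulD_mulD lift_mulD_surjective

theorem comulD_mulD (d e : D) (y : SmashProduct C D) :
    comulD (d ⊗ₜ mulD C D e y) = LinearMap.lTensor D ((mulD C D).flip y) (T₁ (d ⊗ₜ[ℂ] e)) :=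
  comulAct_act _ _ d e y

/-- `p ⊗ z ↦ ∑ p₁ ⊗ (p₂ ▷ v) z`. -/
def twistOpAct (v : C) : D ⊗[ℂ] SmashProduct C D →ₗ[ℂ] D ⊗[ℂ] SmashProduct C D :=
  LinearMap.lTensor D (TensorProduct.lift (mulC C D)) ∘ₗ
    (TensorProduct.assoc ℂ D C (SmashProduct C D)).toLinearMap ∘ₗ
    LinearMap.rTensor (SmashProduct C D)
      ((TensorProduct.comm ℂ C D).toLinearMap ∘ₗ twistOp D C ∘ₗ (TensorProduct.mk ℂ D C).flip v)

/-- Both sides are ∑ d₁ ⊗ (d₂ ▷ v)d₃y, by the commutation rule d v = ∑ (d₁ ▷ v)d₂ and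
coassociativity. This is how Rᵒᵖ, and with it P, enters. -/
theorem comulD_mulC (d : D) (v : C) (y : SmashProduct C D) :
    comulD (d ⊗ₜ mulC C D v y) = twistOpAct v (comulD (d ⊗ₜ y)) := by
  obtain ⟨e, he⟩ := exists_mulD_eq_self y
  rw [← he, comulD_mulD]
  refine rTensor_mulLeft_ext nondegenerate fun f => ?_
  rw [comulD, mulLeft_comulAct]
  -- Φ(a ⊗ p ⊗ q) = a ⊗ (p ▷ v)(q y), evaluated below at ∑ fd₁ ⊗ d₂ ⊗ d₃e.
  let Φ : D ⊗[ℂ] (D ⊗[ℂ] D) →ₗ[ℂ] D ⊗[ℂ] SmashProduct C D :=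
    LinearMap.lTensor D (TensorProduct.lift ((mulC C D ∘ₗ LeftModuleAlgebra.act.flip v).compl₂
      ((mulD C D).flip y)))
  have e1 : ∀ w : D ⊗[ℂ] D, LinearMap.rTensor (SmashProduct C D) (LinearMap.mulLeft ℂ f)
      (twistOpAct v (LinearMap.lTensor D ((mulD C D).flip y) w)) =
      Φ (TensorProduct.assoc ℂ D D D (LinearMap.rTensor D (T₂ (A := D)).toLinearMap
        ((TensorProduct.assoc ℂ D D D).symm (f ⊗ₜ w)))) := by
    intro w
    induction w using TensorProduct.induction_on with
    | zero => simp
    | add y z hy hz => simp only [map_add, TensorProduct.tmul_add, hy, hz]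
    | tmul p q =>
      have e2 : ∀ s : D ⊗[ℂ] C, LinearMap.rTensor (SmashProduct C D) (LinearMap.mulLeft ℂ f)
          (LinearMap.lTensor D (TensorProduct.lift (mulC C D))
            (TensorProduct.assoc ℂ D C (SmashProduct C D) (s ⊗ₜ mulD C D q y))) =
          LinearMap.lTensor D (TensorProduct.lift (mulC C D))
            (TensorProduct.assoc ℂ D C (SmashProduct C D)
              (LinearMap.rTensor C (LinearMap.mulLeft ℂ f) s ⊗ₜ mulD C D q y)) := by
        intro s
        induction s using TensorProduct.induction_on with
        | zero => simp
        | add y z hy hz => simp only [map_add, TensorProduct.add_tmul, hy, hz]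
        | tmul x y => simp
      have e3 : twistOpAct v (LinearMap.lTensor D ((mulD C D).flip y) (p ⊗ₜ q)) =
          LinearMap.lTensor D (TensorProduct.lift (mulC C D))
            (TensorProduct.assoc ℂ D C (SmashProduct C D)
              (TensorProduct.comm ℂ C D (twistOp D C (p ⊗ₜ v)) ⊗ₜ mulD C D q y)) := by
        simp [twistOpAct]
      rw [e3, e2, mulLeft_twistOp, TensorProduct.assoc_symm_tmul, LinearMap.rTensor_tmul,
        LinearEquiv.coe_coe]
      generalize T₂ (f ⊗ₜ[ℂ] p) = s
      induction s using TensorProduct.induction_on with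
      | zero => simp
      | add y z hy hz => simp only [map_add, TensorProduct.add_tmul, hy, hz]
      | tmul x y => simp [Φ]
  rw [e1, coassoc]
  generalize T₂ (f ⊗ₜ[ℂ] d) = w
  induction w using TensorProduct.induction_on with
  | zero => simp
  | add y z hy hz => simp only [map_add, TensorProduct.add_tmul, hy, hz]
  | tmul a b =>
    rw [LinearMap.lTensor_tmul, LinearMap.flip_apply, mulD_mulC_mulD]
    have e4 : ∀ w : D ⊗[ℂ] D, TensorProduct.lift ((LinearMap.llcomp ℂ _ _ _).compl₁₂ (mulC C D ∘ₗ
        LeftModuleAlgebra.act.flip v) (mulD C D)) w y =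
        TensorProduct.lift ((mulC C D ∘ₗ LeftModuleAlgebra.act.flip v).compl₂
          ((mulD C D).flip y)) w := by
      intro w
      induction w using TensorProduct.induction_on with
      | zero => simp
      | add y z hy hz => simp only [map_add, LinearMap.add_apply, hy, hz]
      | tmul x y => simp
    rw [e4]
    simp [Φ]

/-- `∑ ∑ c' ⊗ d'₁ ⊗ d'₂ y = ∑ R(d₁ ⊗ c) ⊗ d₂ y` where `∑ c' ⊗ d' = R(d ⊗ c)`. -/
theorem comulD_twist (d : D) (c : C) (y : SmashProduct C D) :
    LinearMap.lTensor C comulD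
      (TensorProduct.assoc ℂ C D (SmashProduct C D) (twist D C (d ⊗ₜ c) ⊗ₜ y)) =
    TensorProduct.assoc ℂ C D (SmashProduct C D) (LinearMap.rTensor (SmashProduct C D)
      (twist D C ∘ₗ (TensorProduct.mk ℂ D C).flip c) (comulD (d ⊗ₜ y))) := by
  obtain ⟨e, he⟩ := exists_mulD_eq_self y
  rw [← he, comulD_mulD]
  have e1 : ∀ s : C ⊗[ℂ] D, LinearMap.lTensor C comulD
      (TensorProduct.assoc ℂ C D (SmashProduct C D) (s ⊗ₜ mulD C D e y)) =
      LinearMap.lTensor C (LinearMap.lTensor D ((mulD C D).flip y))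
        (LinearMap.lTensor C (T₁ (A := D)).toLinearMap
          (TensorProduct.assoc ℂ C D D (s ⊗ₜ e))) := by
    intro s
    induction s using TensorProduct.induction_on with
    | zero => simp
    | add y z hy hz => simp only [map_add, TensorProduct.add_tmul, hy, hz]
    | tmul a b => simp [comulD_mulD]
  rw [e1, twist_T₁]
  generalize T₁ (d ⊗ₜ[ℂ] e) = w
  induction w using TensorProduct.induction_on with
  | zero => simp
  | add y z hy hz => simp only [map_add, hy, hz]
  | tmul p q =>
    simp only [LinearMap.rTensor_tmul, LinearMap.lTensor_tmul, LinearMap.comp_apply,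
      LinearMap.flip_apply, TensorProduct.mk_apply]
    generalize twist D C (p ⊗ₜ c) = s
    induction s using TensorProduct.induction_on with
    | zero => simp
    | add y z hy hz => simp only [map_add, TensorProduct.add_tmul, hy, hz]
    | tmul a b => simp

end SmashProduct

namespace SmashProduct

variable {C D : Type*}
  [NonUnitalRing C] [Module ℂ C] [IsScalarTower ℂ C C] [SMulCommClass ℂ C C]
  [RegularMultiplierHopfAlgebra C]
  [NonUnitalRing D] [Module ℂ D] [IsScalarTower ℂ D D] [SMulCommClass ℂ D D]
  [RegularMultiplierHopfAlgebra D]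
  [LeftModuleAlgebra D C]

/-! ### The action of `Δ_C(c)` on `CD ⊗ CD` -/

theorem multiplierCAct_tmul (m : Multiplier (C ⊗[ℂ] C)) (c c' : C) (d d' : D) :
    multiplierCAct C D m (equiv C D (c ⊗ₜ d) ⊗ₜ equiv C D (c' ⊗ₜ d')) =
      TensorProduct.map (equiv C D).toLinearMap (equiv C D).toLinearMap
        (TensorProduct.tensorTensorTensorComm ℂ C C D D (m.left (c ⊗ₜ c') ⊗ₜ (d ⊗ₜ d'))) := by
  simp [multiplierCAct]

theorem induction_tmul {motive : SmashProduct C D ⊗[ℂ] SmashProduct C D → Prop}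
    (z : SmashProduct C D ⊗[ℂ] SmashProduct C D) (zero : motive 0)
    (tmul : ∀ c d c' d', motive (equiv C D (c ⊗ₜ d) ⊗ₜ equiv C D (c' ⊗ₜ d')))
    (add : ∀ x y, motive x → motive y → motive (x + y)) : motive z := by
  induction z using TensorProduct.induction_on with
  | zero => exact zero
  | add y z hy hz => exact add _ _ hy hz
  | tmul x y =>
    induction x using induction with
    | zero => simpa using zero
    | add x x' hx hx' => rw [TensorProduct.add_tmul]; exact add _ _ hx hx'
    | tmul c d =>
      induction y using induction with
      | zero => simpa using zero
      | add y y' hy hy' => rw [TensorProduct.tmul_add]; exact add _ _ hy hy'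
      | tmul c' d' => exact tmul c d c' d'

theorem tensorOp_mulC_mulC (s : C ⊗[ℂ] C) (c c' : C) (d d' : D) :
    tensorOp (mulC C D) (mulC C D) s (equiv C D (c ⊗ₜ d) ⊗ₜ equiv C D (c' ⊗ₜ d')) =
      TensorProduct.map (equiv C D).toLinearMap (equiv C D).toLinearMap
        (TensorProduct.tensorTensorTensorComm ℂ C C D D ((s * (c ⊗ₜ c')) ⊗ₜ (d ⊗ₜ d'))) := by
  induction s using TensorProduct.induction_on with
  | zero => simp
  | add y z hy hz => simp only [map_add, add_mul, TensorProduct.add_tmul, LinearMap.add_apply,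
      hy, hz]
  | tmul a b => simp [mulC_equiv]

/-- The left action of `Δ_C(c)` on `CD ⊗ CD`, linear in `c`. -/
def comulCAct : C →ₗ[ℂ] SmashProduct C D ⊗[ℂ] SmashProduct C D →ₗ[ℂ]
    SmashProduct C D ⊗[ℂ] SmashProduct C D :=
  ((LinearMap.rTensorHom (D ⊗[ℂ] D) ∘ₗ ΔLeft (H := C)).compr₂
    (TensorProduct.map (equiv C D).toLinearMap (equiv C D).toLinearMap ∘ₗ
      (TensorProduct.tensorTensorTensorComm ℂ C C D D).toLinearMap)).compl₂
    ((TensorProduct.tensorTensorTensorComm ℂ C D C D).toLinearMap ∘ₗ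
      TensorProduct.map (equiv C D).symm.toLinearMap (equiv C D).symm.toLinearMap)

theorem comulCAct_apply (c : C) : comulCAct (D := D) c = multiplierCAct C D (Δ c) := rfl

theorem multiplierCAct_mul (m n : Multiplier (C ⊗[ℂ] C)) :
    multiplierCAct C D (m * n) = multiplierCAct C D m ∘ₗ multiplierCAct C D n := by
  have h : ∀ u : (C ⊗[ℂ] D) ⊗[ℂ] (C ⊗[ℂ] D),
      TensorProduct.map (equiv C D).symm.toLinearMap (equiv C D).symm.toLinearMap
        (TensorProduct.map (equiv C D).toLinearMap (equiv C D).toLinearMap u) = u :=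
    (TensorProduct.congr (equiv C D) (equiv C D)).symm_apply_apply
  have h' : ∀ u : (C ⊗[ℂ] C) ⊗[ℂ] (D ⊗[ℂ] D), TensorProduct.tensorTensorTensorComm ℂ C D C D
      (TensorProduct.tensorTensorTensorComm ℂ C C D D u) = u :=
    (TensorProduct.tensorTensorTensorComm ℂ C C D D).symm_apply_apply
  refine LinearMap.ext fun z => ?_
  simp only [multiplierCAct, LinearMap.comp_apply, LinearEquiv.coe_coe, h, h',
    Multiplier.left_mul, LinearMap.rTensor_comp]

theorem comulCAct_mul (a b : C) (z : SmashProduct C D ⊗[ℂ] SmashProduct C D) :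
    comulCAct (a * b) z = comulCAct a (comulCAct b z) := by
  simp only [comulCAct_apply, map_mul, multiplierCAct_mul, LinearMap.comp_apply]

/-- Once a factor s covers the second leg, Δ(a)(1 ⊗ s) is an element of C ⊗ C and acts by ordinary
left multiplications. -/
theorem comulCAct_tmul_mulC (a s : C) (x y : SmashProduct C D) :
    comulCAct a (x ⊗ₜ mulC C D s y) = tensorOp (mulC C D) (mulC C D) (T₁ (a ⊗ₜ s)) (x ⊗ₜ y) := by
  have key : ∀ z : SmashProduct C D ⊗[ℂ] SmashProduct C D,
      comulCAct a (LinearMap.lTensor _ (mulC C D s) z) =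
        tensorOp (mulC C D) (mulC C D) (T₁ (a ⊗ₜ s)) z := by
    intro z
    induction z using induction_tmul with
    | zero => simp
    | add y z hy hz => simp only [map_add, hy, hz]
    | tmul c d c' d' =>
      rw [LinearMap.lTensor_tmul, mulC_equiv, comulCAct_apply, multiplierCAct_tmul, T₁_spec,
        tensorOp_mulC_mulC]
  exact key (x ⊗ₜ y)

theorem comulCAct_mulC_tmul (a s : C) (x y : SmashProduct C D) :
    comulCAct a (mulC C D s x ⊗ₜ y) = tensorOp (mulC C D) (mulC C D) (T₃ (a ⊗ₜ s)) (x ⊗ₜ y) := by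
  have key : ∀ z : SmashProduct C D ⊗[ℂ] SmashProduct C D,
      comulCAct a (LinearMap.rTensor _ (mulC C D s) z) =
        tensorOp (mulC C D) (mulC C D) (T₃ (a ⊗ₜ s)) z := by
    intro z
    induction z using induction_tmul with
    | zero => simp
    | add y z hy hz => simp only [map_add, hy, hz]
    | tmul c d c' d' =>
      rw [LinearMap.rTensor_tmul, mulC_equiv, comulCAct_apply, multiplierCAct_tmul, T₃_spec,
        tensorOp_mulC_mulC]
  exact key (x ⊗ₜ y)

theorem comulCAct_tmul_mul (c : C) (x y a b : SmashProduct C D) :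
    comulCAct c (x ⊗ₜ y) * (a ⊗ₜ b) = comulCAct c ((x * a) ⊗ₜ (y * b)) := by
  obtain ⟨e, he⟩ := exists_mulC_eq_self y
  conv_lhs => rw [← he]
  conv_rhs => rw [← he]
  rw [mulC_mul, comulCAct_tmul_mulC, comulCAct_tmul_mulC, tensorOp_mul _ _ mulC_mul mulC_mul]

/-! ### The action of `Γ(d)` on `CD ⊗ CD` -/

variable [RightCoaction C D]

/-- The left action of `Γ(d)` on `CD ⊗ CD`. -/
def coactOp : D →ₗ[ℂ] SmashProduct C D ⊗[ℂ] SmashProduct C D →ₗ[ℂ]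
    SmashProduct C D ⊗[ℂ] SmashProduct C D :=
  completedModuleAct C D ∘ₗ RightCoaction.Γ (C := C) (D := D)

/-- Covered by c, Γ(d)(1 ⊗ c) lies in D ⊗ C and acts leg by leg; local units in C reduce the general
case to this one. -/
theorem coactOp_tmul_mulC (d : D) (c : C) (x y : SmashProduct C D) :
    coactOp d (x ⊗ₜ mulC C D c y) =
      tensorOp (mulD C D) (mulC C D) (cotwistOp C D (c ⊗ₜ d)) (x ⊗ₜ y) := by
  induction y using induction with
  | zero => simp
  | add y z hy hz => simp only [map_add, TensorProduct.tmul_add, hy, hz]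
  | tmul c' d' =>
    have h : coactOp d (x ⊗ₜ[ℂ] equiv C D ((c * c') ⊗ₜ d')) =
        LinearMap.lTensor (SmashProduct C D) (equiv C D).toLinearMap
          (LinearMap.rTensor (C ⊗[ℂ] D) (TensorProduct.lift (mulD C D).flip)
            ((TensorProduct.assoc ℂ (SmashProduct C D) D (C ⊗[ℂ] D)).symm
              (x ⊗ₜ TensorProduct.assoc ℂ D C D (cotwistOp C D ((c * c') ⊗ₜ d) ⊗ₜ d')))) := by
      simp [coactOp, completedModuleAct, cotwistOp_tmul]
    rw [mulC_equiv, h, cotwistOp_mul_tmul]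
    generalize cotwistOp C D (c ⊗ₜ d) = s
    induction s using TensorProduct.induction_on with
    | zero => simp
    | add y z hy hz => simp only [map_add, TensorProduct.add_tmul, TensorProduct.tmul_add,
        LinearMap.add_apply, hy, hz]
    | tmul a b => simp [mulC_equiv]

theorem coactOp_tmul_mul (d : D) (x y a b : SmashProduct C D) :
    coactOp d (x ⊗ₜ y) * (a ⊗ₜ b) = coactOp d ((x * a) ⊗ₜ (y * b)) := by
  obtain ⟨e, he⟩ := exists_mulC_eq_self y
  conv_lhs => rw [← he]
  conv_rhs => rw [← he]
  rw [mulC_mul, coactOp_tmul_mulC, coactOp_tmul_mulC, tensorOp_mul _ _ mulD_mul mulC_mul]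

/-! ### The action of `∑ Γ(d₁)(1 ⊗ d₂)` on `CD ⊗ CD` -/

/-- The left action of `∑ Γ(d₁)(1 ⊗ d₂)` on `CD ⊗ CD`. -/
def comulDAct : D →ₗ[ℂ] SmashProduct C D ⊗[ℂ] SmashProduct C D →ₗ[ℂ]
    SmashProduct C D ⊗[ℂ] SmashProduct C D :=
  TensorProduct.curry (TensorProduct.lift coactOp ∘ₗ
    (TensorProduct.leftComm ℂ (SmashProduct C D) D (SmashProduct C D)).toLinearMap ∘ₗ
    LinearMap.lTensor (SmashProduct C D) comulD ∘ₗ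
    (TensorProduct.leftComm ℂ D (SmashProduct C D) (SmashProduct C D)).toLinearMap)

theorem comulDAct_tmul (d : D) (x y : SmashProduct C D) :
    comulDAct d (x ⊗ₜ y) =
      TensorProduct.lift (coactOp.compl₂ (TensorProduct.mk ℂ _ _ x)) (comulD (d ⊗ₜ y)) := by
  have h : comulDAct d (x ⊗ₜ[ℂ] y) = TensorProduct.lift coactOp
      (TensorProduct.leftComm ℂ (SmashProduct C D) D (SmashProduct C D)
        (x ⊗ₜ comulD (d ⊗ₜ y))) := by simp [comulDAct]
  rw [h]
  generalize comulD (d ⊗ₜ y) = t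
  induction t using TensorProduct.induction_on with
  | zero => simp
  | add y z hy hz => simp only [map_add, TensorProduct.tmul_add, hy, hz]
  | tmul p z => simp

/-- This is the part of the formula in `IsSmashCoproduct` that involves D. -/
theorem comulDAct_tmul_mulD (d d' : D) (x y : SmashProduct C D) :
    comulDAct d (x ⊗ₜ mulD C D d' y) =
      TensorProduct.lift (coactOp.compl₂ (TensorProduct.mk ℂ _ _ x ∘ₗ (mulD C D).flip y))
        (T₁ (d ⊗ₜ[ℂ] d')) := by
  rw [comulDAct_tmul, comulD_mulD]
  generalize T₁ (d ⊗ₜ[ℂ] d') = w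
  induction w using TensorProduct.induction_on with
  | zero => simp
  | add y z hy hz => simp only [map_add, hy, hz]
  | tmul p z => simp

theorem comulDAct_tmul_mul (d : D) (x y a b : SmashProduct C D) :
    comulDAct d (x ⊗ₜ y) * (a ⊗ₜ b) = comulDAct d ((x * a) ⊗ₜ (y * b)) := by
  obtain ⟨e, he⟩ := exists_mulD_eq_self y
  conv_lhs => rw [← he]
  conv_rhs => rw [← he]
  rw [mulD_mul, comulDAct_tmul_mulD, comulDAct_tmul_mulD]
  generalize T₁ (d ⊗ₜ[ℂ] e) = w
  induction w using TensorProduct.induction_on with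
  | zero => simp
  | add y z hy hz => simp only [map_add, add_mul, hy, hz]
  | tmul p z => simp [coactOp_tmul_mul, mulD_mul]

/-- The operator `p ⊗ z ↦ P(p ⊗ v)(x ⊗ z)`. -/
def mapPOp (v : C) (x : SmashProduct C D) :
    D ⊗[ℂ] SmashProduct C D →ₗ[ℂ] SmashProduct C D ⊗[ℂ] SmashProduct C D :=
  TensorProduct.lift ((tensorOp (mulD C D) (mulC C D) ∘ₗ mapP C D ∘ₗ
    (TensorProduct.mk ℂ D C).flip v).compl₂ (TensorProduct.mk ℂ _ _ x))

theorem mapPOp_tmul (v : C) (x z : SmashProduct C D) (p : D) :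
    mapPOp v x (p ⊗ₜ z) =
      tensorOp (mulD C D) (mulC C D) (mapP C D (p ⊗ₜ v)) (x ⊗ₜ z) := by
  simp [mapPOp]

/-- `∑ Γ(d₁)(1 ⊗ d₂ v) = ∑ P(d₁ ⊗ v)(1 ⊗ d₂)`. -/
theorem comulDAct_tmul_mulC (d : D) (v : C) (x y : SmashProduct C D) :
    comulDAct d (x ⊗ₜ mulC C D v y) = mapPOp v x (comulD (d ⊗ₜ y)) := by
  rw [comulDAct_tmul, comulD_mulC]
  generalize comulD (d ⊗ₜ[ℂ] y) = t
  induction t using TensorProduct.induction_on with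
  | zero => simp
  | add y z hy hz => simp only [map_add, hy, hz]
  | tmul p z =>
    rw [mapPOp_tmul, mapP, LinearMap.comp_apply]
    have h : twistOpAct v (p ⊗ₜ[ℂ] z) = LinearMap.lTensor D (TensorProduct.lift (mulC C D))
        (TensorProduct.assoc ℂ D C (SmashProduct C D)
          (TensorProduct.comm ℂ C D (twistOp D C (p ⊗ₜ v)) ⊗ₜ z)) := by
      simp [twistOpAct]
    rw [h]
    generalize twistOp D C (p ⊗ₜ v) = s
    induction s using TensorProduct.induction_on with
    | zero => simp
    | add y z hy hz => simp only [map_add, TensorProduct.add_tmul, LinearMap.add_apply, hy, hz]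
    | tmul a b => simp [coactOp_tmul_mulC]

/-- `d ↦ ∑ Γ(d₁)(1 ⊗ d₂)` is multiplicative. -/
theorem comulDAct_mul (hmul : PMulCondition C D) (d d' : D)
    (z : SmashProduct C D ⊗[ℂ] SmashProduct C D) :
    comulDAct (d * d') z = comulDAct d (comulDAct d' z) := by
  induction z using TensorProduct.induction_on with
  | zero => simp
  | add y z hy hz => simp only [map_add, hy, hz]
  | tmul x y =>
    obtain ⟨c, hc⟩ := exists_mulC_eq_self y
    obtain ⟨e, he⟩ := exists_mulD_eq_self y
    rw [← hc, ← he, comulDAct_tmul_mulC, comulDAct_tmul_mulC, comulD_mulD, comulD_mulD,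
      ← Δ_left_T₁]
    generalize T₁ (d' ⊗ₜ[ℂ] e) = w
    induction w using TensorProduct.induction_on with
    | zero => simp
    | add y z hy hz => simp only [map_add, hy, hz]
    | tmul p' q' =>
      -- N(s)(p) = (m_D ⊗ ι)P₁₃(p ⊗ s), so that N(P(p' ⊗ c))(p) = P(pp' ⊗ c) is the hypothesis on P
      -- and m_D.
      let N : D ⊗[ℂ] C → D →ₗ[ℂ] D ⊗[ℂ] C := fun s =>
        LinearMap.rTensor C (LinearMap.mul' ℂ D) ∘ₗ
          (TensorProduct.assoc ℂ D D C).symm.toLinearMap ∘ₗ mapP₁₃ C D ∘ₗ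
          (TensorProduct.mk ℂ D (D ⊗[ℂ] C)).flip s
      have hN : ∀ p, N (mapP C D (p' ⊗ₜ c)) p = mapP C D ((p * p') ⊗ₜ c) := by
        intro p
        have := LinearMap.congr_fun hmul (p ⊗ₜ (p' ⊗ₜ c))
        simpa [N, mapP₂₃] using this.symm
      -- On s = r ⊗ b, the operator E(d)(r ⊗ b) is ∑ P(d₁ ⊗ b)(r ⊗ d₂), and P(p ⊗ b)(r ⊗ 1) = N(r ⊗
      -- b)(p).
      have e1 : ∀ s : D ⊗[ℂ] C, comulDAct d
          (tensorOp (mulD C D) (mulC C D) s (x ⊗ₜ mulD C D q' y)) =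
          TensorProduct.lift ((tensorOp (mulD C D) (mulC C D) ∘ₗ N s).compl₂
            (TensorProduct.mk ℂ _ _ x ∘ₗ (mulD C D).flip y)) (T₁ (d ⊗ₜ[ℂ] q')) := by
        intro s
        have e3 : ∀ (s t : D ⊗[ℂ] C) (w : D ⊗[ℂ] D),
            TensorProduct.lift ((tensorOp (mulD C D) (mulC C D) ∘ₗ N (s + t)).compl₂
              (TensorProduct.mk ℂ _ _ x ∘ₗ (mulD C D).flip y)) w =
            TensorProduct.lift ((tensorOp (mulD C D) (mulC C D) ∘ₗ N s).compl₂
              (TensorProduct.mk ℂ _ _ x ∘ₗ (mulD C D).flip y)) w +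
            TensorProduct.lift ((tensorOp (mulD C D) (mulC C D) ∘ₗ N t).compl₂
              (TensorProduct.mk ℂ _ _ x ∘ₗ (mulD C D).flip y)) w := by
          intro s t w
          induction w using TensorProduct.induction_on with
          | zero => simp
          | add y z hy hz => rw [map_add, map_add, map_add, hy, hz]; abel
          | tmul p q => simp [N]
        induction s using TensorProduct.induction_on with
        | zero =>
          have : N 0 = 0 := by ext p; simp [N]
          rw [this, map_zero, LinearMap.zero_apply, map_zero]
          generalize T₁ (d ⊗ₜ[ℂ] q') = w
          induction w using TensorProduct.induction_on with
          | zero => simp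
          | add y z hy hz => rw [map_add, ← hy, ← hz, add_zero]
          | tmul p q => simp
        | add s t hs ht => rw [e3, ← hs, ← ht, map_add, LinearMap.add_apply, map_add]
        | tmul r b =>
          rw [tensorOp_tmul, comulDAct_tmul_mulC, comulD_mulD]
          generalize T₁ (d ⊗ₜ[ℂ] q') = w
          induction w using TensorProduct.induction_on with
          | zero => simp
          | add y z hy hz => rw [map_add, map_add, map_add, hy, hz]
          | tmul p q =>
            have e4 : N (r ⊗ₜ b) p = LinearMap.rTensor C (LinearMap.mulRight ℂ r)
                (mapP C D (p ⊗ₜ b)) := by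
              have : N (r ⊗ₜ b) p = LinearMap.rTensor C (LinearMap.mul' ℂ D)
                  ((TensorProduct.assoc ℂ D D C).symm (TensorProduct.leftComm ℂ D D C
                    (r ⊗ₜ mapP C D (p ⊗ₜ b)))) := by simp [N, mapP₁₃]
              rw [this]
              generalize mapP C D (p ⊗ₜ b) = s
              induction s using TensorProduct.induction_on with
              | zero => simp
              | add y z hy hz => simp only [map_add, TensorProduct.tmul_add, hy, hz]
              | tmul a b => simp
            rw [LinearMap.lTensor_tmul, mapPOp_tmul, TensorProduct.lift.tmul,
              LinearMap.compl₂_apply, LinearMap.comp_apply, e4]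
            generalize mapP C D (p ⊗ₜ b) = s
            induction s using TensorProduct.induction_on with
            | zero => simp
            | add y z hy hz => simp only [map_add, LinearMap.add_apply, hy, hz]
            | tmul a b => simp [mulD_mulD]
      rw [LinearMap.lTensor_tmul, LinearMap.flip_apply, mapPOp_tmul, e1, Δ_left_tmul]
      generalize T₁ (d ⊗ₜ[ℂ] q') = w
      induction w using TensorProduct.induction_on with
      | zero => simp
      | add y z hy hz => simp only [map_add, hy, hz]
      | tmul p q =>
        rw [TensorProduct.lift.tmul, LinearMap.compl₂_apply, LinearMap.comp_apply, hN,
          LinearMap.rTensor_tmul, LinearMap.lTensor_tmul, mapPOp_tmul]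
        rfl

end SmashProduct

namespace SmashProduct

variable {C D : Type*}
  [NonUnitalRing C] [Module ℂ C] [IsScalarTower ℂ C C] [SMulCommClass ℂ C C]
  [RegularMultiplierHopfAlgebra C]
  [NonUnitalRing D] [Module ℂ D] [IsScalarTower ℂ D D] [SMulCommClass ℂ D D]
  [RegularMultiplierHopfAlgebra D]
  [LeftModuleAlgebra D C] [RightCoaction C D]

/-! ### The left action of the smash coproduct -/

/-- The operator `x ⊗ y ↦ (a x) ⊗ (c' y)` on `CD ⊗ CD` for `a ⊗ c'` in `CD ⊗ C`. -/
def smashOpC : (C ⊗[ℂ] D) ⊗[ℂ] C →ₗ[ℂ] SmashProduct C D ⊗[ℂ] SmashProduct C D →ₗ[ℂ]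
    SmashProduct C D ⊗[ℂ] SmashProduct C D :=
  tensorOp (mulMap C D ∘ₗ (equiv C D).toLinearMap) (mulC C D)

/-- The operator `x ⊗ y ↦ d c x ⊗ c' y` on `CD ⊗ CD` for `d ⊗ c ⊗ c'` in `D ⊗ C ⊗ C`. -/
def tripleOp : D ⊗[ℂ] (C ⊗[ℂ] C) →ₗ[ℂ] SmashProduct C D ⊗[ℂ] SmashProduct C D →ₗ[ℂ]
    SmashProduct C D ⊗[ℂ] SmashProduct C D :=
  smashOpC ∘ₗ LinearMap.rTensor C (twist D C) ∘ₗ (TensorProduct.assoc ℂ D C C).symm.toLinearMap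

theorem tripleOp_tmul (d : D) (c c' : C) (x y : SmashProduct C D) :
    tripleOp (d ⊗ₜ (c ⊗ₜ c')) (x ⊗ₜ y) = mulD C D d (mulC C D c x) ⊗ₜ mulC C D c' y := by
  rw [mulD_mulC]
  simp [tripleOp, smashOpC]
  rfl

theorem tripleOp_mulRight_right (s : D ⊗[ℂ] (C ⊗[ℂ] C)) (e : C) (x y : SmashProduct C D) :
    tripleOp (LinearMap.lTensor D (LinearMap.lTensor C (LinearMap.mulRight ℂ e)) s) (x ⊗ₜ y) =
      tripleOp s (x ⊗ₜ mulC C D e y) := by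
  induction s using TensorProduct.induction_on with
  | zero => simp
  | add y z hy hz => simp only [map_add, LinearMap.add_apply, hy, hz]
  | tmul d w =>
    induction w using TensorProduct.induction_on with
    | zero => simp
    | add y z hy hz => simp only [map_add, TensorProduct.tmul_add, LinearMap.add_apply, hy, hz]
    | tmul a b => simp [tripleOp_tmul, mulC_mulC]

theorem tripleOp_mulRight_left (s : D ⊗[ℂ] (C ⊗[ℂ] C)) (e : C) (x y : SmashProduct C D) :
    tripleOp (LinearMap.lTensor D (LinearMap.rTensor C (LinearMap.mulRight ℂ e)) s) (x ⊗ₜ y) =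
      tripleOp s (mulC C D e x ⊗ₜ y) := by
  induction s using TensorProduct.induction_on with
  | zero => simp
  | add y z hy hz => simp only [map_add, LinearMap.add_apply, hy, hz]
  | tmul d w =>
    induction w using TensorProduct.induction_on with
    | zero => simp
    | add y z hy hz => simp only [map_add, TensorProduct.tmul_add, LinearMap.add_apply, hy, hz]
    | tmul a b => simp [tripleOp_tmul, mulC_mulC]

/-- P(p ⊗ v) acts to the left of u ⊗ 1: its D-leg stands before u, which is the order in which
`tripleOp` multiplies. -/
theorem tripleOp_mapP₁₃' (p : D) (u v : C) (x z : SmashProduct C D) :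
    tripleOp (mapP₁₃' C D (p ⊗ₜ (u ⊗ₜ v))) (x ⊗ₜ z) = mapPOp v (mulC C D u x) (p ⊗ₜ z) := by
  rw [mapPOp_tmul]
  have h : mapP₁₃' C D (p ⊗ₜ (u ⊗ₜ v)) = LinearMap.lTensor D (TensorProduct.comm ℂ C C).toLinearMap
      (TensorProduct.assoc ℂ D C C (mapP C D (p ⊗ₜ v) ⊗ₜ u)) := by
    simp [mapP₁₃', mapP₁₂']
  rw [h]
  generalize mapP C D (p ⊗ₜ v) = s
  induction s using TensorProduct.induction_on with
  | zero => simp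
  | add y z hy hz => simp only [map_add, TensorProduct.add_tmul, LinearMap.add_apply, hy, hz]
  | tmul a b => simp [tripleOp_tmul]

/-- Interprets Δ₁₃(a)Γ₂₃(b)(1 ⊗ 1 ⊗ c') as the operator Δ_C(a)Γ(b)(1 ⊗ c') on CD ⊗ CD. -/
theorem smashOpC_comulCoact (c' a : C) (b : D) (x z : SmashProduct C D) :
    smashOpC (comulCoact c' (a ⊗ₜ b)) (x ⊗ₜ z) =
      comulCAct a (coactOp b (x ⊗ₜ mulC C D c' z)) := by
  have h : comulCoact c' (a ⊗ₜ b) = TensorProduct.rightComm ℂ C C D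
      (TensorProduct.comm ℂ D (C ⊗[ℂ] C) (LinearMap.lTensor D (T₁ (A := C)).toLinearMap
        (TensorProduct.leftComm ℂ C D C (a ⊗ₜ cotwistOp C D (c' ⊗ₜ b))))) := by
    simp [comulCoact]
  rw [h, coactOp_tmul_mulC]
  generalize cotwistOp C D (c' ⊗ₜ b) = s
  induction s using TensorProduct.induction_on with
  | zero => simp
  | add y z hy hz => simp only [map_add, TensorProduct.tmul_add, LinearMap.add_apply, hy, hz]
  | tmul r s =>
    rw [tensorOp_tmul, comulCAct_tmul_mulC, TensorProduct.leftComm_tmul, LinearMap.lTensor_tmul,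
      TensorProduct.comm_tmul, LinearEquiv.coe_coe]
    generalize T₁ (a ⊗ₜ[ℂ] s) = w
    induction w using TensorProduct.induction_on with
    | zero => simp
    | add y z hy hz => simp only [map_add, TensorProduct.add_tmul, LinearMap.add_apply, hy, hz]
    | tmul u v =>
      simp [smashOpC]
      rfl

/-- `R₁₂ P₁₃(p ⊗ Δ(c)) = ∑ Δ₁₃(c') Γ₂₃(p')` where `∑ c' ⊗ p' = R(p ⊗ c)`, covered by
`1 ⊗ 1 ⊗ e` from the right. -/
theorem exists_mapP₁₃'_eq_comulCoact (hcomul : PComulCondition C D) (htwist : PTwistCondition C D)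
    (p : D) (c e : C) : ∃ w : D ⊗[ℂ] (C ⊗[ℂ] C),
      (∀ c'' : C, LinearMap.lTensor D (LinearMap.rTensor C (LinearMap.mulRight ℂ c'')) w =
        LinearMap.lTensor D (LinearMap.lTensor C (LinearMap.mulRight ℂ e))
          (mapP₁₃' C D (p ⊗ₜ[ℂ] T₃ (c ⊗ₜ[ℂ] c'')))) ∧
      LinearMap.rTensor C (twist D C) ((TensorProduct.assoc ℂ D C C).symm w) =
        comulCoact e (twist D C (p ⊗ₜ c)) := by
  obtain ⟨w, hw, hw'⟩ := hcomul p c e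
  refine ⟨w, hw, ?_⟩
  -- Apply T to the first two legs: it turns R₁₂ into P₁₂, where the hypothesis on Δ_C and P is
  -- available, and can be cancelled afterwards.
  have hinj : Function.Injective (LinearMap.rTensor C (cotwist C D)) :=
    Module.Flat.rTensor_preserves_injective_linearMap _ cotwist_injective
  apply hinj
  apply (TensorProduct.assoc ℂ D C C).injective
  have hP : mapP C D (p ⊗ₜ c) = cotwist C D (twist D C (p ⊗ₜ c)) :=
    LinearMap.congr_fun htwist (p ⊗ₜ c)
  rw [cotwist_comulCoact, ← hP, ← hw', mapP₁₂', ← LinearMap.rTensor_comp_apply, ← htwist]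
  rfl

/-- The left action of the smash coproduct of an element of `C ⊗ D`. -/
def smashComulAct : C ⊗[ℂ] D →ₗ[ℂ] SmashProduct C D ⊗[ℂ] SmashProduct C D →ₗ[ℂ]
    SmashProduct C D ⊗[ℂ] SmashProduct C D :=
  TensorProduct.lift ((LinearMap.llcomp ℂ _ _ _).compl₁₂ comulCAct comulDAct)

theorem smashComulAct_tmul (c : C) (d : D) (z : SmashProduct C D ⊗[ℂ] SmashProduct C D) :
    smashComulAct (c ⊗ₜ d) z = comulCAct c (comulDAct d z) := by
  simp [smashComulAct]

/-- The commutation rule `d c = R(d ⊗ c)` is respected by the smash coproduct. -/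
theorem comulDAct_comulCAct (hcomul : PComulCondition C D) (htwist : PTwistCondition C D)
    (d : D) (c : C) (z : SmashProduct C D ⊗[ℂ] SmashProduct C D) :
    comulDAct d (comulCAct c z) = smashComulAct (twist D C (d ⊗ₜ c)) z := by
  induction z using TensorProduct.induction_on with
  | zero => simp
  | add y z hy hz => simp only [map_add, hy, hz]
  | tmul x y =>
    obtain ⟨c'', hc''⟩ := exists_mulC_eq_self x
    -- Ω(w)(p ⊗ z) is P₁₃(p ⊗ w) acting on x ⊗ z. It is used with w = Δ(c)(c'' ⊗ 1), where c'' x = x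
    -- covers the first leg.
    let Ω : C ⊗[ℂ] C → D ⊗[ℂ] SmashProduct C D →ₗ[ℂ] SmashProduct C D ⊗[ℂ] SmashProduct C D :=
      fun w => TensorProduct.lift (((tripleOp ∘ₗ mapP₁₃' C D) ∘ₗ
        (TensorProduct.mk ℂ D (C ⊗[ℂ] C)).flip w).compl₂ (TensorProduct.mk ℂ _ _ x))
    have hΩ : ∀ w p z, Ω w (p ⊗ₜ z) = tripleOp (mapP₁₃' C D (p ⊗ₜ w)) (x ⊗ₜ z) := by
      intro w p z
      simp [Ω]
    have e1 : ∀ w : C ⊗[ℂ] C, comulDAct d (tensorOp (mulC C D) (mulC C D) w (x ⊗ₜ y)) =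
        Ω w (comulD (d ⊗ₜ y)) := by
      intro w
      have e2 : ∀ u v, Ω (u + v) = Ω u + Ω v := by
        intro u v
        refine TensorProduct.ext' fun p z => ?_
        simp only [hΩ, TensorProduct.tmul_add, map_add, LinearMap.add_apply]
      induction w using TensorProduct.induction_on with
      | zero =>
        have : Ω 0 = 0 := TensorProduct.ext' fun p z => by simp [hΩ]
        simp [this]
      | add u v hu hv => rw [map_add, LinearMap.add_apply, map_add, hu, hv, e2,
          LinearMap.add_apply]
      | tmul u v =>
        rw [tensorOp_tmul, comulDAct_tmul_mulC]
        generalize comulD (d ⊗ₜ[ℂ] y) = t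
        induction t using TensorProduct.induction_on with
        | zero => simp
        | add y z hy hz => simp only [map_add, hy, hz]
        | tmul p z => rw [hΩ, tripleOp_mapP₁₃']
    -- Ψ(a ⊗ b ⊗ z) = Δ_C(a)Γ(b)(c'' x ⊗ z). With `comulD_twist` the comparison reduces to one p ⊗ z
    -- at a time.
    let Ψ : C ⊗[ℂ] (D ⊗[ℂ] SmashProduct C D) →ₗ[ℂ] SmashProduct C D ⊗[ℂ] SmashProduct C D :=
      TensorProduct.lift (comulCAct.compl₂ (TensorProduct.lift
        (coactOp.compl₂ (TensorProduct.mk ℂ _ _ (mulC C D c'' x)))))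
    have e3 : ∀ s : C ⊗[ℂ] D, smashComulAct s (mulC C D c'' x ⊗ₜ y) =
        Ψ (LinearMap.lTensor C comulD (TensorProduct.assoc ℂ C D (SmashProduct C D) (s ⊗ₜ y))) := by
      intro s
      induction s using TensorProduct.induction_on with
      | zero => simp
      | add y z hy hz => simp only [map_add, TensorProduct.add_tmul, LinearMap.add_apply, hy, hz]
      | tmul a b =>
        rw [smashComulAct_tmul, comulDAct_tmul]
        simp [Ψ]
    rw [← hc'', comulCAct_mulC_tmul, e1, e3, comulD_twist]
    generalize comulD (d ⊗ₜ[ℂ] y) = t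
    induction t using TensorProduct.induction_on with
    | zero => simp
    | add y z hy hz => simp only [map_add, hy, hz]
    | tmul p z =>
      obtain ⟨c', hc'⟩ := exists_mulC_eq_self z
      obtain ⟨w, hw, hw'⟩ := exists_mapP₁₃'_eq_comulCoact hcomul htwist p c c'
      -- Writing z = c' z multiplies the third leg by c'. Then P₁₃(p ⊗ Δ(c)) becomes the element w,
      -- and c'' goes back to x.
      have e4 : tripleOp (mapP₁₃' C D (p ⊗ₜ T₃ (c ⊗ₜ[ℂ] c''))) (x ⊗ₜ z) =
          smashOpC (comulCoact c' (twist D C (p ⊗ₜ c))) (mulC C D c'' x ⊗ₜ z) := by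
        conv_lhs => rw [← hc']
        rw [← tripleOp_mulRight_right, ← hw, tripleOp_mulRight_left, ← hw']
        rfl
      rw [hΩ, e4, LinearMap.rTensor_tmul, LinearMap.comp_apply, LinearMap.flip_apply,
        TensorProduct.mk_apply]
      generalize twist D C (p ⊗ₜ c) = s
      induction s using TensorProduct.induction_on with
      | zero => simp
      | add y z hy hz => simp only [map_add, TensorProduct.add_tmul, LinearMap.add_apply, hy, hz]
      | tmul a b =>
        rw [smashOpC_comulCoact, hc']
        simp [Ψ]

end SmashProduct

/-- A left multiplier `F` of an algebra with non-degenerate product extends to a multiplier if all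
products `a F` are given by elements of the algebra. -/
theorem Multiplier.exists_left_eq {A : Type*} [NonUnitalNonAssocRing A] [Module ℂ A]
    [IsScalarTower ℂ A A] [SMulCommClass ℂ A A] (hassoc : ∀ a b c : A, a * b * c = a * (b * c))
    (hA : ∀ a : A, (∀ b, a * b = 0) → a = 0) (F : A →ₗ[ℂ] A) (hF : ∀ a b, F (a * b) = F a * b)
    (hr : ∀ a, ∃ u, ∀ b, a * F b = u * b) : ∃ m : Multiplier A, m.left = F := by
  choose u hu using hr
  have hext : ∀ a a' : A, (∀ b, a * b = a' * b) → a = a' := fun a a' h =>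
    sub_eq_zero.1 (hA _ fun b => by rw [sub_mul, h, sub_self])
  -- Non-degeneracy makes u a unique, so the chosen function is linear.
  let G : A →ₗ[ℂ] A :=
    { toFun := u
      map_add' := fun a b => hext _ _ fun c => by rw [← hu, add_mul, add_mul, hu, hu]
      map_smul' := fun r a => hext _ _ fun c => by
        rw [← hu, smul_mul_assoc, hu, RingHom.id_apply, smul_mul_assoc] }
  refine ⟨⟨(F, MulOpposite.op G), hF, fun a b => hext _ _ fun c => ?_, fun a b => hu a b⟩, rfl⟩
  change u (a * b) * c = a * u b * c
  rw [← hu, hassoc, hassoc, hu]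

namespace SmashProduct

variable {C D : Type*}
  [NonUnitalRing C] [Module ℂ C] [IsScalarTower ℂ C C] [SMulCommClass ℂ C C]
  [RegularMultiplierHopfAlgebra C]
  [NonUnitalRing D] [Module ℂ D] [IsScalarTower ℂ D D] [SMulCommClass ℂ D D]
  [RegularMultiplierHopfAlgebra D]
  [LeftModuleAlgebra D C]

/-! ### The algebra `CD ⊗ CD` -/

theorem tensor_mul_assoc (a b c : SmashProduct C D ⊗[ℂ] SmashProduct C D) :
    a * b * c = a * (b * c) := by
  induction a using TensorProduct.induction_on with
  | zero => simp
  | add y z hy hz => simp only [add_mul, hy, hz]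
  | tmul x y =>
    induction b using TensorProduct.induction_on with
    | zero => simp
    | add y z hy hz => simp only [mul_add, add_mul, hy, hz]
    | tmul x' y' =>
      induction c using TensorProduct.induction_on with
      | zero => simp
      | add y z hy hz => simp only [mul_add, hy, hz]
      | tmul x'' y'' => simp [smash_mul_assoc]

theorem tensor_eq_zero_of_forall_mul (u : SmashProduct C D ⊗[ℂ] SmashProduct C D)
    (hu : ∀ b, u * b = 0) : u = 0 := by
  have hA := eq_zero_of_forall_mul (D := D) (nondegenerate (A := C))
  refine TensorProduct.eq_of_forall_lTensor_eq
    (fun y : SmashProduct C D => LinearMap.mulRight ℂ y) (fun b hb => hA b hb) fun y => ?_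
  refine TensorProduct.eq_of_forall_rTensor_eq
    (fun y : SmashProduct C D => LinearMap.mulRight ℂ y) (fun b hb => hA b hb) fun x => ?_
  rw [map_zero, map_zero]
  refine Eq.trans ?_ (hu (x ⊗ₜ y))
  generalize u = v
  induction v using TensorProduct.induction_on with
  | zero => simp
  | add y z hy hz => simp only [map_add, add_mul, hy, hz]
  | tmul a b => simp

/-- The operator `F` on `CD ⊗ CD` has a right action on `CD ⊗ CD`. -/
def HasRightAction (F : SmashProduct C D ⊗[ℂ] SmashProduct C D →ₗ[ℂ]
    SmashProduct C D ⊗[ℂ] SmashProduct C D) : Prop :=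
  ∀ a, ∃ u, ∀ b, a * F b = u * b

theorem HasRightAction.comp {F G : SmashProduct C D ⊗[ℂ] SmashProduct C D →ₗ[ℂ]
    SmashProduct C D ⊗[ℂ] SmashProduct C D} (hF : HasRightAction F) (hG : HasRightAction G) :
    HasRightAction (F ∘ₗ G) := by
  intro a
  obtain ⟨u, hu⟩ := hF a
  obtain ⟨v, hv⟩ := hG u
  exact ⟨v, fun b => by rw [LinearMap.comp_apply, hu, hv]⟩

theorem HasRightAction.add {F G : SmashProduct C D ⊗[ℂ] SmashProduct C D →ₗ[ℂ]
    SmashProduct C D ⊗[ℂ] SmashProduct C D} (hF : HasRightAction F) (hG : HasRightAction G) :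
    HasRightAction (F + G) := by
  intro a
  obtain ⟨u, hu⟩ := hF a
  obtain ⟨v, hv⟩ := hG a
  exact ⟨u + v, fun b => by rw [LinearMap.add_apply, mul_add, add_mul, hu, hv]⟩

theorem hasRightAction_of_tmul {F : SmashProduct C D ⊗[ℂ] SmashProduct C D →ₗ[ℂ]
    SmashProduct C D ⊗[ℂ] SmashProduct C D}
    (h : ∀ (c : C) (d : D) (t : SmashProduct C D), ∃ u, ∀ b,
      (equiv C D (c ⊗ₜ d) ⊗ₜ t) * F b = u * b) : HasRightAction F := by
  intro a
  induction a using TensorProduct.induction_on with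
  | zero => exact ⟨0, fun b => by simp⟩
  | add x y hx hy =>
    obtain ⟨u, hu⟩ := hx
    obtain ⟨v, hv⟩ := hy
    exact ⟨u + v, fun b => by rw [add_mul, add_mul, hu, hv]⟩
  | tmul x y =>
    induction x using induction with
    | zero => exact ⟨0, fun b => by simp⟩
    | add x x' hx hx' =>
      obtain ⟨u, hu⟩ := hx
      obtain ⟨v, hv⟩ := hx'
      exact ⟨u + v, fun b => by rw [TensorProduct.add_tmul, add_mul, add_mul, hu, hv]⟩
    | tmul c d => exact h c d y

/-- CD is spanned by products dc as well, by surjectivity of R; in this form the C-part is next to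
whatever acts from the right. -/
theorem induction_twist {motive : SmashProduct C D → Prop} (x : SmashProduct C D)
    (zero : motive 0) (tmul : ∀ d c, motive (equiv C D (twist D C (d ⊗ₜ c))))
    (add : ∀ x y, motive x → motive y → motive (x + y)) : motive x := by
  obtain ⟨x, rfl⟩ := (equiv C D).surjective x
  obtain ⟨t, rfl⟩ := twist_surjective x
  induction t using TensorProduct.induction_on with
  | zero => simpa using zero
  | tmul c d => exact tmul c d
  | add y z hy hz => simpa only [map_add] using add _ _ hy hz

theorem tensorOp_comulCAct (c : C) (s : C ⊗[ℂ] C)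
    (b : SmashProduct C D ⊗[ℂ] SmashProduct C D) :
    tensorOp (mulC C D) (mulC C D) s (comulCAct c b) =
      tensorOp (mulC C D) (mulC C D) ((Δ c).right s) b := by
  induction b using induction_tmul with
  | zero => simp
  | add y z hy hz => simp only [map_add, hy, hz]
  | tmul a d a' d' =>
    rw [tensorOp_mulC_mulC, comulCAct_apply, multiplierCAct_tmul, ← Multiplier.mul_left_apply]
    generalize (Δ c).left (a ⊗ₜ a') = v
    induction v using TensorProduct.induction_on with
    | zero => simp
    | add y z hy hz => simp only [map_add, TensorProduct.add_tmul, mul_add, hy, hz]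
    | tmul p q =>
      rw [TensorProduct.tensorTensorTensorComm_tmul, TensorProduct.map_tmul]
      exact tensorOp_mulC_mulC s p q d d'

/-- On products d₁c₁ ⊗ d₂c₂, the multiplier Δ_C(c) meets only c₁ ⊗ c₂, and (c₁ ⊗ c₂)Δ_C(c) is in C ⊗
C. -/
theorem hasRightAction_comulCAct (c : C) : HasRightAction (comulCAct (D := D) c) := by
  intro a
  induction a using TensorProduct.induction_on with
  | zero => exact ⟨0, fun b => by simp⟩
  | add x y hx hy =>
    obtain ⟨u, hu⟩ := hx
    obtain ⟨v, hv⟩ := hy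
    exact ⟨u + v, fun b => by rw [add_mul, add_mul, hu, hv]⟩
  | tmul x y =>
    induction x using induction_twist with
    | zero => exact ⟨0, fun b => by simp⟩
    | add x x' hx hx' =>
      obtain ⟨u, hu⟩ := hx
      obtain ⟨v, hv⟩ := hx'
      exact ⟨u + v, fun b => by rw [TensorProduct.add_tmul, add_mul, add_mul, hu, hv]⟩
    | tmul d₁ c₁ =>
      induction y using induction_twist with
      | zero => exact ⟨0, fun b => by simp⟩
      | add y y' hy hy' =>
        obtain ⟨u, hu⟩ := hy
        obtain ⟨v, hv⟩ := hy'
        exact ⟨u + v, fun b => by rw [TensorProduct.tmul_add, add_mul, add_mul, hu, hv]⟩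
      | tmul d₂ c₂ =>
        let U : C ⊗[ℂ] C →ₗ[ℂ] SmashProduct C D ⊗[ℂ] SmashProduct C D :=
          TensorProduct.map
            ((equiv C D).toLinearMap ∘ₗ twist D C ∘ₗ TensorProduct.mk ℂ D C d₁)
            ((equiv C D).toLinearMap ∘ₗ twist D C ∘ₗ TensorProduct.mk ℂ D C d₂)
        have hU : ∀ s b, U s * b = TensorProduct.map (mulD C D d₁) (mulD C D d₂)
            (tensorOp (mulC C D) (mulC C D) s b) := by
          intro s b
          induction s using TensorProduct.induction_on with
          | zero => simp
          | add y z hy hz => simp only [map_add, add_mul, LinearMap.add_apply, hy, hz]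
          | tmul p q =>
            induction b using TensorProduct.induction_on with
            | zero => simp
            | add y z hy hz => simp only [map_add, mul_add, hy, hz]
            | tmul x y => simp [U, mulD_mulC]
        refine ⟨U ((Δ c).right (c₁ ⊗ₜ c₂)), fun b => ?_⟩
        have h : equiv C D (twist D C (d₁ ⊗ₜ c₁)) ⊗ₜ equiv C D (twist D C (d₂ ⊗ₜ c₂)) =
            U (c₁ ⊗ₜ c₂) := by simp [U]
        rw [h, hU, hU, tensorOp_comulCAct]

/-! ### The right action of ∑ Γ(d₁)(1 ⊗ d₂) and of the smash coproduct. -/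

variable [RightCoaction C D]

/-- (1 ⊗ c)Γ(p) is in D ⊗ C without any covering from the right; a local unit for z gives access to
the compatibility of T and Tᵒᵖ. -/
theorem mulC_coactOp (c : C) (p : D) (x z : SmashProduct C D) :
    LinearMap.lTensor (SmashProduct C D) (mulC C D c) (coactOp p (x ⊗ₜ z)) =
      tensorOp (mulD C D) (mulC C D) (cotwist C D (c ⊗ₜ p)) (x ⊗ₜ z) := by
  obtain ⟨f, hf⟩ := exists_mulC_eq_self z
  have e1 : ∀ s : D ⊗[ℂ] C, LinearMap.lTensor (SmashProduct C D) (mulC C D c)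
      (tensorOp (mulD C D) (mulC C D) s (x ⊗ₜ z)) =
      tensorOp (mulD C D) (mulC C D) (LinearMap.lTensor D (LinearMap.mulLeft ℂ c) s)
        (x ⊗ₜ z) := by
    intro s
    induction s using TensorProduct.induction_on with
    | zero => simp
    | add y z hy hz => simp only [map_add, LinearMap.add_apply, hy, hz]
    | tmul p q => simp [mulC_mulC]
  have e2 : ∀ s : D ⊗[ℂ] C, tensorOp (mulD C D) (mulC C D)
      (LinearMap.lTensor D (LinearMap.mulRight ℂ f) s) (x ⊗ₜ z) =
      tensorOp (mulD C D) (mulC C D) s (x ⊗ₜ mulC C D f z) := by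
    intro s
    induction s using TensorProduct.induction_on with
    | zero => simp
    | add y z hy hz => simp only [map_add, LinearMap.add_apply, hy, hz]
    | tmul p q => simp [mulC_mulC]
  conv_lhs => rw [← hf]
  rw [coactOp_tmul_mulC, e1, mulLeft_cotwistOp, e2, hf]

/-- Products c₁d₁ ⊗ d₂c₂ span, and in them only d₁ ⊗ c₂ meets the operator; the comodule coalgebra
condition says what (d₁ ⊗ c₂)E(d) is. -/
theorem hasRightAction_comulDAct [RightComoduleCoalgebra C D] (d : D) :
    HasRightAction (comulDAct (C := C) d) := by
  refine hasRightAction_of_tmul fun c₁ d₁ t => ?_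
  induction t using induction_twist with
  | zero => exact ⟨0, fun b => by simp⟩
  | add y y' hy hy' =>
    obtain ⟨u, hu⟩ := hy
    obtain ⟨v, hv⟩ := hy'
    exact ⟨u + v, fun b => by rw [TensorProduct.tmul_add, add_mul, add_mul, hu, hv]⟩
  | tmul d₂ c₂ =>
    -- w represents (d₁ ⊗ 1 ⊗ 1)(T ⊗ ι)(c₂ ⊗ Δ(d)) in D ⊗ C ⊗ D; reading its last two legs in CD
    -- gives (d₁ ⊗ c₂)E(d).
    obtain ⟨w, hw, -⟩ := RightComoduleCoalgebra.comul_left c₂ d d₁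
    let O : D ⊗[ℂ] (C ⊗[ℂ] D) →ₗ[ℂ] SmashProduct C D ⊗[ℂ] SmashProduct C D →ₗ[ℂ]
        SmashProduct C D ⊗[ℂ] SmashProduct C D :=
      tensorOp (mulD C D) (mulMap C D ∘ₗ (equiv C D).toLinearMap)
    have hO : ∀ a s x y, O (a ⊗ₜ s) (x ⊗ₜ y) = mulD C D a x ⊗ₜ (equiv C D s * y) :=
      fun a s x y => tensorOp_tmul _ _ a s x y
    have e1 : ∀ (v : D ⊗[ℂ] (C ⊗[ℂ] D)) (e : D) (x y : SmashProduct C D),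
        O v (x ⊗ₜ mulD C D e y) =
          O (LinearMap.lTensor D (LinearMap.lTensor C (LinearMap.mulRight ℂ e)) v) (x ⊗ₜ y) := by
      intro v e x y
      induction v using TensorProduct.induction_on with
      | zero => simp
      | add y z hy hz => simp only [map_add, LinearMap.add_apply, hy, hz]
      | tmul a s => rw [LinearMap.lTensor_tmul, hO, hO, equiv_mul_mulD]
    have e2 : ∀ b, TensorProduct.map (mulD C D d₁) (mulC C D c₂) (comulDAct d b) = O w b := by
      intro b
      induction b using TensorProduct.induction_on with
      | zero => simp
      | add y z hy hz => simp only [map_add, hy, hz]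
      | tmul x y =>
        obtain ⟨e, he⟩ := exists_mulD_eq_self y
        rw [← he, e1, hw, comulDAct_tmul_mulD]
        generalize T₁ (d ⊗ₜ[ℂ] e) = v
        induction v using TensorProduct.induction_on with
        | zero => simp
        | add y z hy hz => simp only [map_add, TensorProduct.tmul_add, LinearMap.add_apply, hy, hz]
        | tmul p q =>
          rw [TensorProduct.lift.tmul, LinearMap.compl₂_apply, LinearMap.comp_apply,
            LinearMap.flip_apply, TensorProduct.mk_apply, ← LinearMap.rTensor_comp_lTensor,
            LinearMap.comp_apply, mulC_coactOp, TensorProduct.assoc_symm_tmul,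
            LinearMap.rTensor_tmul]
          generalize cotwist C D (c₂ ⊗ₜ p) = s
          induction s using TensorProduct.induction_on with
          | zero => simp
          | add y z hy hz => simp only [map_add, TensorProduct.add_tmul, LinearMap.add_apply,
              hy, hz]
          | tmul a b => simp [hO, mulD_mulD, equiv_tmul_mul]
    -- U multiplies by the remaining outer factors c₁ ⊗ d₂ from the left; U(w) is the element
    -- sought.
    let U : D ⊗[ℂ] (C ⊗[ℂ] D) →ₗ[ℂ] SmashProduct C D ⊗[ℂ] SmashProduct C D :=
      TensorProduct.map ((equiv C D).toLinearMap ∘ₗ TensorProduct.mk ℂ C D c₁)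
        (mulD C D d₂ ∘ₗ (equiv C D).toLinearMap)
    have hU : ∀ v b, U v * b =
        TensorProduct.map (mulC C D c₁) (mulD C D d₂) (O v b) := by
      intro v b
      induction v using TensorProduct.induction_on with
      | zero => simp
      | add y z hy hz => simp only [map_add, add_mul, LinearMap.add_apply, hy, hz]
      | tmul p q =>
        induction b using TensorProduct.induction_on with
        | zero => simp
        | add y z hy hz => simp only [map_add, mul_add, hy, hz]
        | tmul x y => simp [U, hO, mulD_mul, equiv_tmul_mul]
    have e3 : ∀ b, (equiv C D (c₁ ⊗ₜ d₁) ⊗ₜ equiv C D (twist D C (d₂ ⊗ₜ c₂))) * b =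
        TensorProduct.map (mulC C D c₁) (mulD C D d₂)
          (TensorProduct.map (mulD C D d₁) (mulC C D c₂) b) := by
      intro b
      induction b using TensorProduct.induction_on with
      | zero => simp
      | add y z hy hz => simp only [map_add, mul_add, hy, hz]
      | tmul x y => simp [equiv_tmul_mul, mulD_mulC]
    exact ⟨U w, fun b => by rw [e3, e2, hU]⟩

theorem hasRightAction_smashComulAct [RightComoduleCoalgebra C D] (s : C ⊗[ℂ] D) :
    HasRightAction (smashComulAct s) := by
  induction s using TensorProduct.induction_on with
  | zero => exact fun a => ⟨0, fun b => by simp⟩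
  | add y z hy hz =>
    rw [map_add]
    exact hy.add hz
  | tmul c d =>
    have h : smashComulAct (c ⊗ₜ d) = comulCAct c ∘ₗ comulDAct d :=
      LinearMap.ext fun z => smashComulAct_tmul c d z
    rw [h]
    exact (hasRightAction_comulCAct c).comp (hasRightAction_comulDAct d)

/-! ### Module property and multiplicativity of the left action. -/

theorem smashComulAct_apply_mul (s : C ⊗[ℂ] D) (a b : SmashProduct C D ⊗[ℂ] SmashProduct C D) :
    smashComulAct s (a * b) = smashComulAct s a * b := by
  have e1 : ∀ (c : C) (a b : SmashProduct C D ⊗[ℂ] SmashProduct C D),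
      comulCAct c (a * b) = comulCAct c a * b := by
    intro c a b
    induction a using TensorProduct.induction_on with
    | zero => simp
    | add y z hy hz => simp only [map_add, add_mul, hy, hz]
    | tmul x y =>
      induction b using TensorProduct.induction_on with
      | zero => simp
      | add y z hy hz => simp only [map_add, mul_add, hy, hz]
      | tmul x' y' => rw [comulCAct_tmul_mul, Algebra.TensorProduct.tmul_mul_tmul]
  have e2 : ∀ (d : D) (a b : SmashProduct C D ⊗[ℂ] SmashProduct C D),
      comulDAct d (a * b) = comulDAct d a * b := by
    intro c a b
    induction a using TensorProduct.induction_on with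
    | zero => simp
    | add y z hy hz => simp only [map_add, add_mul, hy, hz]
    | tmul x y =>
      induction b using TensorProduct.induction_on with
      | zero => simp
      | add y z hy hz => simp only [map_add, mul_add, hy, hz]
      | tmul x' y' => rw [comulDAct_tmul_mul, Algebra.TensorProduct.tmul_mul_tmul]
  induction s using TensorProduct.induction_on with
  | zero => simp
  | add y z hy hz => simp only [map_add, LinearMap.add_apply, add_mul, hy, hz]
  | tmul c d => rw [smashComulAct_tmul, smashComulAct_tmul, e2, e1]

/-- The left action of the smash coproduct is multiplicative. -/
theorem smashComulAct_mul (hmul : PMulCondition C D) (hcomul : PComulCondition C D)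
    (htwist : PTwistCondition C D) (x y : SmashProduct C D) :
    smashComulAct ((equiv C D).symm (x * y)) =
      smashComulAct ((equiv C D).symm x) ∘ₗ smashComulAct ((equiv C D).symm y) := by
  refine LinearMap.ext fun z => ?_
  rw [LinearMap.comp_apply]
  induction x using induction with
  | zero => simp
  | add a b ha hb => simp only [smash_add_mul, map_add, LinearMap.add_apply, ha, hb]
  | tmul c d =>
    induction y using induction with
    | zero => simp
    | add a b ha hb => simp only [mul_add, map_add, LinearMap.add_apply, ha, hb]
    | tmul c' d' =>
      rw [mul_def, LinearEquiv.symm_apply_apply, LinearEquiv.symm_apply_apply,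
        LinearEquiv.symm_apply_apply, smashComulAct_tmul, smashComulAct_tmul,
        comulDAct_comulCAct hcomul htwist]
      generalize twist D C (d ⊗ₜ c') = s
      induction s using TensorProduct.induction_on with
      | zero => simp
      | add y z hy hz => simp only [map_add, LinearMap.add_apply, hy, hz]
      | tmul a b =>
        rw [TensorProduct.map_tmul, LinearMap.mulLeft_apply, LinearMap.mulRight_apply,
          smashComulAct_tmul, smashComulAct_tmul, comulCAct_mul, comulDAct_mul hmul]

/-- A map is the smash coproduct if and only if it has the expected left action. -/
theorem isSmashCoproduct_iff
    (Δ' : SmashProduct C D →ₗ[ℂ] Multiplier (SmashProduct C D ⊗[ℂ] SmashProduct C D)) :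
    IsSmashCoproduct C D Δ' ↔ ∀ x, (Δ' x).left = smashComulAct ((equiv C D).symm x) := by
  constructor
  · intro h x
    induction x using induction with
    | zero => rw [map_zero, map_zero, map_zero]; rfl
    | add a b ha hb =>
      rw [map_add, map_add, map_add, ← ha, ← hb]
      rfl
    | tmul c d =>
      refine TensorProduct.ext' fun x y => ?_
      -- Every y is of the form e y, so the defining formula covers all x ⊗ y.
      obtain ⟨e, he⟩ := exists_mulD_eq_self y
      rw [← he, h, LinearEquiv.symm_apply_apply, smashComulAct_tmul, comulDAct_tmul_mulD]
      rfl
  · intro h c d d' x y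
    rw [h, LinearEquiv.symm_apply_apply, smashComulAct_tmul, comulDAct_tmul_mulD]
    rfl

end SmashProduct

end

/-! ### The smash coproduct: existence, uniqueness, multiplicativity. -/

open SmashProduct

theorem theorem3p16 (C D : Type*)
    [NonUnitalRing C] [Module ℂ C] [IsScalarTower ℂ C C] [SMulCommClass ℂ C C]
    [RegularMultiplierHopfAlgebra C]
    [NonUnitalRing D] [Module ℂ D] [IsScalarTower ℂ D D] [SMulCommClass ℂ D D]
    [RegularMultiplierHopfAlgebra D]
    [LeftModuleAlgebra D C] [RightCoaction C D] [RightComoduleCoalgebra C D]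
    (hmul : PMulCondition C D)
    (hcomul : PComulCondition C D)
    (htwist : PTwistCondition C D) :
    (∃! Δ' : SmashProduct C D →ₗ[ℂ] Multiplier (SmashProduct C D ⊗[ℂ] SmashProduct C D),
      IsSmashCoproduct C D Δ') ∧
    ∀ Δ' : SmashProduct C D →ₗ[ℂ] Multiplier (SmashProduct C D ⊗[ℂ] SmashProduct C D),
      IsSmashCoproduct C D Δ' → ∀ x y : SmashProduct C D, Δ' (x * y) = Δ' x * Δ' y := by
  have hext : ∀ m n : Multiplier (SmashProduct C D ⊗[ℂ] SmashProduct C D),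
      m.left = n.left → m = n := fun m n h => Multiplier.ext_left tensor_eq_zero_of_forall_mul h
  refine ⟨?_, fun Δ' hΔ x y => ?_⟩
  · have hex : ∀ x : SmashProduct C D,
        ∃ m : Multiplier (SmashProduct C D ⊗[ℂ] SmashProduct C D),
          m.left = smashComulAct ((SmashProduct.equiv C D).symm x) := fun x =>
      Multiplier.exists_left_eq tensor_mul_assoc tensor_eq_zero_of_forall_mul _
        (smashComulAct_apply_mul _) (hasRightAction_smashComulAct _)
    choose m hm using hex
    let Δ' : SmashProduct C D →ₗ[ℂ] Multiplier (SmashProduct C D ⊗[ℂ] SmashProduct C D) :=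
      { toFun := m
        map_add' := fun x y => hext _ _ <| by
          change (m (x + y)).left = (m x).left + (m y).left
          rw [hm, hm, hm, map_add, map_add]
        map_smul' := fun r x => hext _ _ <| by
          change (m (r • x)).left = r • (m x).left
          rw [hm, hm, map_smul, map_smul] }
    refine ⟨Δ', (isSmashCoproduct_iff Δ').2 hm, fun Δ'' hΔ => LinearMap.ext fun x => ?_⟩
    apply hext
    rw [(isSmashCoproduct_iff Δ'').1 hΔ]
    exact (hm x).symm
  · apply hext
    rw [isSmashCoproduct_iff] at hΔ
    rw [Multiplier.left_mul, hΔ, hΔ, hΔ, smashComulAct_mul hmul hcomul htwist]
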